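/- **Conventions.** Let $\mathcal A$ be a finite alphabet and $\tau:\mathcal A\to\mathcal A^+$ a substitution, extended to words and to one-sided sequences by concatenation. Let $\mathcal L_\tau$ be the set of subwords of the words $\tau^n(a)$ ($n\ge 1$, $a\in\mathcal A$), let $X_\tau\subset\mathcal A^{\mathbb N}$ be the set of sequences all of whose words lie in $\mathcal L_\tau$, with the topology induced by the product topology, and let $\sigma$ be the shift on $X_\tau$. * A *generating fixed point* of $\tau$ is a sequence $u$ with $\tau(u)=u$ in which every letter of $\mathcal A$ occurs, such that $\mathcal L_\tau$ is the set of words occurring in $u$ and $|\tau^n(u_0)|\to\infty$. * $\tau$ is *reasonable*, with fixed point $u$, if $u$ is a generating fixed point; every forward $\sigma$-orbit in $X_\tau$ is dense in $X_\tau$; for every $n$ the map $a\mapsto\tau^n(a)$ is injective on $\mathcal A$; and $\tau$ is (unilaterally) recognizable, i.e. with $E=\{|\tau(u_0\cdots u_{p-1})|:p\ge 0\}$ there is $L$ such that $u_{[i,i+L-1]}=u_{[j,j+L-1]}$ and $i\in E$ imply $j\in E$. * $\tau$ is *left proper* if all words $\tau(a)$ have the same first letter, and *primitive* if for some $k\ge1$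 every letter occurs in every $\tau^k(a)$. * A *branch point* is a point of $X_\tau$ with at least two $\sigma$-preimages in $X_\tau$; $\tau$ is *quasi-invertible* if there is exactly one branch point. * An ordered Bratteli diagram $\mathcal B$ has finite vertex sets $\mathcal V_0=\{v_0\},\mathcal V_1,\dots$ and finite edge sets $\mathcal E_n$ ($n\ge1$) with surjective source and range maps $\mathcal E_n\to\mathcal V_{n-1}$, $\mathcal E_n\to\mathcal V_n$, and a linear order on the set of edges with a given range. It is *stationary* if, after an identification of the sets $\mathcal V_n$ ($n\ge1$) with each other, the ordered edge sets $\mathcal E_n$, $n\ge2$, all coincide. It is *simple* if some telescoping has an edge between any two vertices of consecutive levels, and *semi-proper* if it is simple and has a unique infinite path $x_{\min}$ all of whose edges are minimal. Then $V_{\mathcal B}$ is the map on the space $X_{\mathcal B}$ of infinite paths that sends a non-maximal path to its successor and every maximal path to $x_{\min}$. * The *diagram associated with* a primitive substitution $\tau$ has $\mathcal V_n=\mathcal A$ for $n\ge1$, one edge from $v_0$ to each vertex of $\mathcal V_1$, and, for $n\ge2$, as $i$-th edge with range $a\in\mathcal V_n$ an edge whose source is the $i$-th letter of $\tau(a)$.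 * Let $\rho$ be a substitution. Put $A_1=\mathcal A$ and, inductively, let $s_k$ be the maximal common proper suffix of the words $\rho(a)$, $a\in A_k$, and $A_{k+1}$ the set of letters preceding $s_k$ in these words. Say that $\rho$ *has the stable ending* $s$ if every $A_k$ has at least two elements and $s_k=s$ for all $k\ge1$. If moreover $s$ is non-empty, write $\rho(a)=w_a s$; the *modified substitution* is $\rho^*(a)=s\,w_a$. **Theorem.** Let $\tau$ be left proper, reasonable with fixed point $u$, and quasi-invertible, with branch point $y$. 1. There is a stationary, semi-proper ordered Bratteli diagram $\mathcal B$ such that $(X_{\mathcal B},V_{\mathcal B})$ is topologically conjugate to $(X_\tau,\sigma)$. 2. If $y=u$, then $\tau$ is primitive and its associated diagram is stationary and semi-proper, and can be taken as $\mathcal B$ in 1. 3. Suppose that for some $m\ge1$ the power $\tau^m$ has a non-empty stable ending, and let $\tau^*=(\tau^m)^*$ be the modified substitution. Then $y\ne u$, $X_{\tau^*}=X_\tau$, and $\tau^*$ is left proper, primitive, and reasonable with fixed point $y$. The diagram associated with $\tau^*$ is stationary and semi-proper, and can be taken as $\mathcal B$ in 1. -/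

import Mathlib

universe u

/-! ### Dynamical systems -/

section Systems

/-- Every forward orbit is dense. -/
def IsMinimalMap {Y : Type*} [TopologicalSpace Y] (T : Y → Y) : Prop :=
  ∀ x : Y, Dense (Set.range fun n : ℕ => T^[n] x)

/-- `y` has at least two preimages under `T`. -/
def IsBranchPoint {Y : Type*} (T : Y → Y) (y : Y) : Prop :=
  ∃ x x' : Y, x ≠ x' ∧ T x = y ∧ T x' = y

/-- `T` has exactly one branch point. -/
def IsQuasiInvertible {Y : Type*} (T : Y → Y) : Prop :=
  ∃! y : Y, IsBranchPoint T y

/-- Topological conjugacy of `(Y, T)` and `(Z, S)`. -/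
def IsTopConjugate {Y Z : Type*} [TopologicalSpace Y] [TopologicalSpace Z]
    (T : Y → Y) (S : Z → Z) : Prop :=
  ∃ F : Y ≃ₜ Z, ∀ y : Y, F (T y) = S (F y)

end Systems

/-! ### Substitutions and their one-sided subshifts -/

/-- The word `x m, x (m + 1), …, x (m + k - 1)` of the sequence `x`. -/
def seqWord {A : Type u} (x : ℕ → A) (m k : ℕ) : List A :=
  List.ofFn fun i : Fin k => x (m + i)

/-- The set of words occurring in the sequence `x`. -/
def seqLanguage {A : Type u} (x : ℕ → A) : Set (List A) :=
  {w | ∃ m k : ℕ, w = seqWord x m k}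

/-- A map from letters to nonempty words. -/
structure Substitution (A : Type u) where
  toFun : A → List A
  ne_nil : ∀ a, toFun a ≠ []

namespace Substitution

variable {A : Type u}

/-- The extension to words by concatenation. -/
def onWord (τ : Substitution A) (w : List A) : List A :=
  w.flatMap τ.toFun

/-- The word `τⁿ(a)`. -/
def iter (τ : Substitution A) (n : ℕ) (a : A) : List A :=
  τ.onWord^[n] [a]

/-- Substituting does not shorten words. -/
theorem length_le_onWord (τ : Substitution A) (w : List A) :
    w.length ≤ (τ.onWord w).length := by
  induction w with
  | nil => simp
  | cons a w ih =>
    have h : 0 < (τ.toFun a).length := List.length_pos_of_ne_nil (τ.ne_nil a)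
    simp only [onWord, List.flatMap_cons, List.length_append, List.length_cons] at ih ⊢
    omega

theorem one_le_length_iter (τ : Substitution A) (n : ℕ) (a : A) :
    1 ≤ (τ.iter n a).length := by
  induction n with
  | zero => simp [iter]
  | succ n ih =>
    have h := τ.length_le_onWord (τ.iter n a)
    simp only [iter, Function.iterate_succ_apply'] at ih h ⊢
    omega

/-- The substitution `a ↦ τᵐ(a)`. -/
def pow (τ : Substitution A) (m : ℕ) : Substitution A where
  toFun := τ.iter m
  ne_nil a := List.ne_nil_of_length_pos (τ.one_le_length_iter m a)

/-- The extension `x ↦ τ(x 0) τ(x 1) τ(x 2) …` to infinite sequences. -/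
def onSeq (τ : Substitution A) (x : ℕ → A) : ℕ → A := fun i =>
  (τ.onWord (seqWord x 0 (i + 1)))[i]'(by
    have h := τ.length_le_onWord (seqWord x 0 (i + 1))
    have h' : (seqWord x 0 (i + 1)).length = i + 1 := by simp [seqWord]
    omega)

/-- All words `τ(a)` start with the same letter. -/
def IsLeftProper (τ : Substitution A) : Prop :=
  ∃ l : A, ∀ a : A, (τ.toFun a).head? = some l

/-- For some `k ≥ 1`, every letter occurs in every `τᵏ(a)`. -/
def IsPrimitive (τ : Substitution A) : Prop :=
  ∃ k : ℕ, 1 ≤ k ∧ ∀ a b : A, b ∈ τ.iter k a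

/-- The language of `τ`: all subwords of the words `τⁿ(a)`, `n ≥ 1`. -/
def language (τ : Substitution A) : Set (List A) :=
  {w | ∃ n : ℕ, 1 ≤ n ∧ ∃ a : A, w <:+: τ.iter n a}

/-- The one-sided substitution subshift `X_τ`. -/
def subshift (τ : Substitution A) : Set (ℕ → A) :=
  {x | ∀ m k : ℕ, seqWord x m k ∈ τ.language}

/-- The shift on `X_τ`. -/
def shift (τ : Substitution A) (x : τ.subshift) : τ.subshift :=
  ⟨fun n => x.1 (n + 1), fun m k => by
    have h := x.2 (m + 1) k
    have e : seqWord (fun n => x.1 (n + 1)) m k = seqWord x.1 (m + 1) k := by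
      simp only [seqWord, Nat.add_right_comm]
    rw [e]
    exact h⟩

/-- `u` is a fixed point of `τ` in which all letters occur, which has the same language
as `τ`, and whose first letter grows without bound under `τ`. -/
structure IsGeneratingFixedPoint (τ : Substitution A) (u : ℕ → A) : Prop where
  fixed : τ.onSeq u = u
  letters : ∀ a : A, ∃ i : ℕ, u i = a
  language_eq : τ.language = seqLanguage u
  growth : Filter.Tendsto (fun n : ℕ => (τ.iter n (u 0)).length) Filter.atTop Filter.atTop

/-- The set of cuttings `{|τ(u 0 … u (p - 1))| : p ≥ 0}` of `u`. -/
def cuttings (τ : Substitution A) (u : ℕ → A) : Set ℕ :=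
  {n | ∃ p : ℕ, n = (τ.onWord (seqWord u 0 p)).length}

/-- Unilateral recognizability, with respect to the fixed point `u`. -/
def IsRecognizable (τ : Substitution A) (u : ℕ → A) : Prop :=
  ∃ L : ℕ, ∀ i j : ℕ, seqWord u i L = seqWord u j L →
    i ∈ τ.cuttings u → j ∈ τ.cuttings u

/-- `τ` is minimal with generating fixed point `u`, recognizable, and all its powers are
injective on letters. -/
structure IsReasonable [TopologicalSpace A] (τ : Substitution A) (u : ℕ → A) : Prop where
  generating : τ.IsGeneratingFixedPoint u
  minimal : IsMinimalMap τ.shift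
  recognizable : τ.IsRecognizable u
  injective : ∀ n : ℕ, Function.Injective (τ.iter n)

/-- Let `S 0` be the whole alphabet and, as long as this makes sense, let `s k` be the maximal
common proper terminal subword of the words `τ(a)`, `a ∈ S k`, and let `S (k + 1)` be the set
of letters that precede `s k` in these words. The statement says that this procedure never
breaks down (every `S k` has at least two elements) and that `s k = s` for all `k`. -/
def HasStableEnding (τ : Substitution A) (s : List A) : Prop :=
  ∃ S : ℕ → Set A, S 0 = Set.univ ∧ ∀ k : ℕ,
    (S k).Nontrivial ∧
    (∀ a ∈ S k, ∃ (p : List A) (x : A), τ.toFun a = p ++ x :: s) ∧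
    S (k + 1) = {x | ∃ a ∈ S k, ∃ p : List A, τ.toFun a = p ++ x :: s}

/-- `τ'(a)` is obtained from `τ(a)` by moving its terminal subword `s` to the front. -/
def IsRotationBy (τ τ' : Substitution A) (s : List A) : Prop :=
  ∀ a : A, ∃ w : List A, τ.toFun a = w ++ s ∧ τ'.toFun a = s ++ w

theorem IsPrimitive.exists_mem {τ : Substitution A} (h : τ.IsPrimitive) (b : A) :
    ∃ a : A, b ∈ τ.toFun a := by
  obtain ⟨k, hk, h⟩ := h
  obtain ⟨n, rfl⟩ : ∃ n, k = n + 1 := ⟨k - 1, by omega⟩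
  have hb := h b b
  simp only [iter, Function.iterate_succ_apply'] at hb
  obtain ⟨a, -, ha⟩ := List.mem_flatMap.1 hb
  exact ⟨a, ha⟩

end Substitution

/-! ### Ordered Bratteli diagrams and adic systems -/

/-- An ordered Bratteli diagram. `E n` is the set of edges from level `n` to level `n + 1`.
Edges are comparable exactly if they have the same range, so that the edges with a given
range are linearly ordered. -/
structure OrderedBratteliDiagram where
  V : ℕ → Type u
  E : ℕ → Type u
  finite_V : ∀ n, Finite (V n)
  finite_E : ∀ n, Finite (E n)
  root : ∃ v₀ : V 0, ∀ v : V 0, v = v₀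
  source : ∀ {n}, E n → V n
  range : ∀ {n}, E n → V (n + 1)
  source_surjective : ∀ n, Function.Surjective (source (n := n))
  range_surjective : ∀ n, Function.Surjective (range (n := n))
  order : ∀ n, PartialOrder (E n)
  comparable_iff : ∀ {n} (e f : E n), (e ≤ f ∨ f ≤ e) ↔ range e = range f

attribute [instance] OrderedBratteliDiagram.order

namespace OrderedBratteliDiagram

/-- Edge sets carry the discrete topology. -/
instance (B : OrderedBratteliDiagram.{u}) (n : ℕ) : TopologicalSpace (B.E n) := ⊥

instance (B : OrderedBratteliDiagram.{u}) (n : ℕ) : DiscreteTopology (B.E n) := ⟨rfl⟩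

/-- The space `X_B` of infinite paths, with the topology induced by the product topology. -/
abbrev Path (B : OrderedBratteliDiagram.{u}) : Type u :=
  {x : ∀ n, B.E n // ∀ n, B.source (x (n + 1)) = B.range (x n)}

/-- `Reaches a n b`: there is a finite path from `a` to the vertex `b` of level `n`. -/
inductive Reaches (B : OrderedBratteliDiagram.{u}) {m : ℕ} (a : B.V m) :
    (n : ℕ) → B.V n → Prop
  | refl : Reaches B a m a
  | step {n : ℕ} (e : B.E n) : Reaches B a n (B.source e) → Reaches B a (n + 1) (B.range e)

/-- Some telescoping has an edge between any two vertices of consecutive levels. -/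
def IsSimple (B : OrderedBratteliDiagram.{u}) : Prop :=
  ∃ N : ℕ → ℕ, N 0 = 0 ∧ StrictMono N ∧
    ∀ (k : ℕ) (a : B.V (N k)) (b : B.V (N (k + 1))), B.Reaches a (N (k + 1)) b

/-- All edges of the path are minimal. -/
def IsMinPath (B : OrderedBratteliDiagram.{u}) (x : B.Path) : Prop :=
  ∀ n, IsMin (x.1 n)

/-- All edges of the path are maximal. -/
def IsMaxPath (B : OrderedBratteliDiagram.{u}) (x : B.Path) : Prop :=
  ∀ n, IsMax (x.1 n)

/-- Simple, with a unique minimal path. -/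
def IsSemiProper (B : OrderedBratteliDiagram.{u}) : Prop :=
  B.IsSimple ∧ ∃! x : B.Path, B.IsMinPath x

/-- From level `1` on, the ordered diagram repeats: the vertices of all levels `≥ 1` can be
identified in such a way that the ordered edge sets between consecutive levels coincide. -/
def IsStationary (B : OrderedBratteliDiagram.{u}) : Prop :=
  ∃ (f : ∀ n, B.V (n + 1) ≃ B.V (n + 2)) (g : ∀ n, B.E (n + 1) ≃o B.E (n + 2)),
    ∀ (n : ℕ) (e : B.E (n + 1)),
      B.source (g n e) = f n (B.source e) ∧ B.range (g n e) = f (n + 1) (B.range e)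

/-- `z` is the successor of the non-maximal path `x`: the first non-maximal edge of `x` is
replaced by its successor, the edges before it by minimal ones, and the rest is kept. -/
def IsSuccessor (B : OrderedBratteliDiagram.{u}) (x z : B.Path) : Prop :=
  ∃ k : ℕ, (∀ i < k, IsMax (x.1 i)) ∧ x.1 k ⋖ z.1 k ∧
    (∀ i < k, IsMin (z.1 i)) ∧ ∀ i, k < i → z.1 i = x.1 i

/-- `T` is the Vershik map: it sends a non-maximal path to its successor and a maximal path
to a minimal one (the minimal one, if the diagram is semi-proper). -/
def IsVershikMap (B : OrderedBratteliDiagram.{u}) (T : B.Path → B.Path) : Prop :=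
  ∀ x : B.Path, (¬ B.IsMaxPath x → B.IsSuccessor x (T x)) ∧
    (B.IsMaxPath x → B.IsMinPath (T x))

/-- `B` is semi-proper, and the adic system `(X_B, V_B)` is topologically conjugate
to `(Y, T)`. -/
def IsSemiProperModel (B : OrderedBratteliDiagram.{u}) {Y : Type*} [TopologicalSpace Y]
    (T : Y → Y) : Prop :=
  B.IsSemiProper ∧ ∃ V : B.Path → B.Path, B.IsVershikMap V ∧ IsTopConjugate V T

end OrderedBratteliDiagram

namespace Substitution

variable {A : Type u}

/-- Vertices of the diagram of a substitution: one at level `0`, the letters above. -/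
def DiagramV (A : Type u) : ℕ → Type u
  | 0 => PUnit
  | _ + 1 => A

/-- Edges of the diagram of a substitution: one edge from the root to each letter; above
level `1`, the edges with range `a` are the positions in the word `τ(a)`. -/
def DiagramE (τ : Substitution A) : ℕ → Type u
  | 0 => A
  | _ + 1 => Σ a : A, Fin (τ.toFun a).length

/-- The Bratteli diagram associated with a primitive substitution: the source of the `i`-th
edge with range `a` is the `i`-th letter of `τ(a)`. -/
def diagram [Finite A] [Nonempty A] (τ : Substitution A) (h : τ.IsPrimitive) :
    OrderedBratteliDiagram.{u} where
  V := DiagramV A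
  E := τ.DiagramE
  finite_V
    | 0 => inferInstanceAs (Finite PUnit)
    | _ + 1 => inferInstanceAs (Finite A)
  finite_E
    | 0 => inferInstanceAs (Finite A)
    | _ + 1 => inferInstanceAs (Finite (Σ a : A, Fin (τ.toFun a).length))
  root := ⟨PUnit.unit, fun _ => rfl⟩
  source {n} :=
    match n with
    | 0 => fun _ => PUnit.unit
    | _ + 1 => fun e => (τ.toFun e.1)[e.2]
  range {n} :=
    match n with
    | 0 => fun a => a
    | _ + 1 => fun e => e.1
  source_surjective
    | 0 => fun _ => ⟨Classical.arbitrary A, rfl⟩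
    | _ + 1 => fun b => by
        obtain ⟨a, ha⟩ := h.exists_mem b
        obtain ⟨i, hi, e⟩ := List.mem_iff_getElem.1 ha
        exact ⟨⟨a, ⟨i, hi⟩⟩, e⟩
  range_surjective
    | 0 => fun a => ⟨a, rfl⟩
    | _ + 1 => fun a =>
        ⟨⟨a, ⟨0, List.length_pos_of_ne_nil (τ.ne_nil a)⟩⟩, rfl⟩
  order
    | 0 =>
      { le := fun a b : A => a = b
        le_refl := fun _ => rfl
        le_trans := fun _ _ _ => Eq.trans
        le_antisymm := fun _ _ e _ => e }
    | _ + 1 => inferInstanceAs (PartialOrder (Σ a : A, Fin (τ.toFun a).length))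
  comparable_iff {n} :=
    match n with
    | 0 => fun _ _ => ⟨fun e => e.elim id Eq.symm, Or.inl⟩
    | _ + 1 => fun e f => by
        obtain ⟨a, i⟩ := e
        obtain ⟨b, j⟩ := f
        refine ⟨?_, ?_⟩
        · rintro (⟨_, _, _⟩ | ⟨_, _, _⟩) <;> rfl
        · intro hab
          obtain rfl : a = b := hab
          exact (le_total i j).imp (fun h => Sigma.mk_le_mk_iff.2 h) (fun h => Sigma.mk_le_mk_iff.2 h)

end Substitution

/-! Write `X` for the subshift, `σ` for the shift, `y` for the branch point and `θ` for a power of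
`τ`. Recognizability of the fixed point passes to all of `X` (`IsReasonable.isRecognizableOn`): `θ`
is injective on `X`, its image is clopen, and the cuttings of `θ(z)` can be read off the sequence.
Distinct orbits of `σ` can merge only at `y`. So if a clopen set `W` contains `y`, every point has a
unique last visit to `W` in its past although `σ` is not invertible, and `X` is a tower over `W`
(`IsTowerBase`). A nested sequence of towers whose positions are the edges of a semi-proper diagram
yields a continuous map to paths. It turns `σ` into the Vershik map, since leaving a tower at the
top is a carry; it is onto by compactness, and it is a conjugacy as soon as paths separate points
(`TowerSequence.isSemiProperModel`).

If `θ` is left proper and fixes `y`, take `W = θ(X)`. Each `x` is `σ^k θ(z)` with `k` inside the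
first block, and iterating `x ↦ z` produces a path in the diagram of `θ`. Two points with the same
path agree on one letter more for each level, because all images begin with the same letter
(`Substitution.isSemiProperModel_diagram`). This settles the case `y = u`. It also settles stable
endings: the modified substitution acts on sequences as `x ↦ s θ(x)` and inherits recognizability,
and the words `s θ(s) ⋯ θⁿ(s)` can be preceded by two different letters, so their limit is `y`, a
fixed point of the modified substitution (`exists_isBranchPoint_of_hasStableEnding`).

In general two preimages of `y` still produce a word `s` with `y = s θ(y)`: behind the longest
common suffix `s` of the images of their first letters, `s θ(y)` has two preimages, so it must be
`y` (`exists_suffix_of_isBranchPoint`). The map `φ(z) = s θ(z)` is defined on a cylinder `U` around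
`y`, sends `U` onto a clopen subset of `U`, and fixes `y`. It conjugates the first return map on `U`
to the one on `φ(U)`, so the towers of `U` over `φ(U)` repeat at every level: vertices are the
return words to `U`, edges are the visits to `U` inside the image of a return word
(`ReturnSystem.isSemiProperModel_diagram`). The power `θ` is taken so large that every `φ(z)` begins
with the return word of `y`, which gives a unique minimal path, and that agreement grows under `φ`,
which separates points. -/

/-! ### Prefixing words to sequences and dropping prefixes. -/

section Sequences

variable {A : Type u}

/-- The sequence `x n, x (n + 1), …`. -/
def seqDrop (n : ℕ) (x : ℕ → A) : ℕ → A := fun i => x (n + i)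

/-- The word `w` followed by the sequence `x`. -/
def seqAppend (w : List A) (x : ℕ → A) : ℕ → A := fun i =>
  if h : i < w.length then w[i] else x (i - w.length)

@[simp] theorem seqDrop_apply (n : ℕ) (x : ℕ → A) (i : ℕ) : seqDrop n x i = x (n + i) := rfl

@[simp] theorem seqDrop_zero (x : ℕ → A) : seqDrop 0 x = x := by
  funext i; simp

theorem seqDrop_seqDrop (m n : ℕ) (x : ℕ → A) : seqDrop m (seqDrop n x) = seqDrop (n + m) x := by
  funext i; simp [Nat.add_assoc]

theorem seqAppend_apply_of_lt {w : List A} {i : ℕ} (h : i < w.length) (x : ℕ → A) :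
    seqAppend w x i = w[i] := by
  simp [seqAppend, h]

theorem seqAppend_apply_add (w : List A) (x : ℕ → A) (i : ℕ) :
    seqAppend w x (w.length + i) = x i := by
  simp [seqAppend]

theorem seqAppend_append (w v : List A) (x : ℕ → A) :
    seqAppend (w ++ v) x = seqAppend w (seqAppend v x) := by
  funext i
  rcases lt_or_ge i w.length with h | h
  · rw [seqAppend_apply_of_lt (by simp; omega), seqAppend_apply_of_lt h,
      List.getElem_append_left h]
  · obtain ⟨j, rfl⟩ := Nat.exists_eq_add_of_le h
    rw [seqAppend_apply_add]
    rcases lt_or_ge j v.length with h' | h'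
    · rw [seqAppend_apply_of_lt (by simp; omega), seqAppend_apply_of_lt h',
        List.getElem_append_right h]
      simp
    · obtain ⟨k, rfl⟩ := Nat.exists_eq_add_of_le h'
      rw [seqAppend_apply_add, ← Nat.add_assoc, ← List.length_append, seqAppend_apply_add]

@[simp] theorem seqDrop_length_seqAppend (w : List A) (x : ℕ → A) :
    seqDrop w.length (seqAppend w x) = x := by
  funext i; simp [seqAppend_apply_add]

@[simp] theorem length_seqWord (x : ℕ → A) (m k : ℕ) : (seqWord x m k).length = k := by
  simp [seqWord]

@[simp] theorem getElem_seqWord (x : ℕ → A) (m k i : ℕ) (h : i < (seqWord x m k).length) :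
    (seqWord x m k)[i] = x (m + i) := by
  simp [seqWord]

@[simp] theorem seqWord_zero_right (x : ℕ → A) (m : ℕ) : seqWord x m 0 = [] := by
  simp [seqWord]

theorem seqWord_one (x : ℕ → A) (m : ℕ) : seqWord x m 1 = [x m] := by
  simp [seqWord]

theorem seqWord_eq_iff {x y : ℕ → A} {m n k : ℕ} :
    seqWord x m k = seqWord y n k ↔ ∀ i < k, x (m + i) = y (n + i) := by
  constructor
  · intro h i hi
    have h1 : (seqWord x m k)[i]'(by simpa) = (seqWord y n k)[i]'(by simpa) := by
      simp only [h]
    simpa using h1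
  · intro h
    apply List.ext_getElem (by simp)
    intro i h1 h2
    simpa using h i (by simpa using h1)

theorem eq_seqWord_iff {x : ℕ → A} {m : ℕ} {w : List A} :
    seqWord x m w.length = w ↔ ∀ i (h : i < w.length), x (m + i) = w[i] := by
  constructor
  · intro h i hi
    have h1 : (seqWord x m w.length)[i]'(by simpa) = w[i] := by
      simp only [h]
    simpa using h1
  · intro h
    apply List.ext_getElem (by simp)
    intro i h1 h2
    simpa using h i (by simpa using h1)

theorem seqWord_add (x : ℕ → A) (m k j : ℕ) :
    seqWord x m (k + j) = seqWord x m k ++ seqWord x (m + k) j := by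
  apply List.ext_getElem (by simp)
  intro i h1 h2
  rcases lt_or_ge i k with h | h
  · rw [List.getElem_append_left (by simpa)]; simp
  · rw [List.getElem_append_right (by simpa)]
    simp only [getElem_seqWord, length_seqWord]
    congr 1; omega

theorem seqWord_length_seqAppend (w : List A) (x : ℕ → A) :
    seqWord (seqAppend w x) 0 w.length = w := by
  rw [eq_seqWord_iff]
  intro i h
  rw [Nat.zero_add, seqAppend_apply_of_lt h]

theorem seqWord_seqAppend_add (w : List A) (x : ℕ → A) (k : ℕ) :
    seqWord (seqAppend w x) 0 (w.length + k) = w ++ seqWord x 0 k := by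
  rw [seqWord_add, seqWord_length_seqAppend, Nat.zero_add]
  congr 1
  rw [seqWord_eq_iff]
  intro i _
  rw [seqAppend_apply_add, Nat.zero_add]

theorem seqAppend_seqWord_seqDrop (x : ℕ → A) (p : ℕ) :
    seqAppend (seqWord x 0 p) (seqDrop p x) = x := by
  funext i
  rcases lt_or_ge i p with h | h
  · rw [seqAppend_apply_of_lt (by simpa)]; simp
  · obtain ⟨j, rfl⟩ := Nat.exists_eq_add_of_le h
    have := seqAppend_apply_add (seqWord x 0 p) (seqDrop p x) j
    simpa using this

theorem seqAppend_seqDrop_length {w : List A} {x : ℕ → A}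
    (h : ∀ i (hi : i < w.length), x i = w[i]) : seqAppend w (seqDrop w.length x) = x := by
  have h1 : seqWord x 0 w.length = w := eq_seqWord_iff.2 (by simpa using h)
  conv_rhs => rw [← seqAppend_seqWord_seqDrop x w.length, h1]

end Sequences

/-! ### Substitutions on words and sequences, and their powers. -/

namespace Substitution

variable {A : Type u}

@[simp] theorem onWord_nil (τ : Substitution A) : τ.onWord [] = [] := rfl

theorem onWord_append (τ : Substitution A) (w v : List A) :
    τ.onWord (w ++ v) = τ.onWord w ++ τ.onWord v := by
  simp [onWord]

theorem onWord_cons (τ : Substitution A) (a : A) (w : List A) :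
    τ.onWord (a :: w) = τ.toFun a ++ τ.onWord w := by
  simp [onWord]

theorem onWord_singleton (τ : Substitution A) (a : A) : τ.onWord [a] = τ.toFun a := by
  simp [onWord]

theorem length_toFun_pos (τ : Substitution A) (a : A) : 0 < (τ.toFun a).length :=
  List.length_pos_of_ne_nil (τ.ne_nil a)

theorem length_onWord_seqWord_mono (τ : Substitution A) (x : ℕ → A) {p q : ℕ} (h : p ≤ q) :
    (τ.onWord (seqWord x 0 p)).length ≤ (τ.onWord (seqWord x 0 q)).length := by
  obtain ⟨r, rfl⟩ := Nat.exists_eq_add_of_le h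
  simp [seqWord_add, onWord_append]

theorem le_length_onWord_seqWord (τ : Substitution A) (x : ℕ → A) (m p : ℕ) :
    p ≤ (τ.onWord (seqWord x m p)).length := by
  simpa using τ.length_le_onWord (seqWord x m p)

theorem getElem_onWord_seqWord (τ : Substitution A) (x : ℕ → A) {p q i : ℕ} (h : p ≤ q)
    (hi : i < (τ.onWord (seqWord x 0 p)).length) :
    (τ.onWord (seqWord x 0 q))[i]'(hi.trans_le (τ.length_onWord_seqWord_mono x h)) =
      (τ.onWord (seqWord x 0 p))[i] := by
  obtain ⟨r, rfl⟩ := Nat.exists_eq_add_of_le h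
  simp only [seqWord_add, onWord_append]
  rw [List.getElem_append_left hi]

theorem onSeq_apply (τ : Substitution A) (x : ℕ → A) {p i : ℕ}
    (hi : i < (τ.onWord (seqWord x 0 p)).length) :
    τ.onSeq x i = (τ.onWord (seqWord x 0 p))[i] := by
  have hi' : i < (τ.onWord (seqWord x 0 (i + 1))).length :=
    Nat.lt_of_succ_le (τ.le_length_onWord_seqWord x 0 (i + 1))
  rw [← τ.getElem_onWord_seqWord x (le_max_left p (i + 1)) hi,
    τ.getElem_onWord_seqWord x (le_max_right p (i + 1)) hi']
  rfl

theorem onSeq_seqAppend (τ : Substitution A) (w : List A) (x : ℕ → A) :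
    τ.onSeq (seqAppend w x) = seqAppend (τ.onWord w) (τ.onSeq x) := by
  funext i
  have e : τ.onWord (seqWord (seqAppend w x) 0 (w.length + (i + 1))) =
      τ.onWord w ++ τ.onWord (seqWord x 0 (i + 1)) := by
    rw [seqWord_seqAppend_add, onWord_append]
  have h1 := τ.le_length_onWord_seqWord x 0 (i + 1)
  rw [τ.onSeq_apply (seqAppend w x) (p := w.length + (i + 1)) (by rw [e]; simp; omega)]
  simp only [e]
  rcases lt_or_ge i (τ.onWord w).length with h | h
  · rw [seqAppend_apply_of_lt h, List.getElem_append_left h]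
  · obtain ⟨j, rfl⟩ := Nat.exists_eq_add_of_le h
    rw [seqAppend_apply_add, List.getElem_append_right h,
      τ.onSeq_apply x (p := (τ.onWord w).length + j + 1) (by omega)]
    simp

theorem onSeq_eq_seqAppend (τ : Substitution A) (x : ℕ → A) (p : ℕ) :
    τ.onSeq x = seqAppend (τ.onWord (seqWord x 0 p)) (τ.onSeq (seqDrop p x)) := by
  conv_lhs => rw [← seqAppend_seqWord_seqDrop x p, onSeq_seqAppend]

theorem seqDrop_onSeq (τ : Substitution A) (x : ℕ → A) (p : ℕ) :
    seqDrop (τ.onWord (seqWord x 0 p)).length (τ.onSeq x) = τ.onSeq (seqDrop p x) := by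
  conv_lhs => rw [τ.onSeq_eq_seqAppend x p, seqDrop_length_seqAppend]

theorem seqWord_onSeq (τ : Substitution A) (x : ℕ → A) (p : ℕ) :
    seqWord (τ.onSeq x) 0 (τ.onWord (seqWord x 0 p)).length = τ.onWord (seqWord x 0 p) := by
  conv_lhs => rw [τ.onSeq_eq_seqAppend x p, seqWord_length_seqAppend]

theorem onSeq_agree (τ : Substitution A) {x y : ℕ → A} {p : ℕ} (h : ∀ i < p, x i = y i) {i : ℕ}
    (hi : i < (τ.onWord (seqWord x 0 p)).length) : τ.onSeq x i = τ.onSeq y i := by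
  have e : seqWord x 0 p = seqWord y 0 p := seqWord_eq_iff.2 (by simpa using h)
  rw [τ.onSeq_apply x hi, τ.onSeq_apply y (p := p) (by rwa [← e])]
  simp only [e]

theorem onSeq_agree_of_le (τ : Substitution A) {x y : ℕ → A} {p : ℕ} (h : ∀ i < p, x i = y i)
    {i : ℕ} (hi : i < p) : τ.onSeq x i = τ.onSeq y i :=
  τ.onSeq_agree h (hi.trans_le (τ.le_length_onWord_seqWord x 0 p))

/-- Prefixes of unbounded length suffice, so that two images can be compared at the lengths of
images of prefixes. -/
theorem eq_of_forall_seqWord {x y : ℕ → A} (h : ∀ n, ∃ k ≥ n, seqWord x 0 k = seqWord y 0 k) :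
    x = y := by
  funext i
  obtain ⟨k, hk, e⟩ := h (i + 1)
  simpa using seqWord_eq_iff.1 e i (by omega)

theorem iter_zero (τ : Substitution A) (a : A) : τ.iter 0 a = [a] := rfl

theorem iter_succ (τ : Substitution A) (n : ℕ) (a : A) :
    τ.iter (n + 1) a = τ.onWord (τ.iter n a) := by
  simp only [iter, Function.iterate_succ_apply']

theorem iter_one (τ : Substitution A) (a : A) : τ.iter 1 a = τ.toFun a := by
  simp [iter, onWord_singleton]

theorem onWord_iterate_append (τ : Substitution A) (n : ℕ) (w v : List A) :
    τ.onWord^[n] (w ++ v) = τ.onWord^[n] w ++ τ.onWord^[n] v := by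
  induction n generalizing w v with
  | zero => rfl
  | succ n ih => simp only [Function.iterate_succ_apply, onWord_append, ih]

theorem onWord_iterate_nil (τ : Substitution A) (n : ℕ) : τ.onWord^[n] [] = [] := by
  induction n with
  | zero => rfl
  | succ n ih => simp only [Function.iterate_succ_apply, onWord_nil, ih]

theorem onWord_pow (τ : Substitution A) (m : ℕ) (w : List A) :
    (τ.pow m).onWord w = τ.onWord^[m] w := by
  induction w with
  | nil => simp [onWord_iterate_nil]
  | cons a w ih =>
    rw [onWord_cons, ih, ← List.singleton_append, onWord_iterate_append]
    rfl

theorem onWord_pow_succ (τ : Substitution A) (m : ℕ) (w : List A) :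
    (τ.pow (m + 1)).onWord w = τ.onWord ((τ.pow m).onWord w) := by
  simp only [onWord_pow, Function.iterate_succ_apply']

theorem iter_pow (τ : Substitution A) (m n : ℕ) (a : A) :
    (τ.pow m).iter n a = τ.iter (m * n) a := by
  have : (τ.pow m).onWord = τ.onWord^[m] := funext (τ.onWord_pow m)
  simp only [iter, this, Function.iterate_mul]

theorem onSeq_pow_zero (τ : Substitution A) (x : ℕ → A) : (τ.pow 0).onSeq x = x := by
  apply eq_of_forall_seqWord
  intro n
  have e : (τ.pow 0).onWord (seqWord x 0 n) = seqWord x 0 n := by simp [onWord_pow]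
  refine ⟨n, le_rfl, ?_⟩
  have := (τ.pow 0).seqWord_onSeq x n
  simpa [e] using this

theorem onSeq_pow_succ (τ : Substitution A) (m : ℕ) (x : ℕ → A) :
    (τ.pow (m + 1)).onSeq x = τ.onSeq ((τ.pow m).onSeq x) := by
  apply eq_of_forall_seqWord
  intro n
  refine ⟨_, (τ.pow (m + 1)).le_length_onWord_seqWord x 0 n, ?_⟩
  rw [seqWord_onSeq]
  have h := τ.seqWord_onSeq ((τ.pow m).onSeq x) ((τ.pow m).onWord (seqWord x 0 n)).length
  simp only [(τ.pow m).seqWord_onSeq, ← onWord_pow_succ] at h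
  exact h.symm

theorem iter_prefix (τ : Substitution A) {u : ℕ → A} (hu : τ.onSeq u = u) (n p : ℕ) :
    seqWord u 0 (τ.onWord^[n] (seqWord u 0 p)).length = τ.onWord^[n] (seqWord u 0 p) := by
  induction n with
  | zero => simp
  | succ n ih =>
    have h := τ.seqWord_onSeq u (τ.onWord^[n] (seqWord u 0 p)).length
    rw [hu, ih] at h
    simpa only [Function.iterate_succ_apply'] using h

theorem seqWord_iter (τ : Substitution A) {u : ℕ → A} (hu : τ.onSeq u = u) (n : ℕ) :
    seqWord u 0 (τ.iter n (u 0)).length = τ.iter n (u 0) := by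
  have := τ.iter_prefix hu n 1
  rwa [seqWord_one] at this

end Substitution

/-! ### The topology of sequence spaces in terms of common prefixes. -/

section SequenceSpaces

variable {A : Type u} [TopologicalSpace A] [DiscreteTopology A] {X : Set (ℕ → A)}

theorem isOpen_iff_agree {S : Set X} :
    IsOpen S ↔ ∀ x ∈ S, ∃ N : ℕ, ∀ y : X, (∀ i < N, y.1 i = x.1 i) → y ∈ S := by
  constructor
  · intro h x hx
    obtain ⟨O, hO, rfl⟩ := isOpen_induced_iff.1 h
    obtain ⟨C, ⟨z, N, rfl⟩, hxC, hCO⟩ :=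
      (PiNat.isTopologicalBasis_cylinders (fun _ : ℕ => A)).exists_subset_of_mem_open
        (show x.1 ∈ O from hx) hO
    refine ⟨N, fun y hy => hCO ?_⟩
    rw [PiNat.mem_cylinder_iff] at hxC ⊢
    intro i hi
    rw [hy i hi, hxC i hi]
  · intro h
    rw [isOpen_iff_forall_mem_open]
    intro x hx
    obtain ⟨N, hN⟩ := h x hx
    refine ⟨{y : X | y.1 ∈ PiNat.cylinder x.1 N}, fun y hy => hN y ?_,
      (PiNat.isOpen_cylinder (fun _ : ℕ => A) x.1 N).preimage continuous_subtype_val,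
      PiNat.self_mem_cylinder _ _⟩
    exact PiNat.mem_cylinder_iff.1 hy

theorem isClosed_iff_agree {S : Set X} :
    IsClosed S ↔ ∀ x : X, (∀ N : ℕ, ∃ y ∈ S, ∀ i < N, y.1 i = x.1 i) → x ∈ S := by
  rw [← isOpen_compl_iff, isOpen_iff_agree]
  constructor
  · intro h x hx
    by_contra hxS
    obtain ⟨N, hN⟩ := h x hxS
    obtain ⟨y, hy, e⟩ := hx N
    exact hN y e hy
  · intro h x hxS
    by_contra! hcon
    refine hxS (h x fun N => ?_)
    obtain ⟨y, hy, hyS⟩ := hcon N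
    exact ⟨y, not_not.1 hyS, hy⟩

theorem isOpen_setOf_agree (x : X) (N : ℕ) : IsOpen {y : X | ∀ i < N, y.1 i = x.1 i} := by
  rw [isOpen_iff_agree]
  intro z hz
  exact ⟨N, fun y hy i hi => (hy i hi).trans (hz i hi)⟩

theorem isClopen_setOf_agree (w : ℕ → A) (N : ℕ) : IsClopen {y : X | ∀ i < N, y.1 i = w i} := by
  constructor
  · rw [isClosed_iff_agree]
    intro x hx i hi
    obtain ⟨y, hy, e⟩ := hx N
    rw [← e i hi, hy i hi]
  · rw [isOpen_iff_agree]
    intro z hz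
    exact ⟨N, fun y hy i hi => (hy i hi).trans (hz i hi)⟩

theorem continuous_iff_agree {Y : Set (ℕ → A)} {f : X → Y} :
    Continuous f ↔ ∀ x : X, ∀ M : ℕ, ∃ N : ℕ, ∀ y : X, (∀ i < N, y.1 i = x.1 i) →
      ∀ i < M, (f y).1 i = (f x).1 i := by
  constructor
  · intro h x M
    obtain ⟨N, hN⟩ := isOpen_iff_agree.1 ((isOpen_setOf_agree (f x) M).preimage h) x
      (fun i _ => rfl)
    exact ⟨N, fun y hy => hN y hy⟩
  · intro h
    refine continuous_def.2 fun S hS => isOpen_iff_agree.2 fun x hx => ?_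
    obtain ⟨M, hM⟩ := isOpen_iff_agree.1 hS (f x) hx
    obtain ⟨N, hN⟩ := h x M
    exact ⟨N, fun y hy => hM _ (hN y hy)⟩

omit [DiscreteTopology A] in
theorem compactSpace_of_isClosed [Finite A] (hX : IsClosed X) : CompactSpace X :=
  isCompact_iff_compactSpace.1 hX.isCompact

/-- A clopen subset of a compact space of sequences is determined by prefixes of bounded length. -/
theorem exists_agree_of_isClopen [CompactSpace X] {C : Set X} (hC : IsClopen C) :
    ∃ L : ℕ, ∀ x y : X, (∀ i < L, y.1 i = x.1 i) → x ∈ C → y ∈ C := by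
  obtain ⟨L, hL⟩ := hC.1.isCompact.elim_directed_cover
    (fun N : ℕ => {x : X | ∀ y : X, (∀ i < N, y.1 i = x.1 i) → y ∈ C})
    (fun N => isOpen_iff_agree.2 fun x hx => ⟨N, fun y hy z hz =>
      hx z fun i hi => (hz i hi).trans (hy i hi)⟩)
    (fun x hx => by
      obtain ⟨N, hN⟩ := isOpen_iff_agree.1 hC.2 x hx
      exact Set.mem_iUnion.2 ⟨N, hN⟩)
    (directed_of_isDirected_le fun m n hmn x hx y hy => hx y fun i hi => hy i (by omega))
  exact ⟨L, fun x y hxy hx => hL hx y hxy⟩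

end SequenceSpaces

/-! ### Minimal one-sided subshifts. -/

/-- `T` is the shift on the closed set `X` of sequences, and all its forward orbits are dense. -/
structure IsMinimalSubshift {A : Type u} [TopologicalSpace A] (X : Set (ℕ → A)) (T : X → X) :
    Prop where
  isClosed : IsClosed X
  apply : ∀ (x : X) (n : ℕ), (T x).1 n = x.1 (n + 1)
  minimal : IsMinimalMap T

namespace IsMinimalSubshift

variable {A : Type u} [TopologicalSpace A] {X : Set (ℕ → A)} {T : X → X}

theorem coe_apply (h : IsMinimalSubshift X T) (x : X) : (T x).1 = seqDrop 1 x.1 := by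
  funext i; rw [h.apply, seqDrop_apply, Nat.add_comm]

theorem coe_iterate (h : IsMinimalSubshift X T) (n : ℕ) (x : X) :
    (T^[n] x).1 = seqDrop n x.1 := by
  induction n with
  | zero => simp
  | succ n ih => rw [Function.iterate_succ_apply', h.coe_apply, ih, seqDrop_seqDrop]

theorem seqDrop_mem (h : IsMinimalSubshift X T) {x : ℕ → A} (hx : x ∈ X) (n : ℕ) :
    seqDrop n x ∈ X := by
  have := (T^[n] ⟨x, hx⟩).2
  rwa [h.coe_iterate] at this

variable [DiscreteTopology A]

theorem continuous (h : IsMinimalSubshift X T) : Continuous T :=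
  continuous_iff_agree.2 fun x M => ⟨M + 1, fun y hy i hi => by
    rw [h.apply, h.apply, hy (i + 1) (by omega)]⟩

theorem exists_agree (h : IsMinimalSubshift X T) {x y : ℕ → A} (hx : x ∈ X) (hy : y ∈ X) (N : ℕ) :
    ∃ n : ℕ, ∀ i < N, x (n + i) = y i := by
  obtain ⟨z, hz, n, rfl⟩ := (h.minimal ⟨x, hx⟩).inter_open_nonempty _
    (isOpen_setOf_agree ⟨y, hy⟩ N) ⟨⟨y, hy⟩, fun _ _ => rfl⟩
  refine ⟨n, fun i hi => ?_⟩
  have := hz i hi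
  simp only [h.coe_iterate] at this
  simpa using this

theorem exists_apply_eq (h : IsMinimalSubshift X T) {x y : ℕ → A} (hx : x ∈ X) (hy : y ∈ X)
    (j : ℕ) : ∃ i, x i = y j := by
  obtain ⟨n, hn⟩ := h.exists_agree hx hy (j + 1)
  exact ⟨_, hn j (by omega)⟩

/-- The image is compact, hence closed, and contains the dense forward orbit of one of its points.
-/
theorem surjective [CompactSpace X] (h : IsMinimalSubshift X T) : Function.Surjective T := by
  intro x
  have hc : IsClosed (Set.range T) := (isCompact_range h.continuous).isClosed
  have hsub : closure (Set.range fun n : ℕ => T^[n] (T x)) ⊆ Set.range T := by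
    refine closure_minimal ?_ hc
    rintro _ ⟨n, rfl⟩
    exact ⟨T^[n] x, by simp only [← Function.iterate_succ_apply, Function.iterate_succ_apply']⟩
  rw [(h.minimal (T x)).closure_eq] at hsub
  exact hsub (Set.mem_univ x)

/-- A minimal one-sided subshift in which some point is periodic has an injective shift. -/
theorem injective_of_periodic [CompactSpace X] (h : IsMinimalSubshift X T) {y : X} {t : ℕ}
    (ht : 0 < t) (hy : T^[t] y = y) : Function.Injective T := by
  have hp : ∀ n, T^[t] (T^[n] y) = T^[n] y := fun n => by
    rw [← Function.iterate_add_apply, Nat.add_comm, Function.iterate_add_apply, hy]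
  -- Having period `t` is a closed condition that holds along the dense orbit of `y`; then `T^[t -
  -- 1]` is a left inverse of `T`.
  have hall : ∀ x, T^[t] x = x := by
    intro x
    have hc : IsClosed {x : X | T^[t] x = x} :=
      isClosed_eq (h.continuous.iterate t) continuous_id
    have hsub : closure (Set.range fun n : ℕ => T^[n] y) ⊆ {x : X | T^[t] x = x} := by
      refine closure_minimal ?_ hc
      rintro _ ⟨n, rfl⟩
      exact hp n
    rw [(h.minimal y).closure_eq] at hsub
    exact hsub (Set.mem_univ x)
  obtain ⟨s, rfl⟩ : ∃ s, t = s + 1 := ⟨t - 1, by omega⟩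
  intro a b hab
  rw [← hall a, ← hall b, Function.iterate_succ_apply, Function.iterate_succ_apply, hab]

end IsMinimalSubshift

/-! ### Recognizability on the whole subshift. -/

namespace Substitution

variable {A : Type u}

theorem language_infix {τ : Substitution A} {w v : List A} (h : w <:+: v) (hv : v ∈ τ.language) :
    w ∈ τ.language := by
  obtain ⟨n, hn, a, ha⟩ := hv
  exact ⟨n, hn, a, h.trans ha⟩

theorem mem_subshift_of_frequently {τ : Substitution A} {x : ℕ → A}
    (h : ∀ n : ℕ, ∃ k ≥ n, seqWord x 0 k ∈ τ.language) : x ∈ τ.subshift := by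
  intro m k
  obtain ⟨j, hj, hw⟩ := h (m + k)
  refine language_infix ?_ hw
  obtain ⟨r, rfl⟩ := Nat.exists_eq_add_of_le hj
  rw [seqWord_add, seqWord_add, Nat.zero_add]
  exact ⟨_, _, rfl⟩

theorem mem_subshift_iff_of_language_eq {τ : Substitution A} {u : ℕ → A}
    (hu : τ.language = seqLanguage u) {x : ℕ → A} :
    x ∈ τ.subshift ↔ ∀ N : ℕ, ∃ p : ℕ, ∀ i < N, x i = u (p + i) := by
  constructor
  · intro h N
    have h1 := h 0 N
    rw [hu] at h1
    obtain ⟨p, k, e⟩ := h1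
    obtain rfl : N = k := by simpa using congrArg List.length e
    exact ⟨p, fun i hi => by simpa using seqWord_eq_iff.1 e i hi⟩
  · intro h
    refine mem_subshift_of_frequently fun n => ⟨n, le_rfl, ?_⟩
    rw [hu]
    obtain ⟨p, hp⟩ := h n
    exact ⟨p, n, seqWord_eq_iff.2 (by simpa using hp)⟩

theorem isClosed_subshift [TopologicalSpace A] [DiscreteTopology A] (τ : Substitution A) :
    IsClosed τ.subshift := by
  have : IsClosed ((↑) ⁻¹' τ.subshift : Set (Set.univ : Set (ℕ → A))) := by
    rw [isClosed_iff_agree]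
    intro x hx m k
    obtain ⟨y, hy, e⟩ := hx (m + k)
    have h2 : seqWord y.1 m k = seqWord x.1 m k :=
      seqWord_eq_iff.2 fun i hi => e _ (by omega)
    rw [← h2]
    exact hy m k
  simpa using isClosed_univ.isClosedEmbedding_subtypeVal.isClosedMap _ this

theorem isMinimalSubshift [TopologicalSpace A] [DiscreteTopology A] {τ : Substitution A}
    (h : IsMinimalMap τ.shift) : IsMinimalSubshift τ.subshift τ.shift where
  isClosed := τ.isClosed_subshift
  apply _ _ := rfl
  minimal := h

/-- On the subshift `X`, the cuttings of `θ` are determined by the sequence, `θ` is injective,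
and its image is open. -/
structure IsRecognizableOn [TopologicalSpace A] (θ : Substitution A) (X : Set (ℕ → A)) :
    Prop where
  onSeq_mem : ∀ x ∈ X, θ.onSeq x ∈ X
  exists_cutting : ∀ z ∈ X, ∀ v ∈ X, ∀ n, seqDrop n (θ.onSeq z) = θ.onSeq v →
    ∃ p, n = (θ.onWord (seqWord z 0 p)).length ∧ seqDrop p z = v
  isOpen : IsOpen {x : X | ∃ v ∈ X, x.1 = θ.onSeq v}

namespace IsRecognizableOn

variable [TopologicalSpace A] {θ : Substitution A} {X : Set (ℕ → A)}

/-- The restriction of a substitution to a subshift. -/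
def map (h : θ.IsRecognizableOn X) (x : X) : X := ⟨θ.onSeq x.1, h.onSeq_mem x.1 x.2⟩

theorem injOn (h : θ.IsRecognizableOn X) {z v : ℕ → A} (hz : z ∈ X) (hv : v ∈ X)
    (e : θ.onSeq z = θ.onSeq v) : z = v := by
  obtain ⟨p, hp, rfl⟩ := h.exists_cutting z hz v hv 0 (by rw [seqDrop_zero, e])
  have := θ.le_length_onWord_seqWord z 0 p
  obtain rfl : p = 0 := by omega
  simp

theorem map_injective (h : θ.IsRecognizableOn X) : Function.Injective h.map := fun x y e =>
  Subtype.ext (h.injOn x.2 y.2 (congrArg Subtype.val e))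

variable [DiscreteTopology A]

theorem continuous_map (h : θ.IsRecognizableOn X) : Continuous h.map :=
  continuous_iff_agree.2 fun _ M => ⟨M, fun _ hy _ hi =>
    (θ.onSeq_agree_of_le (fun i hi => (hy i hi).symm) hi).symm⟩

omit [DiscreteTopology A] in
theorem range_map (h : θ.IsRecognizableOn X) :
    Set.range h.map = {x : X | ∃ v ∈ X, x.1 = θ.onSeq v} := by
  ext x
  constructor
  · rintro ⟨v, rfl⟩
    exact ⟨v.1, v.2, rfl⟩
  · rintro ⟨v, hv, e⟩
    exact ⟨⟨v, hv⟩, Subtype.ext e.symm⟩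

theorem isOpenEmbedding_map [CompactSpace X] (h : θ.IsRecognizableOn X) :
    Topology.IsOpenEmbedding h.map :=
  ⟨(h.continuous_map.isClosedEmbedding h.map_injective).isEmbedding, by
    rw [h.range_map]; exact h.isOpen⟩

/-- Cuttings of a power are found by desubstituting one factor at a time, and its image is open as
the range of a composition of open embeddings. -/
theorem pow [CompactSpace X] (h : θ.IsRecognizableOn X) (m : ℕ) :
    (θ.pow m).IsRecognizableOn X := by
  induction m with
  | zero =>
    refine ⟨fun x hx => by rwa [onSeq_pow_zero], fun z _ v _ n e => ⟨n, ?_, ?_⟩, ?_⟩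
    · simp [onWord_pow]
    · simpa [onSeq_pow_zero] using e
    · convert isOpen_univ
      ext x
      simp [onSeq_pow_zero]
  | succ m ih =>
    refine ⟨fun x hx => by rw [onSeq_pow_succ]; exact h.onSeq_mem _ (ih.onSeq_mem _ hx),
      fun z hz v hv n e => ?_, ?_⟩
    · rw [onSeq_pow_succ, onSeq_pow_succ] at e
      obtain ⟨p, rfl, e1⟩ := h.exists_cutting _ (ih.onSeq_mem z hz) _ (ih.onSeq_mem v hv) n e
      obtain ⟨q, rfl, e2⟩ := ih.exists_cutting z hz v hv p e1
      exact ⟨q, by rw [seqWord_onSeq, onWord_pow_succ], e2⟩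
    · convert (h.isOpenEmbedding_map.comp ih.isOpenEmbedding_map).isOpen_range using 1
      ext x
      constructor
      · rintro ⟨v, hv, e⟩
        exact ⟨⟨v, hv⟩, Subtype.ext (by rw [e, onSeq_pow_succ]; rfl)⟩
      · rintro ⟨v, rfl⟩
        exact ⟨v.1, v.2, by rw [onSeq_pow_succ]; rfl⟩

end IsRecognizableOn

theorem length_onWord_seqWord_strictMono (τ : Substitution A) (x : ℕ → A) :
    StrictMono fun p => (τ.onWord (seqWord x 0 p)).length := by
  refine strictMono_nat_of_lt_succ fun n => ?_
  have := τ.le_length_onWord_seqWord x (0 + n) 1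
  simp only [seqWord_add, onWord_append, List.length_append]
  omega

/-- Applied to the end of the first block on either side, the cutting property forces the first
blocks of equal images to have the same length. They are then equal words, injectivity on letters
gives the first letter, and the rest follows by shifting. -/
theorem onSeq_injOn_of_exists_cutting {τ : Substitution A} {X : Set (ℕ → A)}
    (hdrop : ∀ x ∈ X, seqDrop 1 x ∈ X) (hinj : Function.Injective τ.toFun)
    (hcut : ∀ z ∈ X, ∀ v ∈ X, ∀ n, seqDrop n (τ.onSeq z) = τ.onSeq v →
      ∃ p, n = (τ.onWord (seqWord z 0 p)).length) {z v : ℕ → A} (hz : z ∈ X) (hv : v ∈ X)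
    (e : τ.onSeq z = τ.onSeq v) : z = v := by
  have key : ∀ z ∈ X, ∀ v ∈ X, τ.onSeq z = τ.onSeq v →
      (τ.toFun (v 0)).length ≤ (τ.toFun (z 0)).length := by
    intro z hz v hv e
    have hz1 := τ.seqDrop_onSeq z 1
    rw [e, seqWord_one, onWord_singleton] at hz1
    obtain ⟨p, hp⟩ := hcut v hv _ (hdrop z hz) _ hz1
    have hp0 : p ≠ 0 := by
      rintro rfl
      have := τ.length_toFun_pos (z 0)
      simp [τ.ne_nil] at hp
    have := τ.length_onWord_seqWord_mono v (Nat.one_le_iff_ne_zero.2 hp0)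
    rw [← hp, seqWord_one, onWord_singleton] at this
    exact this
  have step : ∀ z ∈ X, ∀ v ∈ X, τ.onSeq z = τ.onSeq v →
      z 0 = v 0 ∧ τ.onSeq (seqDrop 1 z) = τ.onSeq (seqDrop 1 v) := by
    intro z hz v hv e
    have hl := le_antisymm (key v hv z hz e.symm) (key z hz v hv e)
    have h1 := τ.seqWord_onSeq z 1
    have h2 := τ.seqWord_onSeq v 1
    have h3 := τ.seqDrop_onSeq z 1
    have h4 := τ.seqDrop_onSeq v 1
    simp only [seqWord_one, onWord_singleton] at h1 h2 h3 h4
    rw [hl, e, h2] at h1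
    rw [hl, e, h4] at h3
    exact ⟨hinj h1.symm, h3.symm⟩
  funext n
  induction n generalizing z v with
  | zero => exact (step z hz v hv e).1
  | succ n ih =>
    have := ih (hdrop z hz) (hdrop v hv) (step z hz v hv e).2
    simpa [Nat.add_comm] using this

/-- Long prefixes of points of the subshift occur in `u`, so the recognizability of `u` transfers to
them; compactness of the image handles the limit needed for openness. -/
theorem IsReasonable.isRecognizableOn [Finite A] [TopologicalSpace A] [DiscreteTopology A]
    {τ : Substitution A} {u : ℕ → A} (h : τ.IsReasonable u) :
    τ.IsRecognizableOn τ.subshift := by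
  have hX := isMinimalSubshift h.minimal
  have hfix := h.generating.fixed
  have hmem := fun x => mem_subshift_iff_of_language_eq (x := x) h.generating.language_eq
  have hdropu : ∀ p, τ.onSeq (seqDrop p u) = seqDrop (τ.onWord (seqWord u 0 p)).length u := by
    intro p
    have := τ.seqDrop_onSeq u p
    rw [hfix] at this
    exact this.symm
  have hmap : ∀ x ∈ τ.subshift, τ.onSeq x ∈ τ.subshift := by
    intro x hx
    rw [hmem] at hx ⊢
    intro N
    obtain ⟨p, hp⟩ := hx N
    refine ⟨(τ.onWord (seqWord u 0 p)).length, fun i hi => ?_⟩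
    rw [τ.onSeq_agree_of_le (y := seqDrop p u) hp hi, hdropu, seqDrop_apply]
  obtain ⟨L, hL⟩ := h.recognizable
  have hinj : Function.Injective τ.toFun := fun a b e =>
    h.injective 1 (by rw [iter_one, iter_one, e])
  have hcut : ∀ z ∈ τ.subshift, ∀ v ∈ τ.subshift, ∀ n,
      seqDrop n (τ.onSeq z) = τ.onSeq v → ∃ p, n = (τ.onWord (seqWord z 0 p)).length := by
    intro z hz v hv n e
    -- `n + L` letters of `z` determine the window of length `L` at position `n` of its image, and
    -- also the at most `n` letters of `z` whose image ends there.
    obtain ⟨p, hp⟩ := (hmem z).1 hz (n + L)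
    obtain ⟨q, hq⟩ := (hmem v).1 hv L
    have hj := hL (τ.onWord (seqWord u 0 q)).length ((τ.onWord (seqWord u 0 p)).length + n)
      (seqWord_eq_iff.2 fun t ht => by
        have e1 := congrFun e t
        rw [τ.onSeq_agree_of_le (y := seqDrop q u) hq ht, hdropu, seqDrop_apply, seqDrop_apply,
          τ.onSeq_agree_of_le (y := seqDrop p u) hp (by omega), hdropu, seqDrop_apply] at e1
        rw [← e1, Nat.add_assoc]) ⟨q, rfl⟩
    obtain ⟨p', hp'⟩ := hj
    have hpp : p ≤ p' := (τ.length_onWord_seqWord_strictMono u).le_iff_le.1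
      (show (τ.onWord (seqWord u 0 p)).length ≤ (τ.onWord (seqWord u 0 p')).length by omega)
    obtain ⟨r, rfl⟩ := Nat.exists_eq_add_of_le hpp
    rw [seqWord_add, onWord_append, List.length_append, Nat.add_left_cancel_iff, Nat.zero_add] at hp'
    have hr := τ.le_length_onWord_seqWord u p r
    refine ⟨r, ?_⟩
    rw [hp']
    congr 2
    exact seqWord_eq_iff.2 fun i hi => by rw [Nat.zero_add, hp i (by omega)]
  have := compactSpace_of_isClosed hX.isClosed
  have hmapc : Continuous fun x : τ.subshift => (⟨τ.onSeq x.1, hmap x.1 x.2⟩ : τ.subshift) :=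
    continuous_iff_agree.2 fun _ M => ⟨M, fun _ hy _ hi =>
      (τ.onSeq_agree_of_le (fun i hi => (hy i hi).symm) hi).symm⟩
  refine ⟨hmap, fun z hz v hv n e => ?_, isOpen_iff_agree.2 ?_⟩
  · obtain ⟨p, hp⟩ := hcut z hz v hv n e
    refine ⟨p, hp, ?_⟩
    rw [hp, seqDrop_onSeq] at e
    exact onSeq_injOn_of_exists_cutting (fun x hx => hX.seqDrop_mem hx 1) hinj hcut
      (hX.seqDrop_mem hz p) hv e
  · rintro x ⟨v, hv, e⟩
    refine ⟨L, fun y hy => ?_⟩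
    have hc : IsClosed (Set.range fun x : τ.subshift =>
        (⟨τ.onSeq x.1, hmap x.1 x.2⟩ : τ.subshift)) := (isCompact_range hmapc).isClosed
    have hy' : y ∈ Set.range fun x : τ.subshift =>
        (⟨τ.onSeq x.1, hmap x.1 x.2⟩ : τ.subshift) := by
      refine isClosed_iff_agree.1 hc y fun N => ?_
      -- `y` is approximated by tails of `u`. The first `L` letters show that these tails start at
      -- cuttings, hence are images of tails of `u`.
      obtain ⟨j, hj⟩ := (hmem y.1).1 y.2 (L + N)
      obtain ⟨q, hq⟩ := (hmem v).1 hv L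
      obtain ⟨p, hp⟩ := hL (τ.onWord (seqWord u 0 q)).length j (seqWord_eq_iff.2 fun t ht => by
        rw [← hj t (by omega), hy t ht, e, τ.onSeq_agree_of_le (y := seqDrop q u) hq ht, hdropu,
          seqDrop_apply]) ⟨q, rfl⟩
      have hpu : seqDrop p u ∈ τ.subshift := (hmem _).2 fun N => ⟨p, fun i _ => rfl⟩
      refine ⟨_, ⟨⟨seqDrop p u, hpu⟩, rfl⟩, fun i hi => ?_⟩
      simp only [hdropu]
      rw [seqDrop_apply, ← hp, hj i (by omega)]
    obtain ⟨z, rfl⟩ := hy'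
    exact ⟨z.1, z.2, rfl⟩

end Substitution

/-! ### Towers over a clopen set that contains the branch points. -/

section Towers

variable {X : Type*}

/-- The first positive time at which the orbit of `x` visits `W`. -/
noncomputable def returnTime (T : X → X) (W : Set X) (x : X) : ℕ :=
  sInf {n | 0 < n ∧ T^[n] x ∈ W}

theorem returnTime_le {T : X → X} {W : Set X} {x : X} {n : ℕ} (hn : 0 < n) (h : T^[n] x ∈ W) :
    returnTime T W x ≤ n :=
  Nat.sInf_le ⟨hn, h⟩

theorem returnTime_eq {T : X → X} {W : Set X} {x : X} {n : ℕ} (hn : 0 < n) (h : T^[n] x ∈ W)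
    (hlt : ∀ i, 0 < i → i < n → T^[i] x ∉ W) : returnTime T W x = n := by
  refine le_antisymm (returnTime_le hn h) ?_
  obtain ⟨h1, h2⟩ : returnTime T W x ∈ {n | 0 < n ∧ T^[n] x ∈ W} := Nat.sInf_mem ⟨n, hn, h⟩
  by_contra! hcon
  exact hlt _ h1 hcon h2

/-- `x` lies above `w ∈ W`, at height `j`: the orbit of `w` reaches `x` at time `j` and does not
visit `W` in between. -/
structure InTower (T : X → X) (W : Set X) (w x : X) (j : ℕ) : Prop where
  mem : w ∈ W
  iterate_eq : T^[j] w = x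
  notMem : ∀ i, 0 < i → i ≤ j → T^[i] w ∉ W

theorem InTower.of_mem {T : X → X} {W : Set X} {x : X} (hx : x ∈ W) : InTower T W x x 0 :=
  ⟨hx, rfl, fun i h0 h1 => by omega⟩

theorem InTower.add {T : X → X} {W : Set X} {w x : X} {j r : ℕ} (h : InTower T W w x j)
    (hr : ∀ i, 0 < i → i ≤ r → T^[i] x ∉ W) : InTower T W w (T^[r] x) (j + r) := by
  refine ⟨h.mem, ?_, fun i h0 h1 => ?_⟩
  · rw [Nat.add_comm, Function.iterate_add_apply, h.iterate_eq]
  · rcases le_or_gt i j with hij | hij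
    · exact h.notMem i h0 hij
    · obtain ⟨k, rfl⟩ := Nat.exists_eq_add_of_lt hij
      rw [show j + k + 1 = (k + 1) + j by ring, Function.iterate_add_apply, h.iterate_eq]
      exact hr _ (by omega) (by omega)

theorem InTower.lt_of_iterate_mem {T : X → X} {W : Set X} {w x : X} {j n : ℕ}
    (h : InTower T W w x j) (hn : 0 < n) (hw : T^[n] w ∈ W) : j < n := by
  by_contra! hcon
  exact h.notMem n hn hcon hw

/-- `W` is a clopen set, visited within bounded time from everywhere, that contains all points
with several preimages. -/
structure IsTowerBase [TopologicalSpace X] (T : X → X) (W : Set X) : Prop where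
  continuous : Continuous T
  surjective : Function.Surjective T
  isClopen : IsClopen W
  exists_bound : ∃ M : ℕ, ∀ x, ∃ j ≤ M, T^[j] x ∈ W
  mem_of_ne : ∀ x x', x ≠ x' → T x = T x' → T x ∈ W

namespace IsTowerBase

variable [TopologicalSpace X] {T : X → X} {W : Set X}

theorem _root_.IsMinimalMap.exists_bound [CompactSpace X]
    (hmin : IsMinimalMap T) (hc : Continuous T) (hW : IsOpen W) (hne : W.Nonempty) :
    ∃ M : ℕ, ∀ x, ∃ j ≤ M, T^[j] x ∈ W := by
  obtain ⟨M, hM⟩ := isCompact_univ.elim_directed_cover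
    (fun M : ℕ => {x : X | ∃ j ≤ M, T^[j] x ∈ W})
    (fun M => by
      have : {x : X | ∃ j ≤ M, T^[j] x ∈ W} = ⋃ j ∈ Set.Iic M, (T^[j]) ⁻¹' W := by
        ext x; simp
      rw [this]
      exact isOpen_biUnion fun j _ => hW.preimage (hc.iterate j))
    (fun x _ => by
      obtain ⟨w, hw, n, rfl⟩ := (hmin x).inter_open_nonempty _ hW hne
      exact Set.mem_iUnion.2 ⟨n, n, le_rfl, hw⟩)
    (directed_of_isDirected_le fun m n hmn x ⟨j, hj, hx⟩ => ⟨j, hj.trans hmn, hx⟩)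
  exact ⟨M, fun x => hM (Set.mem_univ x)⟩

theorem _root_.IsMinimalMap.isTowerBase [CompactSpace X] (hmin : IsMinimalMap T)
    (hc : Continuous T) (hs : Function.Surjective T) (hW : IsClopen W) (hne : W.Nonempty)
    (hbr : ∀ x x', x ≠ x' → T x = T x' → T x ∈ W) : IsTowerBase T W where
  continuous := hc
  surjective := hs
  isClopen := hW
  mem_of_ne := hbr
  exists_bound := hmin.exists_bound hc hW.2 hne

theorem exists_returnTime_bound (h : IsTowerBase T W) : ∃ M : ℕ, ∀ x, ∃ n, 0 < n ∧ n ≤ M ∧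
    T^[n] x ∈ W := by
  obtain ⟨M, hM⟩ := h.exists_bound
  refine ⟨M + 1, fun x => ?_⟩
  obtain ⟨j, hj, hx⟩ := hM (T x)
  exact ⟨j + 1, by omega, by omega, hx⟩

theorem returnTime_spec (h : IsTowerBase T W) (x : X) :
    0 < returnTime T W x ∧ T^[returnTime T W x] x ∈ W := by
  obtain ⟨M, hM⟩ := h.exists_returnTime_bound
  obtain ⟨n, h0, -, hn⟩ := hM x
  exact Nat.sInf_mem (s := {n | 0 < n ∧ T^[n] x ∈ W}) ⟨n, h0, hn⟩

omit [TopologicalSpace X] in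
theorem notMem_of_lt_returnTime {x : X} {i : ℕ} (h0 : 0 < i) (hi : i < returnTime T W x) :
    T^[i] x ∉ W := fun hmem => by
  have := returnTime_le h0 hmem
  omega

theorem returnTime_bounded (h : IsTowerBase T W) : ∃ M : ℕ, ∀ x, returnTime T W x ≤ M := by
  obtain ⟨M, hM⟩ := h.exists_returnTime_bound
  refine ⟨M, fun x => ?_⟩
  obtain ⟨n, h0, hn, hx⟩ := hM x
  exact (returnTime_le h0 hx).trans hn

/-- Two orbits can only merge at a point with several preimages, that is, inside `W`. -/
theorem eq_of_iterate_eq (h : IsTowerBase T W) (j : ℕ) {w v : X} (e : T^[j] w = T^[j] v)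
    (hw : ∀ i, 0 < i → i ≤ j → T^[i] w ∉ W) : w = v := by
  induction j generalizing w v with
  | zero => exact e
  | succ j ih =>
    rw [Function.iterate_succ_apply, Function.iterate_succ_apply] at e
    have e1 : T w = T v := ih e fun i h0 hi => by
      have := hw (i + 1) (by omega) (by omega)
      rwa [Function.iterate_succ_apply] at this
    by_contra hne
    exact hw 1 (by omega) (by omega) (h.mem_of_ne w v hne e1)

theorem inTower_unique (h : IsTowerBase T W) {w w' x : X} {j j' : ℕ} (hw : InTower T W w x j)
    (hw' : InTower T W w' x j') : w = w' ∧ j = j' := by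
  wlog hj : j ≤ j' generalizing w w' j j'
  · have := this hw' hw (by omega)
    exact ⟨this.1.symm, this.2.symm⟩
  obtain ⟨k, rfl⟩ := Nat.exists_eq_add_of_le hj
  have e : w = T^[k] w' := h.eq_of_iterate_eq j
    (by rw [hw.iterate_eq, ← Function.iterate_add_apply, hw'.iterate_eq]) hw.notMem
  rcases Nat.eq_zero_or_pos k with rfl | hk
  · exact ⟨e, rfl⟩
  · exact absurd (e ▸ hw.mem) (hw'.notMem k hk (by omega))

open Classical in
theorem exists_inTower (h : IsTowerBase T W) : ∃ M : ℕ, ∀ x, ∃ p : X × ℕ, p.2 ≤ M ∧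
    InTower T W p.1 x p.2 := by
  obtain ⟨M, hM⟩ := h.exists_bound
  refine ⟨M, fun x => ?_⟩
  -- The orbit of an `M`-th preimage `v` of `x` visits `W` by time `M`; the last such visit is the
  -- base point of `x`.
  obtain ⟨v, rfl⟩ := h.surjective.iterate M x
  obtain ⟨j, hj, hv⟩ := hM v
  have hg := Nat.findGreatest_spec (P := fun j => T^[j] v ∈ W) hj hv
  have hle := Nat.findGreatest_le (P := fun j => T^[j] v ∈ W) M
  refine ⟨⟨T^[Nat.findGreatest (fun j => T^[j] v ∈ W) M] v,
    M - Nat.findGreatest (fun j => T^[j] v ∈ W) M⟩, by simp, hg, ?_, fun i h0 hi => ?_⟩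
  · rw [← Function.iterate_add_apply]
    congr 2; simp only; omega
  · rw [← Function.iterate_add_apply]
    refine Nat.findGreatest_is_greatest (P := fun j => T^[j] v ∈ W) (n := M) ?_ ?_ <;>
      simp only at hi <;> omega

/-- The last point of `W` below `x`. -/
noncomputable def base (h : IsTowerBase T W) (x : X) : X :=
  (h.exists_inTower.choose_spec x).choose.1

/-- The time from the last point of `W` below `x` to `x`. -/
noncomputable def height (h : IsTowerBase T W) (x : X) : ℕ :=
  (h.exists_inTower.choose_spec x).choose.2

theorem inTower (h : IsTowerBase T W) (x : X) : InTower T W (h.base x) x (h.height x) :=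
  (h.exists_inTower.choose_spec x).choose_spec.2

theorem base_eq (h : IsTowerBase T W) {w x : X} {j : ℕ} (hw : InTower T W w x j) :
    h.base x = w :=
  (h.inTower_unique (h.inTower x) hw).1

theorem height_eq (h : IsTowerBase T W) {w x : X} {j : ℕ} (hw : InTower T W w x j) :
    h.height x = j :=
  (h.inTower_unique (h.inTower x) hw).2

theorem height_lt_returnTime (h : IsTowerBase T W) (x : X) :
    h.height x < returnTime T W (h.base x) :=
  (h.inTower x).lt_of_iterate_mem (h.returnTime_spec _).1 (h.returnTime_spec _).2

/-- Heights are bounded, so the set is a finite union of compact images `T^[j]` of closed parts of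
`W`; continuity of base point and height follows. -/
theorem isClosed_base_height [CompactSpace X] [T2Space X] (h : IsTowerBase T W) {C : Set X}
    (hC : IsClosed C) (S : Set ℕ) : IsClosed {x | h.base x ∈ C ∧ h.height x ∈ S} := by
  obtain ⟨M, hM⟩ : ∃ M, ∀ x, h.height x ≤ M :=
    ⟨_, fun x => (h.exists_inTower.choose_spec x).choose_spec.1⟩
  have e : {x | h.base x ∈ C ∧ h.height x ∈ S} = ⋃ j ∈ S ∩ Set.Iic M,
      T^[j] '' (C ∩ W ∩ ⋂ i ∈ Set.Ioc 0 j, (T^[i]) ⁻¹' Wᶜ) := by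
    ext x
    simp only [Set.mem_ofPred_eq, Set.mem_iUnion, Set.mem_image, Set.mem_inter_iff,
      Set.mem_iInter, Set.mem_Iic, Set.mem_Ioc, Set.mem_preimage, Set.mem_compl_iff, exists_prop]
    constructor
    · rintro ⟨h1, h2⟩
      have ht := h.inTower x
      exact ⟨_, ⟨h2, hM x⟩, _, ⟨⟨h1, ht.mem⟩, fun i hi => ht.notMem i hi.1 hi.2⟩,
        ht.iterate_eq⟩
    · rintro ⟨j, ⟨hj, -⟩, w, ⟨⟨h1, h2⟩, h3⟩, h4⟩
      have ht : InTower T W w x j := ⟨h2, h4, fun i h0 hi => h3 i ⟨h0, hi⟩⟩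
      rw [h.base_eq ht, h.height_eq ht]
      exact ⟨h1, hj⟩
  rw [e]
  refine Set.Finite.isClosed_biUnion ((Set.finite_Iic M).subset Set.inter_subset_right)
    fun j _ => ?_
  refine (IsClosed.isCompact ?_ |>.image (h.continuous.iterate j)).isClosed
  exact (hC.inter h.isClopen.1).inter (isClosed_biInter fun i _ =>
    h.isClopen.compl.1.preimage (h.continuous.iterate i))

theorem continuous_base [CompactSpace X] [T2Space X] (h : IsTowerBase T W) :
    Continuous h.base := by
  refine continuous_iff_isClosed.2 fun C hC => ?_
  convert h.isClosed_base_height hC Set.univ using 1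
  ext x; simp

theorem continuous_height [CompactSpace X] [T2Space X] (h : IsTowerBase T W) :
    Continuous h.height := by
  refine continuous_iff_isClosed.2 fun S _ => ?_
  convert h.isClosed_base_height isClosed_univ S using 1
  ext x; simp

/-- Moving up in a tower. -/
theorem step_of_notMem (h : IsTowerBase T W) {x : X} {r : ℕ}
    (hr : ∀ i, 0 < i → i ≤ r → T^[i] x ∉ W) :
    h.base (T^[r] x) = h.base x ∧ h.height (T^[r] x) = h.height x + r :=
  ⟨h.base_eq ((h.inTower x).add hr), h.height_eq ((h.inTower x).add hr)⟩

/-- Leaving a tower. -/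
theorem step_of_mem (h : IsTowerBase T W) {x : X} {r : ℕ} (hr0 : 0 < r)
    (hr : ∀ i, 0 < i → i < r → T^[i] x ∉ W) (hW : T^[r] x ∈ W) :
    h.base (T^[r] x) = T^[r] x ∧ h.height (T^[r] x) = 0 ∧
      returnTime T W (h.base x) = h.height x + r ∧
      T^[returnTime T W (h.base x)] (h.base x) = T^[r] x := by
  have ht := h.inTower x
  have e : T^[h.height x + r] (h.base x) = T^[r] x := by
    rw [Nat.add_comm, Function.iterate_add_apply, ht.iterate_eq]
  have hret : returnTime T W (h.base x) = h.height x + r := by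
    refine returnTime_eq (by omega) (by rwa [e]) ?_
    obtain ⟨s, rfl⟩ : ∃ s, r = s + 1 := ⟨r - 1, by omega⟩
    have := (ht.add (r := s) fun i h0 hi => hr i h0 (by omega)).notMem
    exact fun i h0 hi => this i h0 (by omega)
  exact ⟨h.base_eq (.of_mem hW), h.height_eq (.of_mem hW), hret, by rw [hret, e]⟩

end IsTowerBase

end Towers

universe v

/-! ### Semi-proper diagrams, and adic models from sequences of towers. -/

namespace OrderedBratteliDiagram

variable (B : OrderedBratteliDiagram.{u})

section SemiProper

theorem exists_isMin_range {n : ℕ} (v : B.V (n + 1)) : ∃ e : B.E n, IsMin e ∧ B.range e = v := by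
  have := B.finite_E n
  obtain ⟨e₀, he₀⟩ := B.range_surjective n v
  obtain ⟨e, he⟩ := (Set.toFinite {e : B.E n | B.range e = v}).exists_minimal ⟨e₀, he₀⟩
  refine ⟨e, fun f hf => he.2 ?_ hf, he.1⟩
  exact ((B.comparable_iff f e).1 (Or.inl hf)).trans he.1

theorem isMin_unique {n : ℕ} {e f : B.E n} (he : IsMin e) (hf : IsMin f)
    (h : B.range e = B.range f) : e = f := by
  rcases (B.comparable_iff e f).2 h with hef | hfe
  · exact le_antisymm hef (hf hef)
  · exact le_antisymm (he hfe) hfe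

variable {B} {v₀ : ∀ n, B.V n} (hv : ∀ n (e : B.E n), IsMin e → B.source e = v₀ n)

-- The minimal edge into the distinguished vertex is unique at each level. These edges fit together,
-- and every minimal path is made of them because the next minimal edge has the distinguished
-- source.
include hv in
theorem existsUnique_isMinPath : ∃! x : B.Path, B.IsMinPath x := by
  choose e he hr using fun n => B.exists_isMin_range (v₀ (n + 1))
  refine ⟨⟨e, fun n => by rw [hv _ _ (he (n + 1)), hr]⟩, he, fun x hx => ?_⟩
  refine Subtype.ext (funext fun n => B.isMin_unique (hx n) (he n) ?_)
  rw [hr, ← x.2, hv _ _ (hx (n + 1))]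

include hv in
theorem reaches_of_le {m : ℕ} {a : B.V m} {n n' : ℕ} (hn : n ≤ n') (h : B.Reaches a n (v₀ n)) :
    B.Reaches a n' (v₀ n') := by
  induction n', hn using Nat.le_induction with
  | base => exact h
  | succ k hk ih =>
    obtain ⟨e, he, hr⟩ := B.exists_isMin_range (v₀ (k + 1))
    rw [← hr]
    refine .step e ?_
    rwa [hv _ _ he]

include hv in
theorem isSimple_of_reaches (h : ∀ (n : ℕ) (a : B.V n), ∃ m, n ≤ m ∧ B.Reaches a m (v₀ m)) :
    B.IsSimple := by
  have key : ∀ n, ∃ m, n < m ∧ ∀ (a : B.V n) (b : B.V m), B.Reaches a m b := by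
    intro n
    have := B.finite_V n
    choose f hf using h n
    obtain ⟨M, hM⟩ := (Set.finite_range f).bddAbove
    obtain ⟨v⟩ : Nonempty (B.V n) := ⟨v₀ n⟩
    -- By level `M` every vertex reaches the distinguished one. One more level suffices, since the
    -- minimal edge into any `b` starts there.
    refine ⟨M + 1, ?_, fun a b => ?_⟩
    · have := (hf v).1.trans (hM ⟨v, rfl⟩); omega
    · obtain ⟨e, he, rfl⟩ := B.exists_isMin_range b
      refine .step e ?_
      rw [hv _ _ he]
      exact reaches_of_le hv (hM ⟨a, rfl⟩) (hf a).2
  choose g hg hr using key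
  exact ⟨fun k => Nat.rec 0 (fun _ n => g n) k, rfl, strictMono_nat_of_lt_succ fun k => hg _,
    fun k a b => hr _ a b⟩

include hv in
theorem isSemiProper_of_reaches
    (h : ∀ (n : ℕ) (a : B.V n), ∃ m, n ≤ m ∧ B.Reaches a m (v₀ m)) : B.IsSemiProper :=
  ⟨isSimple_of_reaches hv h, existsUnique_isMinPath hv⟩

end SemiProper

/-- A sequence of systems `(Y n, T n)`, each of which is a tower over the next one, in such a way
that the position of a point in the tower is an edge of the diagram. -/
structure TowerSequence (Y : ℕ → Type v) [∀ n, TopologicalSpace (Y n)] where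
  T : ∀ n, Y n → Y n
  base : ∀ n, Y n → Y (n + 1)
  edge : ∀ n, Y n → B.E n
  continuous_base : ∀ n, Continuous (base n)
  continuous_edge : ∀ n, Continuous (edge n)
  range_edge : ∀ n x, B.range (edge n x) = B.source (edge (n + 1) (base n x))
  exists_source_eq : ∀ n v, ∃ x : Y n, B.source (edge n x) = v
  exists_edge_eq : ∀ n (z : Y (n + 1)) (e : B.E n), B.range e = B.source (edge (n + 1) z) →
    ∃ x, base n x = z ∧ edge n x = e
  step_of_isMax : ∀ n x, IsMax (edge n x) →
    IsMin (edge n (T n x)) ∧ base n (T n x) = T (n + 1) (base n x)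
  step_of_not_isMax : ∀ n x, ¬ IsMax (edge n x) →
    edge n x ⋖ edge n (T n x) ∧ base n (T n x) = base n x

namespace TowerSequence

variable {B} {Y : ℕ → Type v} [∀ n, TopologicalSpace (Y n)] (S : B.TowerSequence Y)

/-- The point of `Y n` that lies below `x` in the `n`-fold tower. -/
def descend : ∀ n, Y 0 → Y n
  | 0, x => x
  | n + 1, x => S.base n (descend n x)

theorem continuous_descend (n : ℕ) : Continuous (S.descend n) := by
  induction n with
  | zero => exact continuous_id
  | succ n ih => exact (S.continuous_base n).comp ih

/-- The path of a point. -/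
def path (x : Y 0) : B.Path :=
  ⟨fun n => S.edge n (S.descend n x), fun n => (S.range_edge n _).symm⟩

theorem continuous_path : Continuous S.path :=
  Continuous.subtype_mk (continuous_pi fun n => (S.continuous_edge n).comp
    (S.continuous_descend n)) _

/-- A finite path is realized from the top: starting with a point of level `n`, each edge is lifted
to the level below. -/
theorem exists_descend_eq (p : B.Path) (n : ℕ) (z : Y n)
    (hz : B.source (S.edge n z) = B.source (p.1 n)) :
    ∃ x : Y 0, S.descend n x = z ∧ ∀ i < n, S.edge i (S.descend i x) = p.1 i := by
  induction n with
  | zero => exact ⟨z, rfl, fun i hi => absurd hi (Nat.not_lt_zero i)⟩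
  | succ n ih =>
    rw [p.2 n] at hz
    obtain ⟨z', hz', he⟩ := S.exists_edge_eq n z (p.1 n) hz.symm
    obtain ⟨x, hx, hi⟩ := ih z' (by rw [he])
    refine ⟨x, by simp only [descend, hx, hz'], fun i hin => ?_⟩
    rcases Nat.lt_succ_iff_lt_or_eq.1 hin with h | rfl
    · exact hi i h
    · rw [hx, he]

/-- The points that follow the first `n` edges form nested nonempty closed sets in a compact space.
-/
theorem path_surjective [CompactSpace (Y 0)] : Function.Surjective S.path := by
  intro p
  have hc : ∀ n, IsClosed {x : Y 0 | ∀ i < n, S.edge i (S.descend i x) = p.1 i} := by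
    intro n
    have : {x : Y 0 | ∀ i < n, S.edge i (S.descend i x) = p.1 i} =
        ⋂ i ∈ Set.Iio n, (fun x => S.edge i (S.descend i x)) ⁻¹' {p.1 i} := by
      ext x; simp
    rw [this]
    exact isClosed_biInter fun i _ => (isClosed_discrete _).preimage
      ((S.continuous_edge i).comp (S.continuous_descend i))
  obtain ⟨x, hx⟩ := IsCompact.nonempty_iInter_of_sequence_nonempty_isCompact_isClosed
    (fun n => {x : Y 0 | ∀ i < n, S.edge i (S.descend i x) = p.1 i})
    (fun n x hx i hi => hx i (by omega))
    (fun n => by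
      obtain ⟨z, hz⟩ := S.exists_source_eq n (B.source (p.1 n))
      obtain ⟨x, -, hx⟩ := S.exists_descend_eq p n z hz
      exact ⟨x, hx⟩)
    (hc 0).isCompact hc
  exact ⟨x, Subtype.ext (funext fun n => Set.mem_iInter.1 hx (n + 1) n (Nat.lt_succ_self n))⟩

/-- The carry of an odometer: while edges are maximal they are reset to minimal ones and the step is
passed to the next level. -/
theorem step_of_forall_isMax {x : Y 0} (n : ℕ) (h : ∀ i < n, IsMax ((S.path x).1 i)) :
    (∀ i < n, IsMin ((S.path (S.T 0 x)).1 i)) ∧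
      S.descend n (S.T 0 x) = S.T n (S.descend n x) := by
  induction n with
  | zero => exact ⟨fun i hi => absurd hi (Nat.not_lt_zero i), rfl⟩
  | succ n ih =>
    obtain ⟨h1, h2⟩ := ih fun i hi => h i (by omega)
    obtain ⟨h3, h4⟩ := S.step_of_isMax n (S.descend n x) (h n (Nat.lt_succ_self n))
    refine ⟨fun i hin => ?_, by simp only [descend, h2, h4]⟩
    rcases Nat.lt_succ_iff_lt_or_eq.1 hin with h | rfl
    · exact h1 i h
    · simpa only [path, h2] using h3

theorem isSuccessor_path {x : Y 0} (h : ¬ B.IsMaxPath (S.path x)) :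
    B.IsSuccessor (S.path x) (S.path (S.T 0 x)) := by
  classical
  have hex : ∃ n, ¬ IsMax ((S.path x).1 n) := by simpa [IsMaxPath] using h
  obtain ⟨m, hm, hlt⟩ : ∃ m, ¬ IsMax ((S.path x).1 m) ∧ ∀ i < m, IsMax ((S.path x).1 i) :=
    ⟨Nat.find hex, Nat.find_spec hex, fun i hi => not_not.1 (Nat.find_min hex hi)⟩
  obtain ⟨h1, h2⟩ := S.step_of_forall_isMax m hlt
  obtain ⟨h3, h4⟩ := S.step_of_not_isMax _ _ hm
  refine ⟨m, hlt, ?_, h1, fun i hi => ?_⟩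
  · simp only [path]
    rw [h2]
    exact h3
  -- The carry stops at level `m`: the base point there is unchanged, and hence so is everything
  -- above.
  · have key : ∀ i, m < i → S.descend i (S.T 0 x) = S.descend i x := by
      intro i hi
      induction i, hi using Nat.le_induction with
      | base => simp only [descend, h2, h4]
      | succ i _ ih => simp only [descend, ih]
    simp only [path, key i hi]

/-- If paths separate points, the adic system of the diagram is conjugate to the first system
of the sequence. -/
theorem isSemiProperModel [CompactSpace (Y 0)] (hB : B.IsSemiProper)
    (hsep : Function.Injective S.path) : B.IsSemiProperModel (S.T 0) := by
  let F : Y 0 ≃ₜ B.Path := Continuous.homeoOfEquivCompactToT2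
    (f := Equiv.ofBijective S.path ⟨hsep, S.path_surjective⟩) S.continuous_path
  have hF : ∀ x, F x = S.path x := fun _ => rfl
  refine ⟨hB, fun p => F (S.T 0 (F.symm p)), fun p => ?_, F.symm, fun p => by simp⟩
  obtain ⟨x, rfl⟩ := F.surjective p
  have hx : F.symm (S.path x) = x := F.symm_apply_apply x
  simp only [hF, hx]
  exact ⟨S.isSuccessor_path, fun h n => (S.step_of_forall_isMax (n + 1) fun i _ => h i).1 n
    (Nat.lt_succ_self n)⟩

end TowerSequence

end OrderedBratteliDiagram

/-! ### The order of edges with a common range. -/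

section SigmaOrder

variable {ι : Type*} {α : ι → Type*} [∀ i, PartialOrder (α i)]

theorem Sigma.isMax_mk_iff {i : ι} {a : α i} : IsMax (⟨i, a⟩ : Σ i, α i) ↔ IsMax a := by
  constructor
  · intro h b hb
    exact Sigma.mk_le_mk_iff.1 (h (Sigma.mk_le_mk_iff.2 hb))
  · rintro h _ ⟨_, _, b, hb⟩
    exact Sigma.mk_le_mk_iff.2 (h hb)

theorem Sigma.isMin_mk_iff {i : ι} {a : α i} : IsMin (⟨i, a⟩ : Σ i, α i) ↔ IsMin a := by
  constructor
  · intro h b hb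
    exact Sigma.mk_le_mk_iff.1 (h (Sigma.mk_le_mk_iff.2 hb))
  · rintro h _ ⟨_, b, _, hb⟩
    exact Sigma.mk_le_mk_iff.2 (h hb)

theorem Sigma.mk_covBy_mk {i : ι} {a b : α i} (h : a ⋖ b) :
    (⟨i, a⟩ : Σ i, α i) ⋖ ⟨i, b⟩ := by
  refine ⟨Sigma.mk_lt_mk_iff.2 h.1, ?_⟩
  rintro ⟨j, c⟩ hc hc'
  obtain ⟨e, -⟩ := Sigma.lt_def.1 hc
  obtain rfl : i = j := e
  exact h.2 (Sigma.mk_lt_mk_iff.1 hc) (Sigma.mk_lt_mk_iff.1 hc')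

end SigmaOrder

/-! ### Desubstitution and the diagram of a substitution fixing the branch point. -/

namespace IsMinimalSubshift

variable {A : Type u} [TopologicalSpace A] {X : Set (ℕ → A)} {T : X → X}
  {θ : Substitution A}

theorem iterate_map (hX : IsMinimalSubshift X T) (hθ : θ.IsRecognizableOn X) (z : X) (p : ℕ) :
    T^[(θ.onWord (seqWord z.1 0 p)).length] (hθ.map z) = hθ.map (T^[p] z) := by
  apply Subtype.ext
  rw [hX.coe_iterate]
  simp only [Substitution.IsRecognizableOn.map, hX.coe_iterate]
  exact θ.seqDrop_onSeq z.1 p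

theorem exists_cutting_of_iterate_mem (hX : IsMinimalSubshift X T) (hθ : θ.IsRecognizableOn X)
    {z v : X} {n : ℕ} (h : T^[n] (hθ.map z) = hθ.map v) :
    ∃ p, n = (θ.onWord (seqWord z.1 0 p)).length ∧ T^[p] z = v := by
  have e : seqDrop n (θ.onSeq z.1) = θ.onSeq v.1 := by
    have := congrArg Subtype.val h
    rwa [hX.coe_iterate] at this
  obtain ⟨p, hp, e'⟩ := hθ.exists_cutting z.1 z.2 v.1 v.2 n e
  exact ⟨p, hp, Subtype.ext (by rw [hX.coe_iterate, e'])⟩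

theorem iterate_map_zero (hX : IsMinimalSubshift X T) (hθ : θ.IsRecognizableOn X) (z : X) :
    T^[(θ.toFun (z.1 0)).length] (hθ.map z) = hθ.map (T z) := by
  have := hX.iterate_map hθ z 1
  rwa [seqWord_one, Substitution.onWord_singleton] at this

/-- An earlier return would be a cutting strictly inside the first block. -/
theorem returnTime_range_map (hX : IsMinimalSubshift X T) (hθ : θ.IsRecognizableOn X) (z : X) :
    returnTime T (Set.range hθ.map) (hθ.map z) = (θ.toFun (z.1 0)).length := by
  refine returnTime_eq (θ.length_toFun_pos _) ⟨_, (hX.iterate_map_zero hθ z).symm⟩ ?_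
  rintro i h0 hi ⟨v, hv⟩
  obtain ⟨p, rfl, -⟩ := hX.exists_cutting_of_iterate_mem hθ hv.symm
  have hp : 1 ≤ p := by
    by_contra hp
    obtain rfl : p = 0 := by omega
    simp at h0
  have := θ.length_onWord_seqWord_mono z.1 hp
  rw [seqWord_one, Substitution.onWord_singleton] at this
  omega

variable [DiscreteTopology A] [CompactSpace X]

theorem isTowerBase (hX : IsMinimalSubshift X T) {W : Set X} (hW : IsClopen W) {y : X}
    (hy : y ∈ W) (hbr : ∀ x x' : X, x ≠ x' → T x = T x' → T x = y) : IsTowerBase T W :=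
  hX.minimal.isTowerBase hX.continuous hX.surjective hW ⟨y, hy⟩
    fun x x' hne e => by rw [hbr x x' hne e]; exact hy

end IsMinimalSubshift

namespace Substitution

variable {A : Type u}

theorem length_onWord_seqWord_succ (θ : Substitution A) (x : ℕ → A) (p : ℕ) :
    (θ.toFun (x 0)).length + p ≤ (θ.onWord (seqWord x 0 (p + 1))).length := by
  rw [Nat.add_comm p 1, seqWord_add, seqWord_one, onWord_append, onWord_singleton,
    List.length_append]
  have := θ.le_length_onWord_seqWord x (0 + 1) p
  omega

theorem onSeq_zero (θ : Substitution A) {l : A} (hl : ∀ a, (θ.toFun a).head? = some l)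
    (x : ℕ → A) : θ.onSeq x 0 = l := by
  have h := hl (x 0)
  rw [θ.onSeq_apply x (p := 1) (by
    rw [seqWord_one, onWord_singleton]; exact θ.length_toFun_pos _)]
  simp only [seqWord_one, onWord_singleton]
  rw [List.head?_eq_getElem?, List.getElem?_eq_some_iff] at h
  exact h.2

/-- Sequences that agree on a prefix have images under a left proper substitution that agree one
letter beyond the image of that prefix. -/
theorem onSeq_agree_of_isLeftProper (θ : Substitution A) {l : A}
    (hl : ∀ a, (θ.toFun a).head? = some l) {x y : ℕ → A} {p : ℕ} (h : ∀ i < p, x i = y i) {i : ℕ}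
    (hi : i ≤ (θ.onWord (seqWord x 0 p)).length) : θ.onSeq x i = θ.onSeq y i := by
  rcases hi.lt_or_eq with hi | rfl
  · exact θ.onSeq_agree h hi
  · have e : seqWord x 0 p = seqWord y 0 p := seqWord_eq_iff.2 (by simpa using h)
    have hx := congrFun (θ.seqDrop_onSeq x p) 0
    have hy := congrFun (θ.seqDrop_onSeq y p) 0
    rw [θ.onSeq_zero hl, seqDrop_apply, Nat.add_zero] at hx hy
    rw [hx, e, hy]

section Diagram

variable [Finite A] [Nonempty A] {θ : Substitution A}

theorem isStationary_diagram (hp : θ.IsPrimitive) : (θ.diagram hp).IsStationary :=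
  ⟨fun _ => Equiv.refl A, fun _ => OrderIso.refl (Σ a : A, Fin (θ.toFun a).length),
    fun _ _ => ⟨rfl, rfl⟩⟩

theorem reaches_diagram (hp : θ.IsPrimitive) (n : ℕ) (a : A) (k : ℕ) (b : A)
    (h : a ∈ θ.iter k b) :
    (θ.diagram hp).Reaches (m := n + 1) a (n + k + 1) b := by
  induction k generalizing b with
  | zero =>
    rw [iter_zero, List.mem_singleton] at h
    subst h
    exact .refl
  | succ k ih =>
    -- The iterate is expanded at its outermost letter, because the last edge of the path to `b`
    -- picks a letter of `θ(b)`.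
    have e : θ.iter (k + 1) b = (θ.toFun b).flatMap (θ.iter k) := by
      have h1 : θ.iter (k + 1) b = θ.onWord^[k] (θ.toFun b) := by
        simp only [iter, Function.iterate_succ_apply, onWord_singleton]
      rw [h1, ← onWord_pow]
      rfl
    rw [e] at h
    obtain ⟨c, hc, hac⟩ := List.mem_flatMap.1 h
    obtain ⟨i, hi, rfl⟩ := List.mem_iff_getElem.1 hc
    exact OrderedBratteliDiagram.Reaches.step (B := θ.diagram hp) (n := n + k + 1)
      (⟨b, ⟨i, hi⟩⟩ : Σ a : A, Fin (θ.toFun a).length) (ih _ hac)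

/-- Minimal edges are the first letters of the blocks, so all have source `l`; primitivity connects
every letter to `l`. -/
theorem isSemiProper_diagram (hp : θ.IsPrimitive) {l : A}
    (hl : ∀ a, (θ.toFun a).head? = some l) : (θ.diagram hp).IsSemiProper := by
  refine OrderedBratteliDiagram.isSemiProper_of_reaches
    (v₀ := fun n => match n with
      | 0 => (PUnit.unit : DiagramV A 0)
      | n + 1 => (l : DiagramV A (n + 1))) ?_ ?_
  · rintro (_ | n) e he
    · rfl
    · obtain ⟨a, i⟩ := (e : Σ a : A, Fin (θ.toFun a).length)
      have hmin : IsMin i := Sigma.isMin_mk_iff (α := fun a => Fin (θ.toFun a).length) |>.1 he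
      have h0 : i.1 = 0 := by
        have h : (⟨0, θ.length_toFun_pos a⟩ : Fin _) ≤ i := Nat.zero_le _
        exact Nat.le_zero.1 (hmin h)
      have h := hl a
      rw [List.head?_eq_getElem?, List.getElem?_eq_some_iff] at h
      obtain ⟨h1, h2⟩ := h
      change (θ.toFun a)[i] = l
      rw [← h2]
      simp [h0]
  · rintro (_ | n) a
    · exact ⟨0, le_rfl, .refl⟩
    · obtain ⟨k, -, hk⟩ := id hp
      exact ⟨n + k + 1, by omega, reaches_diagram (A := A) hp n a k l (hk l a)⟩

end Diagram

section Model

variable [Finite A] [TopologicalSpace A] [DiscreteTopology A] {θ : Substitution A}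
  {X : Set (ℕ → A)} {T : X → X}

/-- A recognizable substitution whose image contains the branch point desubstitutes uniquely. -/
theorem exists_desubstitution (hX : IsMinimalSubshift X T) (hθ : θ.IsRecognizableOn X) {y : X}
    (hfix : hθ.map y = y) (hbr : ∀ x x' : X, x ≠ x' → T x = T x' → T x = y) :
    ∃ (D : X → X) (k : X → ℕ), Continuous D ∧ Continuous k ∧
      (∀ x, k x < (θ.toFun ((D x).1 0)).length ∧ T^[k x] (hθ.map (D x)) = x) ∧
      (∀ z, ∀ i < (θ.toFun (z.1 0)).length, D (T^[i] (hθ.map z)) = z ∧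
        k (T^[i] (hθ.map z)) = i) ∧
      (∀ x, k x + 1 = (θ.toFun ((D x).1 0)).length ∧ k (T x) = 0 ∧ D (T x) = T (D x) ∨
        k (T x) = k x + 1 ∧ D (T x) = D x) := by
  have := compactSpace_of_isClosed hX.isClosed
  have hemb := hθ.isOpenEmbedding_map
  have hcl := hθ.continuous_map.isClosedEmbedding hθ.map_injective
  have hW : IsClopen (Set.range hθ.map) := ⟨hcl.isClosed_range, hemb.isOpen_range⟩
  have hB : IsTowerBase T (Set.range hθ.map) := hX.isTowerBase hW ⟨y, hfix⟩ hbr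
  choose D hD using fun x => (hB.inTower x).mem
  have huniq : ∀ z, ∀ i < (θ.toFun (z.1 0)).length,
      D (T^[i] (hθ.map z)) = z ∧ hB.height (T^[i] (hθ.map z)) = i := by
    intro z i hi
    have ht : InTower T (Set.range hθ.map) (hθ.map z) (T^[i] (hθ.map z)) i := by
      refine ⟨⟨z, rfl⟩, rfl, fun j h0 hj => ?_⟩
      refine IsTowerBase.notMem_of_lt_returnTime h0 ?_
      rw [hX.returnTime_range_map]
      omega
    exact ⟨hθ.map_injective (by rw [hD, hB.base_eq ht]), hB.height_eq ht⟩
  refine ⟨D, hB.height, ?_, hB.continuous_height, fun x => ⟨?_, ?_⟩, huniq, fun x => ?_⟩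
  · refine hemb.isEmbedding.continuous_iff.2 ?_
    convert hB.continuous_base using 1
    exact funext hD
  · rw [← hX.returnTime_range_map hθ, hD]
    exact hB.height_lt_returnTime x
  · rw [hD, (hB.inTower x).iterate_eq]
  · by_cases hx : T x ∈ Set.range hθ.map
    · obtain ⟨h1, h2, h3, h4⟩ := hB.step_of_mem (x := x) (r := 1) one_pos
        (fun i h0 h1 => by omega) hx
      rw [← hD, hX.returnTime_range_map] at h3 h4
      rw [hX.iterate_map_zero] at h4
      refine Or.inl ⟨h3.symm, h2, hθ.map_injective ?_⟩
      rw [hD, h4]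
      exact h1
    · obtain ⟨h1, h2⟩ := hB.step_of_notMem (x := x) (r := 1) (fun i h0 h1 => by
        obtain rfl : i = 1 := by omega
        exact hx)
      refine Or.inr ⟨h2, hθ.map_injective ?_⟩
      rw [hD, hD]
      exact h1

/-- Position in the tower over `θ(X)` and first letter of the desubstituted point form the edges
above level `0`; left properness makes the resulting paths separate points. -/
theorem isSemiProperModel_diagram [Nonempty A] (hX : IsMinimalSubshift X T)
    (hθ : θ.IsRecognizableOn X) (hp : θ.IsPrimitive) {l : A}
    (hl : ∀ a, (θ.toFun a).head? = some l) (hA : ∀ a, ∃ x : X, x.1 0 = a) {y : X}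
    (hfix : hθ.map y = y) (hbr : ∀ x x' : X, x ≠ x' → T x = T x' → T x = y) :
    (θ.diagram hp).IsSemiProperModel T := by
  have := compactSpace_of_isClosed hX.isClosed
  obtain ⟨D, k, hDc, hkc, hkD, huniq, hstep⟩ := exists_desubstitution hX hθ hfix hbr
  have hsrc : ∀ x, (θ.toFun ((D x).1 0))[k x]'(hkD x).1 = x.1 0 := by
    intro x
    have e := congrArg (fun x => x.1 0) (hkD x).2
    simp only [hX.coe_iterate, seqDrop_apply, Nat.add_zero] at e
    rw [← e]
    simp only [IsRecognizableOn.map]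
    rw [θ.onSeq_apply _ (p := 1) (by
      rw [seqWord_one, onWord_singleton]; exact (hkD x).1)]
    simp only [seqWord_one, onWord_singleton]
  let edge : X → Σ a : A, Fin (θ.toFun a).length := fun x => ⟨(D x).1 0, ⟨k x, (hkD x).1⟩⟩
  have hedge : ∀ x, edge x = ⟨(D x).1 0, ⟨k x, (hkD x).1⟩⟩ := fun _ => rfl
  have heq : ∀ x a (i : Fin (θ.toFun a).length), (D x).1 0 = a → k x = i → edge x = ⟨a, i⟩ := by
    rintro x _ i rfl hi
    rw [hedge]
    congr
  have hedgec : ∀ e, IsOpen (edge ⁻¹' {e}) := by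
    rintro ⟨a, i⟩
    have : edge ⁻¹' {⟨a, i⟩} = (fun x => ((D x).1 0, k x)) ⁻¹' {(a, i.1)} := by
      ext x
      simp only [Set.mem_preimage, Set.mem_singleton_iff, Prod.mk.injEq]
      constructor
      · intro h
        rw [hedge] at h
        obtain ⟨rfl, h⟩ := Sigma.mk.inj_iff.1 h
        exact ⟨rfl, by rw [← eq_of_heq h]⟩
      · rintro ⟨h1, h2⟩
        exact heq x a i h1 h2
    rw [this]
    refine (isOpen_discrete _).preimage (Continuous.prodMk ?_ hkc)
    exact (continuous_apply 0).comp (continuous_subtype_val.comp hDc)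
  -- All levels are copies of `X`. The edge from the root is the first letter, so the bottom level
  -- does not desubstitute.
  let S : (θ.diagram hp).TowerSequence (fun _ : ℕ => X) :=
    { T := fun _ => T
      base := fun n => match n with
        | 0 => id
        | _ + 1 => D
      edge := fun n => match n with
        | 0 => fun x => (x.1 0 : A)
        | _ + 1 => edge
      continuous_base := fun n => match n with
        | 0 => continuous_id
        | _ + 1 => hDc
      continuous_edge := fun n => match n with
        | 0 => continuous_discrete_rng.2 fun a =>
            (isOpen_discrete ({a} : Set A)).preimage
              ((continuous_apply 0).comp continuous_subtype_val)
        | _ + 1 => continuous_discrete_rng.2 hedgec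
      range_edge := fun n x => match n with
        | 0 => (hsrc x).symm
        | _ + 1 => (hsrc (D x)).symm
      exists_source_eq := fun n => match n with
        | 0 => fun _ => ⟨y, rfl⟩
        | _ + 1 => fun v => by
            obtain ⟨x, hx⟩ := hA v
            exact ⟨x, (hsrc x).trans hx⟩
      exists_edge_eq := fun n => match n with
        | 0 => fun z _ he => ⟨z, rfl, (he.trans (hsrc z)).symm⟩
        | _ + 1 => fun z e he => by
            obtain ⟨a, i⟩ := (e : Σ a : A, Fin (θ.toFun a).length)
            obtain rfl : a = z.1 0 := he.trans (hsrc z)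
            obtain ⟨h1, h2⟩ := huniq z i i.2
            exact ⟨T^[i] (hθ.map z), h1, heq _ _ _ (by rw [h1]) h2⟩
      step_of_isMax := fun n x => match n with
        | 0 => fun _ => ⟨fun _ h => Eq.symm h, rfl⟩
        | _ + 1 => fun hx => by
            have hx' : IsMax (⟨k x, (hkD x).1⟩ : Fin (θ.toFun ((D x).1 0)).length) :=
              
              Sigma.isMax_mk_iff (α := fun a => Fin (θ.toFun a).length) |>.1 hx
            rcases hstep x with ⟨h1, h2, h3⟩ | ⟨h1, h2⟩
            · refine ⟨?_, h3⟩
              change IsMin (⟨_, _⟩ : Σ a : A, Fin (θ.toFun a).length)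
              refine Sigma.isMin_mk_iff.2 fun j _ => ?_
              change k (T x) ≤ j.1
              omega
            · exfalso
              have hlt := (hkD (T x)).1
              rw [h2, h1] at hlt
              have := hx' (b := ⟨k x + 1, hlt⟩) (Nat.le_succ _)
              have : k x + 1 ≤ k x := this
              omega
      step_of_not_isMax := fun n x => match n with
        | 0 => fun hx => absurd (fun _ h => Eq.symm h) hx
        | _ + 1 => fun hx => by
            rcases hstep x with ⟨h1, h2, h3⟩ | ⟨h1, h2⟩
            · refine absurd (Sigma.isMax_mk_iff.2 fun j _ => ?_) hx
              change j.1 ≤ k x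
              have := j.2
              omega
            · refine ⟨?_, h2⟩
              have hlt := (hkD (T x)).1
              rw [h2, h1] at hlt
              change edge x ⋖ edge (T x)
              rw [heq (T x) _ ⟨k x + 1, hlt⟩ (by rw [h2]) h1, hedge]
              refine Sigma.mk_covBy_mk ⟨Nat.lt_succ_self (k x), fun j h1 h2 => ?_⟩
              have h1 : k x < j.1 := h1
              have h2 : j.1 < k x + 1 := h2
              omega }
  refine S.isSemiProperModel (isSemiProper_diagram hp hl) fun x x' hxx => ?_
  have hdesc : ∀ n x, S.descend (n + 1) x = D^[n] x := by
    intro n x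
    induction n with
    | zero => rfl
    | succ n ih => rw [Function.iterate_succ_apply', ← ih]; rfl
  have hpair : ∀ n, (D (D^[n] x)).1 0 = (D (D^[n] x')).1 0 ∧ k (D^[n] x) = k (D^[n] x') := by
    intro n
    have h : edge (S.descend (n + 1) x) = edge (S.descend (n + 1) x') :=
      congrFun (congrArg Subtype.val hxx) (n + 1)
    rw [hdesc, hdesc] at h
    exact ⟨congrArg (fun e => e.1) h, congrArg (fun e => e.2.1) h⟩
  have hagree : ∀ M x x', (∀ n, (D (D^[n] x)).1 0 = (D (D^[n] x')).1 0 ∧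
      k (D^[n] x) = k (D^[n] x')) → ∀ i < M + 1, x.1 i = x'.1 i := by
    intro M
    induction M with
    | zero =>
      intro x x' h i hi
      obtain rfl : i = 0 := by omega
      obtain ⟨h1, h2⟩ := h 0
      simp only [Function.iterate_zero, id] at h1 h2
      have e := hsrc x
      simp only [h1, h2] at e
      exact e.symm.trans (hsrc x')
    | succ M ih =>
      intro x x' h i hi
      have hD := ih (D x) (D x') fun n => by
        simpa only [Function.iterate_succ_apply] using h (n + 1)
      have h2 : k x = k x' := (h 0).2
      rw [← (hkD x).2, ← (hkD x').2, ← h2, hX.coe_iterate, hX.coe_iterate, seqDrop_apply,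
        seqDrop_apply]
      -- Since `k x` is less than the length of the first block, the image of `M + 1` common letters
      -- leaves at least `M + 1` letters after position `k x`. The common first letter of the next
      -- blocks supplies one more.
      refine θ.onSeq_agree_of_isLeftProper hl hD ?_
      have h3 := θ.length_onWord_seqWord_succ (D x).1 M
      have h4 := (hkD x).1
      omega
  exact Subtype.ext (funext fun i => hagree i x x' hpair i (Nat.lt_succ_self i))

end Model

end Substitution

/-! ### Occurrences of words and letters. -/

section Sequences

variable {A : Type u}

theorem seqWord_infix (x : ℕ → A) {m k N : ℕ} (h : m + k ≤ N) :
    seqWord x m k <:+: seqWord x 0 N := by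
  obtain ⟨r, rfl⟩ := Nat.exists_eq_add_of_le h
  rw [seqWord_add, seqWord_add, Nat.zero_add]
  exact ⟨_, _, rfl⟩

theorem mem_seqLanguage_of_infix {x : ℕ → A} {w v : List A} (h : w <:+: v)
    (hv : v ∈ seqLanguage x) : w ∈ seqLanguage x := by
  obtain ⟨m, k, rfl⟩ := hv
  obtain ⟨p, q, e⟩ := h
  have hk : k = p.length + w.length + q.length := by
    have := congrArg List.length e
    simp at this
    omega
  rw [hk, seqWord_add, seqWord_add] at e
  have e1 := (List.append_inj e (by simp)).1
  exact ⟨_, _, (List.append_inj e1 (by simp)).2⟩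

theorem exists_forall_letter_lt [Finite A] {x : ℕ → A} (h : ∀ a, ∃ i, x i = a) :
    ∃ K, ∀ a, ∃ i < K, x i = a := by
  choose f hf using h
  obtain ⟨M, hM⟩ := (Set.finite_range f).bddAbove
  exact ⟨M + 1, fun a => ⟨f a, Nat.lt_succ_of_le (hM ⟨a, rfl⟩), hf a⟩⟩

theorem IsMinimalMap.congr_of_eq [TopologicalSpace A] {X X' : Set (ℕ → A)} {T : X → X}
    {T' : X' → X'} (h : X = X') (hT : ∀ (x : X) n, (T x).1 n = x.1 (n + 1))
    (hT' : ∀ (x : X') n, (T' x).1 n = x.1 (n + 1)) (hm : IsMinimalMap T) : IsMinimalMap T' := by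
  subst h
  have : T' = T := funext fun x => Subtype.ext (funext fun n => (hT' x n).trans (hT x n).symm)
  rwa [this]

end Sequences

/-! ### Growth, primitivity and generating fixed points. -/

namespace Substitution

variable {A : Type u} {τ : Substitution A} {u : ℕ → A}

theorem iter_prefix_iter_succ {l : A} (hl : ∀ a, (τ.toFun a).head? = some l) (n : ℕ) (a : A) :
    τ.iter n l <+: τ.iter (n + 1) a := by
  obtain ⟨t, ht⟩ := List.head?_eq_some_iff.1 (hl a)
  have h1 : τ.iter (n + 1) a = τ.onWord^[n] ([l] ++ t) := by
    simp only [iter, Function.iterate_succ_apply, onWord_singleton, ht, List.singleton_append]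
  rw [h1, onWord_iterate_append]
  exact ⟨_, rfl⟩

theorem iter_prefix_iter_add {l : A} (hl : ∀ a, (τ.toFun a).head? = some l) {n k : ℕ}
    (hk : 1 ≤ k) (a : A) : τ.iter n l <+: τ.iter (n + k) a := by
  induction k, hk using Nat.le_induction generalizing a with
  | base => exact iter_prefix_iter_succ hl n a
  | succ k hk ih => exact (ih l).trans (iter_prefix_iter_succ hl (n + k) a)

theorem onSeq_pow_eq_self (hu : τ.onSeq u = u) (m : ℕ) : (τ.pow m).onSeq u = u := by
  induction m with
  | zero => exact onSeq_pow_zero τ u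
  | succ m ih => rw [onSeq_pow_succ, ih, hu]

namespace IsGeneratingFixedPoint

theorem apply_zero (hu : τ.IsGeneratingFixedPoint u) {l : A}
    (hl : ∀ a, (τ.toFun a).head? = some l) : u 0 = l := by
  rw [← hu.fixed, τ.onSeq_zero hl]

/-- Only the first letter of `u` is assumed to grow, but it is `l`, and `τⁿ(l)` is a prefix of every
later iterate of every letter. -/
theorem exists_le_length_iter (hu : τ.IsGeneratingFixedPoint u) {l : A}
    (hl : ∀ a, (τ.toFun a).head? = some l) (K : ℕ) :
    ∃ N, ∀ n ≥ N, ∀ a, K ≤ (τ.iter n a).length := by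
  obtain ⟨N, hN⟩ := Filter.eventually_atTop.1 (hu.growth.eventually_ge_atTop K)
  refine ⟨N + 1, fun n hn a => ?_⟩
  obtain ⟨k, rfl⟩ := Nat.exists_eq_add_of_le hn
  have h := (iter_prefix_iter_add hl (n := N) (k := 1 + k) (by omega) a).length_le
  rw [← Nat.add_assoc] at h
  have := hN N le_rfl
  rw [hu.apply_zero hl] at this
  omega

/-- Some prefix of `u` contains all letters; it is a prefix of `τᴺ(l)` for large `N`, hence of
`τᴺ⁺¹(a)` for every `a`. -/
theorem isPrimitive [Finite A] (hu : τ.IsGeneratingFixedPoint u) (hl : τ.IsLeftProper) :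
    τ.IsPrimitive := by
  obtain ⟨l, hl⟩ := hl
  obtain ⟨K, hK⟩ := exists_forall_letter_lt hu.letters
  obtain ⟨N, hN⟩ := hu.exists_le_length_iter hl K
  refine ⟨N + 1, by omega, fun a b => ?_⟩
  refine (iter_prefix_iter_succ hl N a).subset ?_
  obtain ⟨i, hi, rfl⟩ := hK b
  rw [← hu.apply_zero hl, ← τ.seqWord_iter hu.fixed N]
  have hi' : i < (seqWord u 0 (τ.iter N (u 0)).length).length := by
    rw [length_seqWord]
    exact hi.trans_le (hN N le_rfl _)
  exact List.mem_iff_getElem.2 ⟨i, hi', by rw [getElem_seqWord, Nat.zero_add]⟩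

theorem seqDrop_mem (hu : τ.IsGeneratingFixedPoint u) (p : ℕ) : seqDrop p u ∈ τ.subshift :=
  (mem_subshift_iff_of_language_eq hu.language_eq).2 fun _ => ⟨p, fun _ _ => rfl⟩

theorem mem (hu : τ.IsGeneratingFixedPoint u) : u ∈ τ.subshift :=
  seqDrop_zero u ▸ hu.seqDrop_mem 0

/-- Equality of languages is automatic: every `τⁿ(a)` occurs in the fixed point because `a` does,
and prefixes of the fixed point are prefixes of `τⁿ(y 0)`. -/
theorem of_growth {y : ℕ → A} (hfix : τ.onSeq y = y) (hlet : ∀ a, ∃ i, y i = a)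
    (hgrow : Filter.Tendsto (fun n => (τ.iter n (y 0)).length) Filter.atTop Filter.atTop) :
    τ.IsGeneratingFixedPoint y where
  fixed := hfix
  letters := hlet
  growth := hgrow
  language_eq := by
    ext w
    constructor
    · rintro ⟨n, -, a, hw⟩
      obtain ⟨i, rfl⟩ := hlet a
      have h := τ.iter_prefix hfix n (i + 1)
      refine mem_seqLanguage_of_infix hw (mem_seqLanguage_of_infix ?_ ⟨0, _, h.symm⟩)
      rw [seqWord_add, onWord_iterate_append, Nat.zero_add, seqWord_one]
      exact (List.suffix_append _ _).isInfix
    · rintro ⟨m, k, rfl⟩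
      obtain ⟨n, hn, h1⟩ := ((hgrow.eventually_ge_atTop (m + k)).and
        (Filter.eventually_ge_atTop 1)).exists
      refine ⟨n, h1, y 0, ?_⟩
      rw [← τ.seqWord_iter hfix n]
      exact seqWord_infix y hn

end IsGeneratingFixedPoint

/-! ### Moving a common suffix to the front. -/

section Rotation

variable {θ ρ : Substitution A} {s : List A}

/-- The two substitutions are conjugate by `s`. Lengths, injectivity on letters and the action on
sequences are all read off from this identity and its iterates. -/
theorem IsRotationBy.append_onWord (h : θ.IsRotationBy ρ s) (w : List A) :
    s ++ θ.onWord w = ρ.onWord w ++ s := by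
  induction w with
  | nil => simp
  | cons a w ih =>
    obtain ⟨v, h1, h2⟩ := h a
    rw [onWord_cons, onWord_cons, h1, h2]
    simp only [List.append_assoc]
    rw [ih]

theorem IsRotationBy.length_onWord (h : θ.IsRotationBy ρ s) (w : List A) :
    (ρ.onWord w).length = (θ.onWord w).length := by
  have := congrArg List.length (h.append_onWord w)
  simp at this
  omega

theorem IsRotationBy.exists_append_iterate (h : θ.IsRotationBy ρ s) (n : ℕ) :
    ∃ c : List A, ∀ w, c ++ θ.onWord^[n] w = ρ.onWord^[n] w ++ c := by
  induction n with
  | zero => exact ⟨[], by simp⟩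
  | succ n ih =>
    obtain ⟨c, hc⟩ := ih
    refine ⟨ρ.onWord c ++ s, fun w => ?_⟩
    rw [Function.iterate_succ_apply', Function.iterate_succ_apply', List.append_assoc,
      h.append_onWord, ← List.append_assoc, ← onWord_append, hc, onWord_append, List.append_assoc]

theorem IsRotationBy.length_iter (h : θ.IsRotationBy ρ s) (n : ℕ) (a : A) :
    (ρ.iter n a).length = (θ.iter n a).length := by
  obtain ⟨c, hc⟩ := h.exists_append_iterate n
  have := congrArg List.length (hc [a])
  simp only [List.length_append] at this
  simp only [iter]
  omega

theorem IsRotationBy.iter_injective (h : θ.IsRotationBy ρ s) {n : ℕ}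
    (hi : Function.Injective (θ.iter n)) : Function.Injective (ρ.iter n) := by
  obtain ⟨c, hc⟩ := h.exists_append_iterate n
  intro a b e
  refine hi (List.append_cancel_left (as := c) ?_)
  simp only [iter] at e ⊢
  rw [hc, hc, e]

theorem IsRotationBy.onSeq_eq (h : θ.IsRotationBy ρ s) (x : ℕ → A) :
    ρ.onSeq x = seqAppend s (θ.onSeq x) := by
  refine eq_of_forall_seqWord fun n => ⟨_, ρ.le_length_onWord_seqWord x 0 n, ?_⟩
  rw [seqWord_onSeq, θ.onSeq_eq_seqAppend x n, ← seqAppend_append, h.append_onWord,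
    seqAppend_append, seqWord_length_seqAppend]

theorem IsRotationBy.isSuffix_onWord (h : θ.IsRotationBy ρ s) {w : List A} (hw : w ≠ []) :
    s <:+ θ.onWord w := by
  obtain ⟨v, a, rfl⟩ := List.eq_nil_or_concat w |>.resolve_left hw
  obtain ⟨p, hp, -⟩ := h a
  rw [List.concat_eq_append, onWord_append, onWord_singleton, hp, ← List.append_assoc]
  exact List.suffix_append _ _

/-- Since `ρ(x) = s θ(x)`, cuttings of `ρ` become cuttings of `θ` after dropping `s`. For the same
reason the image of `ρ` is the preimage of `θ(X)` under `T^[s.length]`. -/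
theorem IsRotationBy.isRecognizableOn [Finite A] [TopologicalSpace A] [DiscreteTopology A]
    {X : Set (ℕ → A)} {T : X → X} (hX : IsMinimalSubshift X T) (hne : X.Nonempty)
    (hθ : θ.IsRecognizableOn X) (hs : s ≠ []) (h : θ.IsRotationBy ρ s) :
    ρ.IsRecognizableOn X := by
  have := compactSpace_of_isClosed hX.isClosed
  have hmem : ∀ x ∈ X, ρ.onSeq x ∈ X := by
    intro x hx
    obtain ⟨z, hz⟩ := hX.surjective ⟨x, hx⟩
    have hz' : seqDrop 1 z.1 = x := by rw [← hX.coe_apply, hz]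
    obtain ⟨p, hp, -⟩ := h (z.1 0)
    have e := θ.onSeq_eq_seqAppend z.1 1
    rw [seqWord_one, onWord_singleton, hp, hz', seqAppend_append, ← h.onSeq_eq] at e
    rw [← seqDrop_length_seqAppend p (ρ.onSeq x), ← e]
    exact hX.seqDrop_mem (hθ.onSeq_mem z.1 z.2) _
  have hdrop : ∀ x, seqDrop s.length (ρ.onSeq x) = θ.onSeq x := fun x => by
    rw [h.onSeq_eq, seqDrop_length_seqAppend]
  refine ⟨hmem, fun z hz v hv n e => ?_, ?_⟩
  · have e' := congrArg (seqDrop s.length) e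
    rw [seqDrop_seqDrop, Nat.add_comm, ← seqDrop_seqDrop, hdrop, hdrop] at e'
    obtain ⟨p, hp, hpv⟩ := hθ.exists_cutting z hz v hv n e'
    exact ⟨p, by rw [hp, h.length_onWord], hpv⟩
  · convert hθ.isOpen.preimage (hX.continuous.iterate s.length) using 1
    ext x
    constructor
    · rintro ⟨v, hv, e⟩
      refine ⟨v, hv, ?_⟩
      rw [hX.coe_iterate, e, hdrop]
    · rintro ⟨v, hv, e⟩
      rw [hX.coe_iterate] at e
      obtain ⟨x₀, hx₀⟩ := hne
      obtain ⟨M, hM⟩ := hX.minimal.exists_bound hX.continuous hθ.isOpenEmbedding_map.isOpen_range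
        ⟨_, ⟨⟨x₀, hx₀⟩, rfl⟩⟩
      obtain ⟨w, rfl⟩ := hX.surjective.iterate M x
      obtain ⟨j, hj, z, hz⟩ := hM w
      obtain ⟨k, rfl⟩ := Nat.exists_eq_add_of_le hj
      have ew : (T^[j + k] w).1 = seqDrop k (θ.onSeq z.1) := by
        rw [Nat.add_comm, Function.iterate_add_apply, ← hz, hX.coe_iterate]
        rfl
      rw [ew, seqDrop_seqDrop] at e
      -- Now `x` lies `k` places above `θ(z)`, and `k + s.length` is a cutting. The image of a
      -- nonempty word ends there, hence with `s`, so `x` begins with `s`.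
      obtain ⟨q, hq, hv'⟩ := hθ.exists_cutting z.1 z.2 v hv _ e
      have hq0 : seqWord z.1 0 q ≠ [] := by
        intro h0
        rw [h0, onWord_nil, List.length_nil] at hq
        have := List.length_pos_of_ne_nil hs
        omega
      obtain ⟨r, hr⟩ := h.isSuffix_onWord hq0
      have hrk : r.length = k := by
        rw [← hr, List.length_append] at hq
        omega
      refine ⟨v, hv, ?_⟩
      rw [ew, θ.onSeq_eq_seqAppend z.1 q, ← hr, hv', ← hrk, seqAppend_append,
        seqDrop_length_seqAppend, h.onSeq_eq]

end Rotation

/-! ### Stable endings and the sequence `s θ(s) θ²(s) ⋯`. -/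

/-- The words `s`, `s θ(s)`, `s θ(s) θ²(s)`, … -/
def endingWord (θ : Substitution A) (s : List A) : ℕ → List A
  | 0 => []
  | n + 1 => s ++ θ.onWord (endingWord θ s n)

section Ending

variable {θ : Substitution A} {s : List A}

theorem le_length_endingWord (θ : Substitution A) (hs : s ≠ []) (n : ℕ) :
    n ≤ (θ.endingWord s n).length := by
  induction n with
  | zero => exact Nat.zero_le _
  | succ n ih =>
    have h1 := List.length_pos_of_ne_nil hs
    have h2 := θ.length_le_onWord (θ.endingWord s n)
    simp only [endingWord, List.length_append]
    omega

theorem endingWord_prefix_succ (θ : Substitution A) (s : List A) (n : ℕ) :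
    θ.endingWord s n <+: θ.endingWord s (n + 1) := by
  induction n with
  | zero => exact List.nil_prefix
  | succ n ih =>
    obtain ⟨t, ht⟩ := ih
    refine ⟨θ.onWord t, ?_⟩
    conv_rhs => rw [endingWord, ← ht, onWord_append, ← List.append_assoc]
    rfl

theorem endingWord_prefix (θ : Substitution A) (s : List A) {m n : ℕ} (h : m ≤ n) :
    θ.endingWord s m <+: θ.endingWord s n := by
  induction n, h using Nat.le_induction with
  | base => exact List.prefix_rfl
  | succ n _ ih => exact ih.trans (θ.endingWord_prefix_succ s n)

/-- The sequence `s θ(s) θ²(s) ⋯`. -/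
theorem exists_endingSeq (θ : Substitution A) (hs : s ≠ []) :
    ∃ y : ℕ → A, (∀ n, seqWord y 0 (θ.endingWord s n).length = θ.endingWord s n) ∧
      seqAppend s (θ.onSeq y) = y := by
  have hlen : ∀ i, i < (θ.endingWord s (i + 1)).length := fun i =>
    θ.le_length_endingWord hs (i + 1)
  have hy : ∀ n, seqWord (fun i => (θ.endingWord s (i + 1))[i]'(hlen i)) 0
      (θ.endingWord s n).length = θ.endingWord s n := by
    intro n
    rw [eq_seqWord_iff]
    intro i hi
    simp only [Nat.zero_add]
    rw [(θ.endingWord_prefix s (le_max_left (i + 1) n)).getElem (hlen i),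
      (θ.endingWord_prefix s (le_max_right (i + 1) n)).getElem hi]
  refine ⟨fun i => (θ.endingWord s (i + 1))[i]'(hlen i), hy, ?_⟩
  refine eq_of_forall_seqWord fun n => ⟨(θ.endingWord s (n + 1)).length,
    (Nat.le_succ n).trans (θ.le_length_endingWord hs (n + 1)), ?_⟩
  rw [hy]
  have h := θ.seqWord_onSeq (fun i => (θ.endingWord s (i + 1))[i]'(hlen i))
    (θ.endingWord s n).length
  rw [hy] at h
  conv_lhs => rw [endingWord, List.length_append, seqWord_seqAppend_add, h]
  rfl

/-- Every letter of `S n` precedes the `n`-th ending word in some `n`-th iterate. Each `S n` has two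
letters, and by pigeonhole one pair serves infinitely many `n`. -/
theorem HasStableEnding.exists_pair [Finite A] (h : θ.HasStableEnding s) :
    ∃ a b : A, a ≠ b ∧ ∀ N, ∃ n ≥ N,
      (∃ c, a :: θ.endingWord s n <:+: θ.iter n c) ∧
      (∃ c, b :: θ.endingWord s n <:+: θ.iter n c) := by
  obtain ⟨S, -, hS⟩ := h
  have key : ∀ n, ∀ a ∈ S n, ∃ c q, θ.iter n c = q ++ a :: θ.endingWord s n := by
    intro n
    induction n with
    | zero => exact fun a _ => ⟨a, [], rfl⟩
    | succ n ih =>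
      intro a ha
      rw [(hS n).2.2] at ha
      obtain ⟨a', ha', p, hp⟩ := ha
      obtain ⟨c, q, hc⟩ := ih a' ha'
      refine ⟨c, θ.onWord q ++ p, ?_⟩
      rw [iter_succ, hc, onWord_append, onWord_cons, hp]
      simp [endingWord]
  choose a ha b hb hab using fun n => (hS n).1
  obtain ⟨⟨a₀, b₀⟩, hinf⟩ := Finite.exists_infinite_fiber fun n => (a n, b n)
  have hinf' := Set.infinite_coe_iff.1 hinf
  have hne : a₀ ≠ b₀ := by
    obtain ⟨n, hn⟩ := hinf'.nonempty
    obtain ⟨rfl, rfl⟩ := Prod.mk.inj hn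
    exact hab n
  refine ⟨a₀, b₀, hne, fun N => ?_⟩
  obtain ⟨n, hn, hN⟩ := hinf'.exists_gt N
  obtain ⟨rfl, rfl⟩ := Prod.mk.inj hn
  obtain ⟨c, q, hc⟩ := key n _ (ha n)
  obtain ⟨d, r, hd⟩ := key n _ (hb n)
  exact ⟨n, hN.le, ⟨c, hc ▸ (List.suffix_append _ _).isInfix⟩,
    ⟨d, hd ▸ (List.suffix_append _ _).isInfix⟩⟩

end Ending

/-! ### Models when the branch point is `u` or there is a stable ending. -/

section Main

variable [Finite A] [TopologicalSpace A] [DiscreteTopology A]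

/-- A substitution with a generating fixed point that is recognizable on a minimal subshift
is reasonable. -/
theorem isReasonable_of_isRecognizableOn {X : Set (ℕ → A)} {T : X → X}
    (hX : IsMinimalSubshift X T) {ρ : Substitution A} {y : ℕ → A}
    (hy : ρ.IsGeneratingFixedPoint y) (hρX : ρ.subshift = X) (hρ : ρ.IsRecognizableOn X)
    (hinj : ∀ n, Function.Injective (ρ.iter n)) : ρ.IsReasonable y where
  generating := hy
  minimal := hX.minimal.congr_of_eq hρX.symm hX.apply fun _ _ => rfl
  injective := hinj
  recognizable := by
    have := compactSpace_of_isClosed hX.isClosed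
    have hyX : y ∈ X := hρX ▸ hy.mem
    have hcl := (hρ.continuous_map.isClosedEmbedding hρ.map_injective).isClosed_range
    obtain ⟨L, hL⟩ := exists_agree_of_isClopen ⟨hcl, hρ.isOpenEmbedding_map.isOpen_range⟩
    refine ⟨L, ?_⟩
    rintro _ j e ⟨p, rfl⟩
    have hp : seqDrop (ρ.onWord (seqWord y 0 p)).length y = ρ.onSeq (seqDrop p y) := by
      rw [← ρ.seqDrop_onSeq, hy.fixed]
    obtain ⟨v, hv⟩ := hL ⟨_, hX.seqDrop_mem hyX (ρ.onWord (seqWord y 0 p)).length⟩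
      ⟨_, hX.seqDrop_mem hyX j⟩ (fun i hi => (seqWord_eq_iff.1 e i hi).symm)
      ⟨⟨_, hX.seqDrop_mem hyX p⟩, Subtype.ext hp.symm⟩
    have hv' : seqDrop j (ρ.onSeq y) = ρ.onSeq v.1 := by
      rw [hy.fixed]
      exact (congrArg Subtype.val hv).symm
    obtain ⟨q, hq, -⟩ := hρ.exists_cutting y hyX v.1 v.2 j hv'
    exact ⟨q, hq⟩

theorem _root_.IsQuasiInvertible.eq_of_isBranchPoint {Y : Type*} {T : Y → Y} {y : Y}
    (h : IsQuasiInvertible T) (hy : IsBranchPoint T y) (x x' : Y) (hne : x ≠ x')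
    (e : T x = T x') : T x = y :=
  h.unique ⟨x, x', hne, rfl, e.symm⟩ hy

theorem isSemiProperModel_of_branchPoint_eq [Nonempty A] {τ : Substitution A}
    (hproper : τ.IsLeftProper) (hreas : τ.IsReasonable u) (hquasi : IsQuasiInvertible τ.shift)
    {y : τ.subshift} (hy : IsBranchPoint τ.shift y) (hyu : y.1 = u) :
    ∃ h : τ.IsPrimitive,
      (τ.diagram h).IsStationary ∧ (τ.diagram h).IsSemiProperModel τ.shift := by
  have hp := hreas.generating.isPrimitive hproper
  obtain ⟨l, hl⟩ := hproper
  refine ⟨hp, isStationary_diagram hp, isSemiProperModel_diagram (isMinimalSubshift hreas.minimal)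
    hreas.isRecognizableOn hp hl (fun a => ?_) (y := y) (Subtype.ext ?_)
    (hquasi.eq_of_isBranchPoint hy)⟩
  · obtain ⟨i, rfl⟩ := hreas.generating.letters a
    exact ⟨⟨_, hreas.generating.seqDrop_mem i⟩, rfl⟩
  · change τ.onSeq y.1 = y.1
    rw [hyu, hreas.generating.fixed]

theorem not_injective_of_isBranchPoint {Y : Type*} {T : Y → Y} {y : Y} (h : IsBranchPoint T y) :
    ¬ Function.Injective T := by
  obtain ⟨x, x', hne, e, e'⟩ := h
  exact fun hi => hne (hi (e.trans e'.symm))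

omit [TopologicalSpace A] [DiscreteTopology A] in
/-- The limit `s θ(s) θ²(s) ⋯` of the stable endings is a branch point. -/
theorem exists_isBranchPoint_of_hasStableEnding {τ : Substitution A} {m : ℕ} (hm : 1 ≤ m)
    {s : List A} (hs : s ≠ []) (hst : (τ.pow m).HasStableEnding s) :
    ∃ y : τ.subshift, IsBranchPoint τ.shift y ∧
      seqAppend s ((τ.pow m).onSeq y.1) = y.1 := by
  obtain ⟨y, hy, hfix⟩ := (τ.pow m).exists_endingSeq hs
  obtain ⟨a, b, hab, hfreq⟩ := hst.exists_pair
  have hmem : ∀ a, (∀ N, ∃ n ≥ N, ∃ c, a :: (τ.pow m).endingWord s n <:+: (τ.pow m).iter n c) →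
      seqAppend [a] y ∈ τ.subshift := by
    intro a ha
    refine mem_subshift_of_frequently fun n => ?_
    obtain ⟨k, hk, c, hc⟩ := ha (n + 1)
    have hlen := (τ.pow m).le_length_endingWord hs k
    refine ⟨[a].length + ((τ.pow m).endingWord s k).length, by omega, ?_⟩
    rw [seqWord_seqAppend_add, hy]
    refine ⟨m * k, Nat.mul_pos hm (by omega), c, ?_⟩
    rwa [← iter_pow]
  have hA := hmem a fun N => (hfreq N).imp fun n h => ⟨h.1, h.2.1⟩
  have hB := hmem b fun N => (hfreq N).imp fun n h => ⟨h.1, h.2.2⟩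
  have hsh : ∀ a (h : seqAppend [a] y ∈ τ.subshift), (τ.shift ⟨_, h⟩).1 = y := fun a h => by
    funext n
    change seqAppend [a] y (n + 1) = y n
    rw [Nat.add_comm]
    exact seqAppend_apply_add [a] y n
  refine ⟨τ.shift ⟨_, hA⟩, ⟨⟨_, hA⟩, ⟨_, hB⟩, fun e => hab ?_, rfl, ?_⟩, ?_⟩
  · exact congrFun (congrArg Subtype.val e) 0
  · exact Subtype.ext ((hsh b hB).trans (hsh a hA).symm)
  · rw [hsh]; exact hfix

/-- The modified substitution begins all its words with `s`, fixes the branch point and is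
recognizable, so the model for a fixed branch point applies to it. -/
theorem isSemiProperModel_of_hasStableEnding [Nonempty A] {τ : Substitution A}
    (hproper : τ.IsLeftProper) (hreas : τ.IsReasonable u) (hquasi : IsQuasiInvertible τ.shift)
    {m : ℕ} {s : List A} {ρ : Substitution A} (hm : 1 ≤ m) (hs : s ≠ [])
    (hst : (τ.pow m).HasStableEnding s) (hrot : (τ.pow m).IsRotationBy ρ s) :
    ρ.subshift = τ.subshift ∧ ρ.IsLeftProper ∧
      (∀ y : τ.subshift, IsBranchPoint τ.shift y → y.1 ≠ u ∧ ρ.IsReasonable y.1) ∧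
      ∃ h : ρ.IsPrimitive,
        (ρ.diagram h).IsStationary ∧ (ρ.diagram h).IsSemiProperModel τ.shift := by
  have hX := isMinimalSubshift hreas.minimal
  have := compactSpace_of_isClosed hX.isClosed
  have hu := hreas.generating
  obtain ⟨l, hl⟩ := hproper
  have hθ := hreas.isRecognizableOn.pow m
  have hρ := hrot.isRecognizableOn hX ⟨u, hu.mem⟩ hθ hs
  obtain ⟨y, hy, hfix⟩ := exists_isBranchPoint_of_hasStableEnding hm hs hst
  have hρfix : ρ.onSeq y.1 = y.1 := by rw [hrot.onSeq_eq, hfix]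
  have hlet : ∀ a, ∃ i, y.1 i = a := fun a => by
    obtain ⟨j, rfl⟩ := hu.letters a
    exact hX.exists_apply_eq y.2 hu.mem j
  have hgen : ρ.IsGeneratingFixedPoint y.1 := by
    refine .of_growth hρfix hlet (Filter.tendsto_atTop.2 fun K => ?_)
    obtain ⟨N, hN⟩ := hu.exists_le_length_iter hl K
    refine Filter.eventually_atTop.2 ⟨N, fun n hn => ?_⟩
    rw [hrot.length_iter, iter_pow]
    exact hN _ (hn.trans (Nat.le_mul_of_pos_left n hm)) _
  -- By minimality of `τ.subshift`, its points `y` and `u` contain the same words.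
  have hsub : ρ.subshift = τ.subshift := by
    ext x
    rw [mem_subshift_iff_of_language_eq hgen.language_eq,
      mem_subshift_iff_of_language_eq hu.language_eq]
    constructor
    · intro h N
      obtain ⟨p, hp⟩ := h N
      obtain ⟨q, hq⟩ := hX.exists_agree hu.mem y.2 (p + N)
      exact ⟨q + p, fun i hi => by rw [hp i hi, ← hq _ (by omega), Nat.add_assoc]⟩
    · intro h N
      obtain ⟨p, hp⟩ := h N
      obtain ⟨q, hq⟩ := hX.exists_agree y.2 hu.mem (p + N)
      exact ⟨q + p, fun i hi => by rw [hp i hi, ← hq _ (by omega), Nat.add_assoc]⟩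
  obtain ⟨c, t, rfl⟩ := List.exists_cons_of_ne_nil hs
  have hρl : ∀ a, (ρ.toFun a).head? = some c := fun a => by
    obtain ⟨w, -, hw⟩ := hrot a
    rw [hw]
    rfl
  have hp := hgen.isPrimitive ⟨c, hρl⟩
  refine ⟨hsub, ⟨c, hρl⟩, fun y' hy' => ?_, hp, isStationary_diagram hp,
    isSemiProperModel_diagram hX hρ hp hρl (fun a => ?_) (y := y) (Subtype.ext hρfix)
      (hquasi.eq_of_isBranchPoint hy)⟩
  · obtain rfl := hquasi.unique hy hy'
    refine ⟨fun e => ?_, isReasonable_of_isRecognizableOn hX hgen hsub hρ fun n =>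
      hrot.iter_injective ?_⟩
    -- If `y = u`, then `u = s u` is periodic and the shift is injective, which the branch point
    -- excludes.
    · rw [e, onSeq_pow_eq_self hu.fixed] at hfix
      refine not_injective_of_isBranchPoint hy (hX.injective_of_periodic (y := y)
        (t := (c :: t).length) (by simp) (Subtype.ext ?_))
      rw [hX.coe_iterate, e]
      conv_lhs => rw [← hfix, seqDrop_length_seqAppend]
    · have : (τ.pow m).iter n = τ.iter (m * n) := funext (iter_pow τ m n)
      rw [this]
      exact hreas.injective _
  · obtain ⟨i, rfl⟩ := hu.letters a
    exact ⟨⟨_, hu.seqDrop_mem i⟩, rfl⟩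

end Main

end Substitution

/-! ### The word `s` with `y = s θ(y)`. -/

section ListSuffix

variable {A : Type u}

theorem List.suffix_or_exists_ne (w v : List A) :
    w <:+ v ∨ v <:+ w ∨ ∃ (p q s : List A) (c d : A), c ≠ d ∧ w = p ++ c :: s ∧
      v = q ++ d :: s := by
  induction w using List.reverseRecOn generalizing v with
  | nil => exact Or.inl List.nil_suffix
  | append_singleton w a ih =>
    induction v using List.reverseRecOn with
    | nil => exact Or.inr (Or.inl List.nil_suffix)
    | append_singleton v b _ =>
      by_cases hab : a = b
      · subst hab
        rcases ih v with ⟨p, hp⟩ | ⟨p, hp⟩ | ⟨p, q, s, c, d, hcd, hw, hv⟩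
        · exact Or.inl ⟨p, by rw [← hp, List.append_assoc]⟩
        · exact Or.inr (Or.inl ⟨p, by rw [← hp, List.append_assoc]⟩)
        · exact Or.inr (Or.inr ⟨p, q, s ++ [a], c, d, hcd, by simp [hw], by simp [hv]⟩)
      · exact Or.inr (Or.inr ⟨w, v, [], a, b, hab, rfl, rfl⟩)

end ListSuffix

section Branch

variable {A : Type u} [Finite A] [TopologicalSpace A] [DiscreteTopology A] {X : Set (ℕ → A)}
  {T : X → X} {θ : Substitution A}

namespace IsMinimalSubshift

omit [Finite A] [DiscreteTopology A] in
theorem eq_seqAppend (hX : IsMinimalSubshift X T) (x : X) : x.1 = seqAppend [x.1 0] (T x).1 := by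
  rw [hX.coe_apply, ← seqWord_one, seqAppend_seqWord_seqDrop]

omit [Finite A] [DiscreteTopology A] in
theorem onSeq_eq (hX : IsMinimalSubshift X T) (θ : Substitution A) (x : X) :
    θ.onSeq x.1 = seqAppend (θ.toFun (x.1 0)) (θ.onSeq (T x).1) := by
  conv_lhs => rw [hX.eq_seqAppend x, θ.onSeq_seqAppend, Substitution.onWord_singleton]

-- The shorter image would start at a cutting of `θ(x)` inside the first block, which can only be
-- its beginning. Hence the images of the first letters of distinct preimages differ before either
-- one is exhausted.
omit [Finite A] [DiscreteTopology A] in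
theorem eq_of_toFun_isSuffix (hX : IsMinimalSubshift X T) (hθ : θ.IsRecognizableOn X) {x x' : X}
    (e : T x = T x') (h : θ.toFun (x'.1 0) <:+ θ.toFun (x.1 0)) : x = x' := by
  obtain ⟨q, hq⟩ := h
  have h1 : seqDrop q.length (θ.onSeq x.1) = θ.onSeq x'.1 := by
    rw [hX.onSeq_eq θ x, ← hq, seqAppend_append, seqDrop_length_seqAppend, hX.onSeq_eq θ x', e]
  obtain ⟨p, hp, hpx⟩ := hθ.exists_cutting x.1 x.2 x'.1 x'.2 _ h1
  rcases Nat.eq_zero_or_pos p with rfl | hp0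
  · exact Subtype.ext (by rw [← hpx, seqDrop_zero])
  · have h2 := θ.length_onWord_seqWord_mono x.1 (show 1 ≤ p from hp0)
    rw [seqWord_one, Substitution.onWord_singleton, ← hp, ← hq, List.length_append] at h2
    have := θ.length_toFun_pos (x'.1 0)
    omega

omit [Finite A] [DiscreteTopology A] in
/-- Two preimages of the branch point `y` determine a word `s` such that `y = s θ(y)`. -/
theorem exists_common_suffix (hX : IsMinimalSubshift X T) (hθ : θ.IsRecognizableOn X) {y : X}
    (hbr : ∀ x x' : X, x ≠ x' → T x = T x' → T x = y) {x x' : X} (hne : x ≠ x') (hx : T x = y)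
    (hx' : T x' = y) :
    ∃ s, seqAppend s (θ.onSeq y.1) = y.1 ∧ s <:+ θ.toFun (x.1 0) ∧ s <:+ θ.toFun (x'.1 0) := by
  rcases List.suffix_or_exists_ne (θ.toFun (x.1 0)) (θ.toFun (x'.1 0)) with
    h | h | ⟨p, q, s, c, d, hcd, hp, hq⟩
  · exact absurd (hX.eq_of_toFun_isSuffix hθ (hx'.trans hx.symm) h).symm hne
  · exact absurd (hX.eq_of_toFun_isSuffix hθ (hx.trans hx'.symm) h) hne
  · have key : ∀ (x : X) (p : List A) (c : A), T x = y → θ.toFun (x.1 0) = p ++ c :: s →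
        ∃ z : X, z.1 0 = c ∧ (T z).1 = seqAppend s (θ.onSeq y.1) := by
      intro x p c hx hp
      refine ⟨⟨_, hX.seqDrop_mem (hθ.onSeq_mem x.1 x.2) p.length⟩, ?_, ?_⟩
      · simp only [hX.onSeq_eq θ x, hp, seqAppend_append, seqDrop_length_seqAppend]
        rfl
      · rw [hX.coe_apply]
        simp only [hX.onSeq_eq θ x, hp, seqAppend_append, seqDrop_length_seqAppend, hx]
        rw [← List.singleton_append, seqAppend_append]
        exact seqDrop_length_seqAppend [c] _
    obtain ⟨z, hz0, hz⟩ := key x p c hx hp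
    obtain ⟨z', hz0', hz'⟩ := key x' q d hx' hq
    refine ⟨s, ?_, ⟨p ++ [c], by simp [hp]⟩, ⟨q ++ [d], by simp [hq]⟩⟩
    rw [← hz]
    refine congrArg Subtype.val (hbr z z' (fun e => hcd ?_) (Subtype.ext (hz.trans hz'.symm)))
    rw [← hz0, ← hz0', e]

/-- Different pairs of preimages might give different words, but the branch point is not periodic,
so the word is the same for all of them. -/
theorem exists_suffix_of_isBranchPoint (hX : IsMinimalSubshift X T) (hθ : θ.IsRecognizableOn X)
    {y : X} (hy : IsBranchPoint T y) (hbr : ∀ x x' : X, x ≠ x' → T x = T x' → T x = y) :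
    ∃ s, seqAppend s (θ.onSeq y.1) = y.1 ∧ ∀ x : X, T x = y → s <:+ θ.toFun (x.1 0) := by
  have := compactSpace_of_isClosed hX.isClosed
  have hnot := Substitution.not_injective_of_isBranchPoint hy
  obtain ⟨x, x', hne, hx, hx'⟩ := hy
  obtain ⟨s, hs, h1, -⟩ := hX.exists_common_suffix hθ hbr hne hx hx'
  refine ⟨s, hs, fun z hz => ?_⟩
  by_cases hxz : x = z
  · exact hxz ▸ h1
  obtain ⟨t, ht, h2, h3⟩ := hX.exists_common_suffix hθ hbr hxz hx hz
  -- If both `a` and `r a` complete `θ(y)` to `y`, then `y = r y`, and `y` is periodic unless `r` is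
  -- empty.
  have key : ∀ r a b : List A, seqAppend a (θ.onSeq y.1) = y.1 → seqAppend b (θ.onSeq y.1) = y.1 →
      r ++ a = b → r = [] := by
    rintro r a _ ha hb rfl
    by_contra hr
    refine hnot (hX.injective_of_periodic (y := y) (List.length_pos_of_ne_nil hr)
      (Subtype.ext ?_))
    rw [seqAppend_append, ha] at hb
    rw [hX.coe_iterate]
    conv_lhs => rw [← hb, seqDrop_length_seqAppend]
  rcases List.suffix_or_suffix_of_suffix h1 h2 with ⟨r, hr⟩ | ⟨r, hr⟩
  · rwa [← show r ++ s = s by rw [key r s t hs ht hr]; rfl, hr]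
  · rw [key r t s ht hs hr, List.nil_append] at hr
    rwa [← hr]

/-- The points whose first letter begins no preimage of `y` form a compact set whose image misses
`y`, hence misses a cylinder around `y`. -/
theorem exists_agree_preimage (hX : IsMinimalSubshift X T) (y : X) :
    ∃ N, 1 ≤ N ∧ ∀ x : X, (∀ i < N, (T x).1 i = y.1 i) → ∃ x' : X, T x' = y ∧ x'.1 0 = x.1 0 := by
  have := compactSpace_of_isClosed hX.isClosed
  have hC : IsClosed {x : X | ¬ ∃ x' : X, T x' = y ∧ x'.1 0 = x.1 0} := by
    rw [isClosed_iff_agree]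
    rintro x hx ⟨x', h1, h2⟩
    obtain ⟨z, hz, e⟩ := hx 1
    exact hz ⟨x', h1, by rw [h2, e 0 one_pos]⟩
  have hO := (hC.isCompact.image hX.continuous).isClosed.isOpen_compl
  obtain ⟨N, hN⟩ := isOpen_iff_agree.1 hO y (by rintro ⟨x, hx, rfl⟩; exact hx ⟨x, rfl, rfl⟩)
  refine ⟨N + 1, by omega, fun x hx => ?_⟩
  by_contra hcon
  exact hN (T x) (fun i hi => hx i (by omega)) ⟨x, hcon, rfl⟩

end IsMinimalSubshift

end Branch

/-! ### Stationary diagrams given by sets of positions. -/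

namespace OrderedBratteliDiagram

theorem Reaches.trans {B : OrderedBratteliDiagram.{u}} {m n k : ℕ} {a : B.V m} {b : B.V n}
    {c : B.V k} (h : B.Reaches a n b) (h' : B.Reaches b k c) : B.Reaches a k c := by
  induction h' with
  | refl => exact h
  | step e _ ih => exact .step e ih

/-- A family of types that is constant from level `1` on. -/
def Level (P Q : Type u) : ℕ → Type u
  | 0 => P
  | _ + 1 => Q

instance (P Q : Type u) [TopologicalSpace P] [TopologicalSpace Q] :
    ∀ n, TopologicalSpace (Level P Q n)
  | 0 => inferInstanceAs (TopologicalSpace P)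
  | _ + 1 => inferInstanceAs (TopologicalSpace Q)

/-- The stationary diagram with vertices `R` above level `0` in which the edges with range `r`
are the numbers in `P₀ r` at level `0`, and the numbers in `P r` above. -/
def ofPositions {R : Type u} [Finite R] [Nonempty R] (P₀ P : R → Set ℕ)
    (src : (Σ r, P r) → R) (h₀ : ∀ r, (P₀ r).Finite ∧ (P₀ r).Nonempty)
    (h : ∀ r, (P r).Finite ∧ (P r).Nonempty) (hsrc : Function.Surjective src) :
    OrderedBratteliDiagram.{u} where
  V := Level PUnit R
  E := Level (Σ r, P₀ r) (Σ r, P r)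
  finite_V
    | 0 => inferInstanceAs (Finite PUnit)
    | _ + 1 => inferInstanceAs (Finite R)
  finite_E
    | 0 => by
      have := fun r => (h₀ r).1.to_subtype
      exact inferInstanceAs (Finite (Σ r, P₀ r))
    | _ + 1 => by
      have := fun r => (h r).1.to_subtype
      exact inferInstanceAs (Finite (Σ r, P r))
  root := ⟨PUnit.unit, fun _ => rfl⟩
  source {n} :=
    match n with
    | 0 => fun _ => PUnit.unit
    | _ + 1 => src
  range {n} :=
    match n with
    | 0 => fun e => e.1
    | _ + 1 => fun e => e.1
  source_surjective
    | 0 => fun _ => ⟨⟨Classical.arbitrary R, _, (h₀ _).2.some_mem⟩, rfl⟩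
    | _ + 1 => hsrc
  range_surjective
    | 0 => fun r => ⟨⟨r, _, (h₀ r).2.some_mem⟩, rfl⟩
    | _ + 1 => fun r => ⟨⟨r, _, (h r).2.some_mem⟩, rfl⟩
  order
    | 0 => inferInstanceAs (PartialOrder (Σ r, P₀ r))
    | _ + 1 => inferInstanceAs (PartialOrder (Σ r, P r))
  comparable_iff {n} := by
    have key : ∀ (Q : R → Set ℕ) (e f : Σ r, Q r), (e ≤ f ∨ f ≤ e) ↔ e.1 = f.1 := by
      rintro Q ⟨a, i⟩ ⟨b, j⟩
      refine ⟨?_, ?_⟩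
      · rintro (⟨_, _, _⟩ | ⟨_, _, _⟩) <;> rfl
      · intro hab
        obtain rfl : a = b := hab
        exact (le_total i j).imp (fun h => Sigma.mk_le_mk_iff.2 h)
          (fun h => Sigma.mk_le_mk_iff.2 h)
    exact match n with
      | 0 => key P₀
      | _ + 1 => key P

end OrderedBratteliDiagram

/-- `D x` and `k x` are the base point of `x` in a tower and the position of `x` above it, and
the set of positions above a point of the base is determined by its type `π`. -/
structure IsPositioned {Y Y' R : Type*} (T : Y → Y) (T' : Y' → Y') (D : Y → Y') (k : Y → ℕ)
    (π : Y' → R) (P : R → Set ℕ) : Prop where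
  mem : ∀ x, k x ∈ P (π (D x))
  exists_eq : ∀ z, ∀ j ∈ P (π z), ∃ x, D x = z ∧ k x = j
  step : ∀ x, (D (T x) = T' (D x) ∧ k (T x) = 0 ∧ ∀ j ∈ P (π (D x)), j ≤ k x) ∨
    (D (T x) = D x ∧ k x < k (T x) ∧ ∀ j ∈ P (π (D x)), k x < j → k (T x) ≤ j)

namespace IsPositioned

variable {Y Y' R : Type*} {T : Y → Y} {T' : Y' → Y'} {D : Y → Y'} {k : Y → ℕ}
  {π : Y' → R} {P : R → Set ℕ} (h : IsPositioned T T' D k π P)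

/-- The pair of the type of the base point and the position. -/
def edge (x : Y) : Σ r, P r := ⟨π (D x), k x, h.mem x⟩

theorem edge_eq {x : Y} {r : R} {j : P r} (h1 : π (D x) = r) (h2 : k x = j) :
    h.edge x = ⟨r, j⟩ := by
  subst h1
  exact Sigma.ext rfl (heq_of_eq (Subtype.ext h2))

theorem exists_edge_eq (z : Y') (e : Σ r, P r) (he : e.1 = π z) :
    ∃ x, D x = z ∧ h.edge x = e := by
  obtain ⟨r, j⟩ := e
  obtain rfl : r = π z := he
  obtain ⟨x, h1, h2⟩ := h.exists_eq z j j.2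
  exact ⟨x, h1, h.edge_eq (by rw [h1]) h2⟩

theorem step_of_isMax {x : Y} (hx : IsMax (h.edge x)) :
    IsMin (h.edge (T x)) ∧ D (T x) = T' (D x) := by
  rcases h.step x with ⟨h1, h2, -⟩ | ⟨h1, h2, -⟩
  · exact ⟨Sigma.isMin_mk_iff.2 fun j _ => Subtype.coe_le_coe.1 (h2.trans_le (Nat.zero_le _)), h1⟩
  · have hm := h.mem (T x)
    rw [h1] at hm
    have hmax : IsMax (⟨k x, h.mem x⟩ : P (π (D x))) :=
      Sigma.isMax_mk_iff (α := fun r => P r) |>.1 hx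
    have hle : (⟨k x, h.mem x⟩ : P (π (D x))) ≤ ⟨k (T x), hm⟩ := h2.le
    exact absurd (hmax hle) (not_le_of_gt h2)

theorem step_of_not_isMax {x : Y} (hx : ¬ IsMax (h.edge x)) :
    h.edge x ⋖ h.edge (T x) ∧ D (T x) = D x := by
  rcases h.step x with ⟨-, -, h3⟩ | ⟨h1, h2, h3⟩
  · exact absurd (Sigma.isMax_mk_iff.2 fun j _ => h3 j j.2) hx
  · have hm := h.mem (T x)
    rw [h1] at hm
    refine ⟨?_, h1⟩
    rw [h.edge_eq (x := T x) (j := ⟨k (T x), hm⟩) (by rw [h1]) rfl]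
    exact Sigma.mk_covBy_mk ⟨h2, fun j hj hj' => absurd (h3 j j.2 hj) (not_le_of_gt hj')⟩

theorem continuous_edge [TopologicalSpace Y] [TopologicalSpace R] [DiscreteTopology R]
    [TopologicalSpace (Σ r, P r)] [DiscreteTopology (Σ r, P r)]
    (hD : Continuous fun x => π (D x)) (hk : Continuous k) : Continuous h.edge := by
  refine continuous_discrete_rng.2 ?_
  rintro ⟨r, j⟩
  have : h.edge ⁻¹' {⟨r, j⟩} = (fun x => (π (D x), k x)) ⁻¹' {(r, j.1)} := by
    ext x
    simp only [Set.mem_preimage, Set.mem_singleton_iff, Prod.mk.injEq]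
    constructor
    · intro e
      obtain ⟨rfl, e⟩ := Sigma.mk.inj_iff.1 e
      exact ⟨rfl, by rw [← eq_of_heq e]⟩
    · rintro ⟨h1, h2⟩
      exact h.edge_eq h1 h2
  rw [this]
  exact (isOpen_discrete _).preimage (hD.prodMk hk)

end IsPositioned

theorem Substitution.agree_seqAppend_onSeq {A : Type u} (θ : Substitution A)
    (s : List A) {x x' : ℕ → A} {p : ℕ} (h : ∀ i < p, x i = x' i)
    {i : ℕ} (hi : i < s.length + (θ.onWord (seqWord x 0 p)).length) :
    seqAppend s (θ.onSeq x) i = seqAppend s (θ.onSeq x') i := by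
  rcases lt_or_ge i s.length with h1 | h1
  · rw [seqAppend_apply_of_lt h1, seqAppend_apply_of_lt h1]
  · obtain ⟨j, rfl⟩ := Nat.exists_eq_add_of_le h1
    rw [seqAppend_apply_add, seqAppend_apply_add, θ.onSeq_agree h (by omega)]

/-! ### Return words to a cylinder. -/

section Cylinders

variable {A : Type u} {X : Set (ℕ → A)} {T : X → X}

/-- The points of `X` that agree with `y` on the first `N` letters. -/
def seqCylinder (y : X) (N : ℕ) : Set X := {z | ∀ i < N, z.1 i = y.1 i}

theorem self_mem_seqCylinder (y : X) (N : ℕ) : y ∈ seqCylinder y N := fun _ _ => rfl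

/-- The word read until the first return of `z` to `U`. -/
noncomputable def returnWord (T : X → X) (U : Set X) (z : X) : List A :=
  seqWord z.1 0 (returnTime T U z)

@[simp] theorem length_returnWord (T : X → X) (U : Set X) (z : X) :
    (returnWord T U z).length = returnTime T U z := by
  simp [returnWord]

namespace IsMinimalSubshift

variable [TopologicalSpace A]

theorem iterate_apply (hX : IsMinimalSubshift X T) (n : ℕ) (x : X) (i : ℕ) :
    (T^[n] x).1 i = x.1 (n + i) := by
  rw [hX.coe_iterate, seqDrop_apply]

theorem iterate_mem_seqCylinder (hX : IsMinimalSubshift X T) {y : X} {N n : ℕ} {x x' : X}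
    (h : ∀ i < n + N, x.1 i = x'.1 i) (hx : T^[n] x ∈ seqCylinder y N) :
    T^[n] x' ∈ seqCylinder y N := fun i hi => by
  rw [← hx i hi, hX.iterate_apply, hX.iterate_apply, h _ (by omega)]

theorem returnTime_congr (hX : IsMinimalSubshift X T) {y : X} {N n : ℕ} {x x' : X}
    (h : ∀ i < n + N, x.1 i = x'.1 i)
    (hx : 0 < returnTime T (seqCylinder y N) x ∧
      T^[returnTime T (seqCylinder y N) x] x ∈ seqCylinder y N)
    (hn : returnTime T (seqCylinder y N) x ≤ n) :
    returnTime T (seqCylinder y N) x' = returnTime T (seqCylinder y N) x := by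
  refine returnTime_eq hx.1 (hX.iterate_mem_seqCylinder (fun i hi => h i (by omega)) hx.2) ?_
  intro i h0 hi hmem
  exact IsTowerBase.notMem_of_lt_returnTime h0 hi
    (hX.iterate_mem_seqCylinder (fun j hj => (h j (by omega)).symm) hmem)

theorem returnWord_congr (hX : IsMinimalSubshift X T) {y : X} {N n : ℕ} {x x' : X}
    (h : ∀ i < n + N, x.1 i = x'.1 i)
    (hx : 0 < returnTime T (seqCylinder y N) x ∧
      T^[returnTime T (seqCylinder y N) x] x ∈ seqCylinder y N)
    (hn : returnTime T (seqCylinder y N) x ≤ n) :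
    returnWord T (seqCylinder y N) x' = returnWord T (seqCylinder y N) x := by
  rw [returnWord, returnWord, hX.returnTime_congr h hx hn, seqWord_eq_iff]
  intro i hi
  rw [Nat.zero_add, h i (by omega)]

/-- Points with the same return word agree up to `N` letters beyond it. -/
theorem agree_of_returnWord_eq (hX : IsMinimalSubshift X T) {y : X} {N : ℕ} {x x' : X}
    (h : returnWord T (seqCylinder y N) x = returnWord T (seqCylinder y N) x')
    (hx : T^[returnTime T (seqCylinder y N) x] x ∈ seqCylinder y N)
    (hx' : T^[returnTime T (seqCylinder y N) x'] x' ∈ seqCylinder y N) :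
    ∀ i < returnTime T (seqCylinder y N) x + N, x.1 i = x'.1 i := by
  have hr : returnTime T (seqCylinder y N) x = returnTime T (seqCylinder y N) x' := by
    simpa using congrArg List.length h
  intro i hi
  rcases lt_or_ge i (returnTime T (seqCylinder y N) x) with h1 | h1
  · rw [returnWord, returnWord, ← hr, seqWord_eq_iff] at h
    simpa using h i h1
  · obtain ⟨j, rfl⟩ := Nat.exists_eq_add_of_le h1
    rw [← hX.iterate_apply, hx j (by omega), hr, ← hX.iterate_apply, hx' j (by omega)]

end IsMinimalSubshift

end Cylinders

/-! ### The map `z ↦ s θ(z)` near the branch point. -/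

/-- A substitution `θ` on a minimal subshift with the branch point `y = s θ(y)`, and a cylinder
around `y` on which `z ↦ s θ(z)` is defined and which returns more slowly after an application
of `θ`. -/
structure ReturnSystem {A : Type u} [TopologicalSpace A] (X : Set (ℕ → A)) (T : X → X)
    (θ : Substitution A) (s : List A) (y : X) (N : ℕ) : Prop where
  subshift : IsMinimalSubshift X T
  recog : θ.IsRecognizableOn X
  branch : ∀ x x' : X, x ≠ x' → T x = T x' → T x = y
  fixed : seqAppend s (θ.onSeq y.1) = y.1
  pos : 1 ≤ N
  suffix : ∀ x : X, T x ∈ seqCylinder y N → s <:+ θ.toFun (x.1 0)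
  long : ∀ a z, returnTime T (seqCylinder y N) z + N + 2 ≤ (θ.toFun a).length

namespace ReturnSystem

variable {A : Type u} [Finite A] [TopologicalSpace A] [DiscreteTopology A] {X : Set (ℕ → A)}
  {T : X → X} {θ : Substitution A} {s : List A} {y : X} {N : ℕ}

omit [DiscreteTopology A] in
theorem compactSpace (h : ReturnSystem X T θ s y N) : CompactSpace X :=
  compactSpace_of_isClosed h.subshift.isClosed

theorem isTowerBase (h : ReturnSystem X T θ s y N) : IsTowerBase T (seqCylinder y N) := by
  have := h.compactSpace
  exact h.subshift.isTowerBase (isClopen_setOf_agree y.1 N) (self_mem_seqCylinder y N) h.branch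

/-- The length of the image of the return word. -/
noncomputable def imageTime (_ : ReturnSystem X T θ s y N) (z : X) : ℕ :=
  (θ.onWord (returnWord T (seqCylinder y N) z)).length

/-- For a preimage `x` of `z`, the word `θ(x 0)` ends with `s`, so `s θ(z)` is a tail of `θ(x)`. -/
theorem seqAppend_onSeq_mem (h : ReturnSystem X T θ s y N) {z : X} (hz : z ∈ seqCylinder y N) :
    seqAppend s (θ.onSeq z.1) ∈ X := by
  have := h.compactSpace
  obtain ⟨x, rfl⟩ := h.subshift.surjective z
  obtain ⟨p, hp⟩ := h.suffix x hz
  have := h.subshift.seqDrop_mem (h.recog.onSeq_mem x.1 x.2) p.length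
  rwa [h.subshift.onSeq_eq θ x, ← hp, seqAppend_append, seqDrop_length_seqAppend] at this

/-- The map `z ↦ s θ(z)` on the cylinder. -/
def map (h : ReturnSystem X T θ s y N) (z : seqCylinder y N) : X :=
  ⟨seqAppend s (θ.onSeq z.1.1), h.seqAppend_onSeq_mem z.2⟩

theorem map_mem (h : ReturnSystem X T θ s y N) (z : seqCylinder y N) :
    h.map z ∈ seqCylinder y N := by
  intro i hi
  conv_rhs => rw [← h.fixed]
  refine θ.agree_seqAppend_onSeq s z.2 (hi.trans_le ?_)
  have := θ.le_length_onWord_seqWord z.1.1 0 N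
  omega

theorem map_self (h : ReturnSystem X T θ s y N) : h.map ⟨y, self_mem_seqCylinder y N⟩ = y :=
  Subtype.ext h.fixed

theorem continuous_map (h : ReturnSystem X T θ s y N) : Continuous h.map := by
  refine Continuous.subtype_mk (continuous_pi fun i => ?_) _
  rcases lt_or_ge i s.length with hi | hi
  · simp only [seqAppend_apply_of_lt hi]
    exact continuous_const
  · obtain ⟨j, rfl⟩ := Nat.exists_eq_add_of_le hi
    simp only [seqAppend_apply_add]
    exact (continuous_apply j).comp (continuous_subtype_val.comp
      (h.recog.continuous_map.comp continuous_subtype_val))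

theorem iterate_length_map (h : ReturnSystem X T θ s y N) (z : seqCylinder y N) :
    T^[s.length] (h.map z) = h.recog.map z.1 := by
  refine Subtype.ext ?_
  rw [h.subshift.coe_iterate]
  exact seqDrop_length_seqAppend s _

theorem exists_of_iterate_map_eq (h : ReturnSystem X T θ s y N) {z v : seqCylinder y N} {n : ℕ}
    (e : T^[n] (h.map z) = h.map v) :
    ∃ p, n = (θ.onWord (seqWord z.1.1 0 p)).length ∧ T^[p] z.1 = v := by
  refine h.subshift.exists_cutting_of_iterate_mem h.recog ?_
  rw [← h.iterate_length_map z, ← h.iterate_length_map v, ← e, ← Function.iterate_add_apply,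
    ← Function.iterate_add_apply, Nat.add_comm]

theorem map_injective (h : ReturnSystem X T θ s y N) : Function.Injective h.map := by
  intro z v e
  refine Subtype.ext (h.recog.map_injective ?_)
  rw [← h.iterate_length_map z, ← h.iterate_length_map v, e]

theorem isClosedEmbedding_map (h : ReturnSystem X T θ s y N) :
    Topology.IsClosedEmbedding h.map := by
  have := h.compactSpace
  have : CompactSpace (seqCylinder y N) :=
    isCompact_iff_compactSpace.1 (isClopen_setOf_agree y.1 N).1.isCompact
  exact h.continuous_map.isClosedEmbedding h.map_injective

theorem isTowerBase_range (h : ReturnSystem X T θ s y N) : IsTowerBase T (Set.range h.map) := by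
  have := h.compactSpace
  refine h.subshift.isTowerBase ⟨h.isClosedEmbedding_map.isClosed_range, ?_⟩
    ⟨_, h.map_self⟩ h.branch
  have hO : IsOpen (h.recog.map '' seqCylinder y N) :=
    h.recog.isOpenEmbedding_map.isOpenMap _ (isClopen_setOf_agree y.1 N).2
  -- The image consists of the points that begin with `s` and continue with a point of `θ(U)`, where
  -- `U` is the cylinder. The sequence `s y` only serves to express the first condition.
  convert (hO.preimage (h.subshift.continuous.iterate s.length)).inter
    (isClopen_setOf_agree (X := X) (seqAppend s y.1) s.length).2 using 1
  ext x
  constructor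
  · rintro ⟨z, rfl⟩
    refine ⟨⟨z.1, z.2, (h.iterate_length_map z).symm⟩, fun i hi => ?_⟩
    rw [seqAppend_apply_of_lt hi]
    exact seqAppend_apply_of_lt hi _
  · rintro ⟨⟨z, hz, e⟩, hx⟩
    refine ⟨⟨z, hz⟩, Subtype.ext ?_⟩
    have e' := congrArg Subtype.val e
    rw [h.subshift.coe_iterate] at e'
    change seqAppend s (θ.onSeq z.1) = x.1
    rw [show θ.onSeq z.1 = seqDrop s.length x.1 from e']
    exact seqAppend_seqDrop_length fun i hi => by rw [hx i hi, seqAppend_apply_of_lt hi]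

theorem returnTime_spec (h : ReturnSystem X T θ s y N) (x : X) :
    0 < returnTime T (seqCylinder y N) x ∧
      T^[returnTime T (seqCylinder y N) x] x ∈ seqCylinder y N :=
  h.isTowerBase.returnTime_spec x

/-- The first return map to the cylinder. -/
noncomputable def next (h : ReturnSystem X T θ s y N) (z : seqCylinder y N) : seqCylinder y N :=
  ⟨_, (h.returnTime_spec z.1).2⟩

/-- The last letter of a return word precedes a point of the cylinder, so its image ends with `s`.
Moving this `s` across shows that the map carries first returns to the cylinder to returns to its
image. -/
theorem iterate_imageTime_map (h : ReturnSystem X T θ s y N) (z : seqCylinder y N) :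
    T^[h.imageTime z.1] (h.map z) = h.map (h.next z) := by
  obtain ⟨r, hr⟩ : ∃ r, returnTime T (seqCylinder y N) z.1 = r + 1 :=
    ⟨_, (Nat.sub_add_cancel (h.returnTime_spec z.1).1).symm⟩
  have hw : returnWord T (seqCylinder y N) z.1 = seqWord z.1.1 0 r ++ [z.1.1 r] := by
    rw [returnWord, hr, seqWord_add, Nat.zero_add, seqWord_one]
  obtain ⟨q, hq⟩ := h.suffix (T^[r] z.1) (by
    rw [← Function.iterate_succ_apply' (f := T), Nat.succ_eq_add_one, ← hr]
    exact (h.returnTime_spec z.1).2)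
  rw [h.subshift.iterate_apply, Nat.add_zero] at hq
  have hv : θ.onWord (returnWord T (seqCylinder y N) z.1) =
      (θ.onWord (seqWord z.1.1 0 r) ++ q) ++ s := by
    rw [hw, θ.onWord_append, θ.onWord_singleton, ← hq, List.append_assoc]
  refine Subtype.ext ?_
  rw [h.subshift.coe_iterate]
  change seqDrop _ (seqAppend s (θ.onSeq z.1.1)) = seqAppend s (θ.onSeq (h.next z).1.1)
  have hn : (h.next z).1.1 = seqDrop (returnTime T (seqCylinder y N) z.1) z.1.1 :=
    h.subshift.coe_iterate _ _
  rw [θ.onSeq_eq_seqAppend z.1.1 (returnTime T (seqCylinder y N) z.1), ← hn, ← returnWord, hv,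
    seqAppend_append, ← seqAppend_append, imageTime, hv]
  have : ((θ.onWord (seqWord z.1.1 0 r) ++ q) ++ s).length =
      (s ++ (θ.onWord (seqWord z.1.1 0 r) ++ q)).length := by
    simp only [List.length_append]; omega
  rw [this, seqDrop_length_seqAppend]

theorem imageTime_pos (h : ReturnSystem X T θ s y N) (z : X) : 0 < h.imageTime z := by
  have h1 := θ.length_le_onWord (returnWord T (seqCylinder y N) z)
  have h2 := (h.returnTime_spec z).1
  rw [length_returnWord] at h1
  exact h2.trans_le h1

theorem returnTime_range_map (h : ReturnSystem X T θ s y N) (z : seqCylinder y N) :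
    returnTime T (Set.range h.map) (h.map z) = h.imageTime z.1 := by
  refine returnTime_eq (h.imageTime_pos _) ⟨_, (h.iterate_imageTime_map z).symm⟩ ?_
  rintro i h0 hi ⟨v, hv⟩
  obtain ⟨p, rfl, hp⟩ := h.exists_of_iterate_map_eq hv.symm
  have hp0 : 0 < p := by
    by_contra hp
    obtain rfl : p = 0 := by omega
    simp at h0
  have h1 : returnTime T (seqCylinder y N) z.1 ≤ p :=
    returnTime_le hp0 (by rw [hp]; exact v.2)
  have h2 := θ.length_onWord_seqWord_mono z.1.1 h1
  rw [imageTime, returnWord] at hi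
  omega

theorem returnTime_iterate_map_le (h : ReturnSystem X T θ s y N) {z : seqCylinder y N} {j : ℕ}
    (hj : j < h.imageTime z.1) :
    returnTime T (seqCylinder y N) (T^[j] (h.map z)) ≤ h.imageTime z.1 - j := by
  refine returnTime_le (by omega) ?_
  rw [← Function.iterate_add_apply, Nat.sub_add_cancel hj.le, h.iterate_imageTime_map]
  exact h.map_mem _

omit [Finite A] [DiscreteTopology A] in
theorem length_onWord_add (h : ReturnSystem X T θ s y N) (x : ℕ → A) (m : ℕ) {p : ℕ}
    (hp : 1 ≤ p) : p + 1 ≤ (θ.onWord (seqWord x m p)).length := by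
  obtain ⟨q, rfl⟩ := Nat.exists_eq_add_of_le hp
  rw [seqWord_add, seqWord_one, θ.onWord_append, θ.onWord_singleton, List.length_append]
  have h1 := θ.le_length_onWord_seqWord x (m + 1) q
  have h2 := h.long (x m) y
  omega

/-- If two points agree `p ≥ 1` letters beyond their common return word, then their images agree
`p + 1` letters beyond its image. -/
theorem agree_map (h : ReturnSystem X T θ s y N) {z z' : seqCylinder y N} {p : ℕ} (hp : 1 ≤ p)
    (hz : ∀ i < returnTime T (seqCylinder y N) z.1 + p, z.1.1 i = z'.1.1 i) :
    ∀ i < h.imageTime z.1 + (p + 1), (h.map z).1 i = (h.map z').1 i := by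
  intro i hi
  refine θ.agree_seqAppend_onSeq s hz (hi.trans_le ?_)
  rw [seqWord_add, θ.onWord_append, List.length_append]
  have := h.length_onWord_add z.1.1 (0 + returnTime T (seqCylinder y N) z.1) hp
  rw [imageTime, returnWord]
  omega

theorem agree_of_returnWord_eq (h : ReturnSystem X T θ s y N) {z z' : X}
    (e : returnWord T (seqCylinder y N) z = returnWord T (seqCylinder y N) z') :
    ∀ i < returnTime T (seqCylinder y N) z + N, z.1 i = z'.1 i :=
  h.subshift.agree_of_returnWord_eq e (h.returnTime_spec z).2 (h.returnTime_spec z').2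

omit [Finite A] [DiscreteTopology A] in
theorem imageTime_congr (h : ReturnSystem X T θ s y N) {z z' : X}
    (e : returnWord T (seqCylinder y N) z = returnWord T (seqCylinder y N) z') :
    h.imageTime z = h.imageTime z' := by
  rw [imageTime, imageTime, e]

/-- Agreement beyond the image of the return word fixes every return word that starts inside it, so
edges and sources depend on the return word alone and not on the point. -/
theorem iterate_map_congr (h : ReturnSystem X T θ s y N) {z z' : seqCylinder y N}
    (e : returnWord T (seqCylinder y N) z.1 = returnWord T (seqCylinder y N) z'.1) {j : ℕ}
    (hj : j < h.imageTime z.1) (hmem : T^[j] (h.map z) ∈ seqCylinder y N) :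
    T^[j] (h.map z') ∈ seqCylinder y N ∧
      returnWord T (seqCylinder y N) (T^[j] (h.map z')) =
        returnWord T (seqCylinder y N) (T^[j] (h.map z)) := by
  have hag := h.agree_map h.pos (h.agree_of_returnWord_eq e)
  refine ⟨h.subshift.iterate_mem_seqCylinder (fun i hi => hag i (by omega)) hmem,
    h.subshift.returnWord_congr (n := h.imageTime z.1 - j) (fun i hi => ?_)
      (h.returnTime_spec _) (h.returnTime_iterate_map_le hj)⟩
  rw [h.subshift.iterate_apply, h.subshift.iterate_apply, hag _ (by omega)]

/-- The images of all points of the cylinder have the same return word. -/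
theorem returnWord_map (h : ReturnSystem X T θ s y N) (z : seqCylinder y N) :
    returnWord T (seqCylinder y N) (h.map z) = returnWord T (seqCylinder y N) y := by
  refine h.subshift.returnWord_congr (n := returnTime T (seqCylinder y N) y) (fun i hi => ?_)
    (h.returnTime_spec _) le_rfl
  conv_lhs => rw [← h.fixed]
  refine θ.agree_seqAppend_onSeq (p := N) s (fun i hi => (z.2 i hi).symm) (hi.trans_le ?_)
  have h1 := θ.length_onWord_seqWord_mono y.1 h.pos
  have h2 := h.long (y.1 0) y
  rw [seqWord_one, θ.onWord_singleton] at h1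
  omega

end ReturnSystem

/-! ### The stationary diagram of return words. -/

namespace ReturnSystem

variable {A : Type u} [Finite A] [TopologicalSpace A] [DiscreteTopology A] {X : Set (ℕ → A)}
  {T : X → X} {θ : Substitution A} {s : List A} {y : X} {N : ℕ}

/-- The set of return words. -/
def ReturnWords (_ : ReturnSystem X T θ s y N) : Type u :=
  Set.range fun z : seqCylinder y N => returnWord T (seqCylinder y N) z.1

instance (h : ReturnSystem X T θ s y N) : TopologicalSpace h.ReturnWords := ⊥

instance (h : ReturnSystem X T θ s y N) : DiscreteTopology h.ReturnWords := ⟨rfl⟩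

theorem finite_returnWords (h : ReturnSystem X T θ s y N) : Finite h.ReturnWords := by
  obtain ⟨M, hM⟩ := h.isTowerBase.returnTime_bounded
  refine ((List.finite_length_le A M).subset ?_).to_subtype
  rintro _ ⟨z, rfl⟩
  change (returnWord T (seqCylinder y N) z.1).length ≤ M
  rw [length_returnWord]
  exact hM z.1

/-- The return word of a point of the cylinder. -/
noncomputable def toWord (h : ReturnSystem X T θ s y N) (z : seqCylinder y N) : h.ReturnWords :=
  ⟨returnWord T (seqCylinder y N) z.1, z, rfl⟩

omit [Finite A] [DiscreteTopology A] in
theorem toWord_surjective (h : ReturnSystem X T θ s y N) : Function.Surjective h.toWord := by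
  rintro ⟨_, z, rfl⟩
  exact ⟨z, rfl⟩

omit [Finite A] [DiscreteTopology A] in
theorem toWord_eq_iff (h : ReturnSystem X T θ s y N) {z z' : seqCylinder y N} :
    h.toWord z = h.toWord z' ↔
      returnWord T (seqCylinder y N) z.1 = returnWord T (seqCylinder y N) z'.1 :=
  Subtype.ext_iff

theorem continuous_toWord (h : ReturnSystem X T θ s y N) : Continuous h.toWord := by
  refine continuous_discrete_rng.2 fun r => ?_
  have : IsOpen {x : X | returnWord T (seqCylinder y N) x = r.1} := by
    refine isOpen_iff_agree.2 fun x hx =>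
      ⟨returnTime T (seqCylinder y N) x + N, fun x' hx' => ?_⟩
    exact (h.subshift.returnWord_congr (fun i hi => (hx' i hi).symm) (h.returnTime_spec x)
      le_rfl).trans hx
  convert this.preimage continuous_subtype_val using 1
  ext z
  exact Subtype.ext_iff

/-- The positions in a return word. -/
def wordPositions (h : ReturnSystem X T θ s y N) (r : h.ReturnWords) : Set ℕ :=
  {j | j < r.1.length}

/-- The positions in the image of a return word at which a return word starts. -/
def imagePositions (h : ReturnSystem X T θ s y N) (r : h.ReturnWords) : Set ℕ :=
  {j | ∃ z, h.toWord z = r ∧ j < h.imageTime z.1 ∧ T^[j] (h.map z) ∈ seqCylinder y N}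

theorem mem_imagePositions_iff (h : ReturnSystem X T θ s y N) {z : seqCylinder y N} {j : ℕ} :
    j ∈ h.imagePositions (h.toWord z) ↔
      j < h.imageTime z.1 ∧ T^[j] (h.map z) ∈ seqCylinder y N := by
  constructor
  · rintro ⟨z', e, hj, hm⟩
    rw [toWord_eq_iff] at e
    exact ⟨h.imageTime_congr e ▸ hj, (h.iterate_map_congr e hj hm).1⟩
  · exact fun hj => ⟨z, rfl, hj⟩

/-- The return word that starts at a position in the image of a return word. -/
noncomputable def source (h : ReturnSystem X T θ s y N)
    (e : Σ r, h.imagePositions r) : h.ReturnWords :=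
  h.toWord ⟨_, e.2.2.choose_spec.2.2⟩

theorem source_mk (h : ReturnSystem X T θ s y N) {z : seqCylinder y N} {j : ℕ}
    (hj : j ∈ h.imagePositions (h.toWord z)) {x : seqCylinder y N} (hx : T^[j] (h.map z) = x.1) :
    h.source ⟨h.toWord z, j, hj⟩ = h.toWord x := by
  rw [source, toWord_eq_iff]
  obtain ⟨e, -, -⟩ := hj.choose_spec
  obtain ⟨h1, h2⟩ := h.mem_imagePositions_iff.1 hj
  have := (h.iterate_map_congr (h.toWord_eq_iff.1 e.symm) h1 h2).2
  rw [hx] at this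
  exact this

/-- The last visit to the cylinder. -/
noncomputable def base₀ (h : ReturnSystem X T θ s y N) (x : X) : seqCylinder y N :=
  ⟨h.isTowerBase.base x, (h.isTowerBase.inTower x).mem⟩

/-- The image under `z ↦ s θ(z)` of this point is the last visit to the image of the cylinder. -/
noncomputable def base (h : ReturnSystem X T θ s y N) (x : seqCylinder y N) : seqCylinder y N :=
  (h.isTowerBase_range.inTower x.1).mem.choose

theorem map_base (h : ReturnSystem X T θ s y N) (x : seqCylinder y N) :
    h.map (h.base x) = h.isTowerBase_range.base x.1 :=
  (h.isTowerBase_range.inTower x.1).mem.choose_spec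

theorem continuous_base₀ (h : ReturnSystem X T θ s y N) : Continuous h.base₀ := by
  have := h.compactSpace
  exact h.isTowerBase.continuous_base.subtype_mk _

theorem continuous_base (h : ReturnSystem X T θ s y N) : Continuous h.base := by
  have := h.compactSpace
  refine h.isClosedEmbedding_map.isEmbedding.continuous_iff.2 ?_
  convert h.isTowerBase_range.continuous_base.comp continuous_subtype_val using 1
  exact funext h.map_base

theorem isPositioned₀ (h : ReturnSystem X T θ s y N) :
    IsPositioned T h.next h.base₀ h.isTowerBase.height h.toWord h.wordPositions where
  mem x := by
    change _ < (returnWord T (seqCylinder y N) _).length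
    rw [length_returnWord]
    exact h.isTowerBase.height_lt_returnTime x
  exists_eq z j hj := by
    have hj : j < (returnWord T (seqCylinder y N) z.1).length := hj
    rw [length_returnWord] at hj
    have ht : InTower T (seqCylinder y N) z.1 (T^[j] z.1) j :=
      ⟨z.2, rfl, fun i h0 hi => IsTowerBase.notMem_of_lt_returnTime h0 (by omega)⟩
    exact ⟨T^[j] z.1, Subtype.ext (h.isTowerBase.base_eq ht), h.isTowerBase.height_eq ht⟩
  step x := by
    by_cases hx : T x ∈ seqCylinder y N
    · obtain ⟨h1, h2, h3, h4⟩ := h.isTowerBase.step_of_mem (x := x) (r := 1) one_pos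
        (fun i h0 h1 => by omega) hx
      refine Or.inl ⟨Subtype.ext (h1.trans h4.symm), h2, fun j hj => ?_⟩
      have hj : j < (returnWord T (seqCylinder y N) (h.isTowerBase.base x)).length := hj
      rw [length_returnWord, h3] at hj
      omega
    · obtain ⟨h1, h2⟩ := h.isTowerBase.step_of_notMem (x := x) (r := 1) (fun i h0 h1 => by
        obtain rfl : i = 1 := by omega
        exact hx)
      have h2 : h.isTowerBase.height (T x) = h.isTowerBase.height x + 1 := h2
      exact Or.inr ⟨Subtype.ext h1, by omega, fun j _ hj => by omega⟩

theorem height_lt_imageTime (h : ReturnSystem X T θ s y N) (x : seqCylinder y N) :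
    h.isTowerBase_range.height x.1 < h.imageTime (h.base x).1 := by
  rw [← h.returnTime_range_map, h.map_base]
  exact h.isTowerBase_range.height_lt_returnTime x.1

theorem iterate_height (h : ReturnSystem X T θ s y N) (x : seqCylinder y N) :
    T^[h.isTowerBase_range.height x.1] (h.map (h.base x)) = x.1 := by
  rw [h.map_base, (h.isTowerBase_range.inTower x.1).iterate_eq]

/-- The image of the cylinder lies inside the cylinder, so nothing is missed by moving between
consecutive visits to the cylinder, and the next visit is the next position. -/
theorem isPositioned (h : ReturnSystem X T θ s y N) :
    IsPositioned h.next h.next h.base (fun x => h.isTowerBase_range.height x.1) h.toWord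
      h.imagePositions where
  mem x := by
    refine h.mem_imagePositions_iff.2 ⟨h.height_lt_imageTime x, ?_⟩
    rw [h.iterate_height]
    exact x.2
  exists_eq z j hj := by
    obtain ⟨h1, h2⟩ := h.mem_imagePositions_iff.1 hj
    have ht : InTower T (Set.range h.map) (h.map z) (T^[j] (h.map z)) j := by
      refine ⟨⟨z, rfl⟩, rfl, fun i h0 hi => IsTowerBase.notMem_of_lt_returnTime h0 ?_⟩
      rw [h.returnTime_range_map]
      omega
    refine ⟨⟨_, h2⟩, h.map_injective ?_, h.isTowerBase_range.height_eq ht⟩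
    rw [h.map_base, h.isTowerBase_range.base_eq ht]
  step x := by
    have hno : ∀ i, 0 < i → i < returnTime T (seqCylinder y N) x.1 →
        T^[i] x.1 ∉ seqCylinder y N := fun i => IsTowerBase.notMem_of_lt_returnTime
    have hnoW : ∀ i, 0 < i → i < returnTime T (seqCylinder y N) x.1 →
        T^[i] x.1 ∉ Set.range h.map := by
      rintro i h0 hi ⟨z, hz⟩
      exact hno i h0 hi (hz ▸ h.map_mem z)
    have hpos := (h.returnTime_spec x.1).1
    have hnext : ∀ j ∈ h.imagePositions (h.toWord (h.base x)),
        h.isTowerBase_range.height x.1 < j →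
        h.isTowerBase_range.height x.1 + returnTime T (seqCylinder y N) x.1 ≤ j := by
      intro j hj hlt
      obtain ⟨k, rfl⟩ := Nat.exists_eq_add_of_lt hlt
      have hm := (h.mem_imagePositions_iff.1 hj).2
      rw [Nat.add_assoc, Nat.add_comm, Function.iterate_add_apply, h.iterate_height] at hm
      by_contra hcon
      exact hno (k + 1) (by omega) (by omega) hm
    by_cases hx : T^[returnTime T (seqCylinder y N) x.1] x.1 ∈ Set.range h.map
    · obtain ⟨h1, h2, h3, h4⟩ := h.isTowerBase_range.step_of_mem hpos hnoW hx
      rw [← h.map_base, h.returnTime_range_map] at h3 h4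
      rw [h.iterate_imageTime_map] at h4
      refine Or.inl ⟨h.map_injective ?_, h2, fun j hj => ?_⟩
      · rw [h.map_base, h4]
        exact h1
      · by_contra! hcon
        have := hnext j hj hcon
        have := (h.mem_imagePositions_iff.1 hj).1
        omega
    · obtain ⟨h1, h2⟩ := h.isTowerBase_range.step_of_notMem
        (r := returnTime T (seqCylinder y N) x.1) (fun i h0 hi => by
          rcases hi.lt_or_eq with hi | rfl
          · exact hnoW i h0 hi
          · exact hx)
      have h2 : h.isTowerBase_range.height (h.next x).1 =
        h.isTowerBase_range.height x.1 + returnTime T (seqCylinder y N) x.1 := h2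
      refine Or.inr ⟨h.map_injective ?_, by omega, fun j hj hlt => ?_⟩
      · rw [h.map_base, h.map_base]
        exact h1
      · rw [h2]
        exact hnext j hj hlt

theorem source_edge (h : ReturnSystem X T θ s y N) (x : seqCylinder y N) :
    h.source (h.isPositioned.edge x) = h.toWord x :=
  h.source_mk _ (h.iterate_height x)

theorem source_surjective (h : ReturnSystem X T θ s y N) : Function.Surjective h.source := by
  intro r
  obtain ⟨z, rfl⟩ := h.toWord_surjective r
  exact ⟨_, h.source_edge z⟩

theorem zero_mem_imagePositions (h : ReturnSystem X T θ s y N) (z : seqCylinder y N) :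
    0 ∈ h.imagePositions (h.toWord z) :=
  h.mem_imagePositions_iff.2 ⟨h.imageTime_pos _, h.map_mem z⟩

/-- The diagram of the return words. -/
noncomputable def diagram (h : ReturnSystem X T θ s y N) : OrderedBratteliDiagram.{u} :=
  haveI := h.finite_returnWords
  haveI : Nonempty h.ReturnWords := ⟨h.toWord ⟨y, self_mem_seqCylinder y N⟩⟩
  .ofPositions h.wordPositions h.imagePositions h.source
    (fun r => ⟨Set.finite_Iio _, 0, by
      obtain ⟨z, rfl⟩ := h.toWord_surjective r
      change 0 < (returnWord T (seqCylinder y N) z.1).length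
      rw [length_returnWord]
      exact (h.returnTime_spec _).1⟩)
    (fun r => by
      obtain ⟨z, rfl⟩ := h.toWord_surjective r
      exact ⟨(Set.finite_Iio (h.imageTime z.1)).subset
        fun j hj => (h.mem_imagePositions_iff.1 hj).1, 0, h.zero_mem_imagePositions z⟩)
    h.source_surjective

theorem isStationary_diagram (h : ReturnSystem X T θ s y N) : h.diagram.IsStationary :=
  ⟨fun _ => Equiv.refl h.ReturnWords, fun _ => OrderIso.refl (Σ r, h.imagePositions r),
    fun _ _ => ⟨rfl, rfl⟩⟩

/-- The return word of the branch point. -/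
noncomputable def rootWord (h : ReturnSystem X T θ s y N) : h.ReturnWords :=
  h.toWord ⟨y, self_mem_seqCylinder y N⟩

theorem exists_iterate_eq_base (h : ReturnSystem X T θ s y N) (t : ℕ) :
    ∃ t', h.isTowerBase_range.base (T^[t] y) = T^[t'] y ∧ t' ≤ t := by
  have hy : y ∈ Set.range h.map := ⟨_, h.map_self⟩
  induction t with
  | zero => exact ⟨0, h.isTowerBase_range.base_eq (.of_mem hy), le_rfl⟩
  | succ t ih =>
    obtain ⟨t', ht', hle⟩ := ih
    rw [Function.iterate_succ_apply']
    by_cases hx : T (T^[t] y) ∈ Set.range h.map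
    · exact ⟨t + 1, by rw [h.isTowerBase_range.base_eq (.of_mem hx), Function.iterate_succ_apply'],
        le_rfl⟩
    · refine ⟨t', ?_, by omega⟩
      rw [← ht']
      exact (h.isTowerBase_range.step_of_notMem (r := 1) fun i h0 h1 => by
        obtain rfl : i = 1 := by omega
        exact hx).1

/-- Because `y` is fixed, base points on its orbit stay on its orbit. Since images are strictly
longer, the time decreases, which drives the induction that leads every vertex to the root word. -/
theorem exists_iterate_eq_base_of_pos (h : ReturnSystem X T θ s y N) {t : ℕ} (ht : 0 < t)
    {x : seqCylinder y N} (hx : T^[t] y = x.1) : ∃ t' < t, T^[t'] y = (h.base x).1 := by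
  obtain ⟨t', ht', hle⟩ := h.exists_iterate_eq_base t
  rw [hx, ← h.map_base] at ht'
  obtain ⟨p, hp, hpx⟩ := h.exists_of_iterate_map_eq
    (z := ⟨y, self_mem_seqCylinder y N⟩) (v := h.base x) (n := t') (by rw [h.map_self, ht'])
  refine ⟨p, ?_, hpx⟩
  rcases Nat.eq_zero_or_pos p with rfl | hp0
  · exact ht
  · have := h.length_onWord_add y.1 0 (show 1 ≤ p from hp0)
    simp only at hp
    omega

theorem reaches_of_iterate (h : ReturnSystem X T θ s y N) (t : ℕ) (x : seqCylinder y N)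
    (hx : T^[t] y = x.1) (n : ℕ) :
    ∃ m, n ≤ m ∧ h.diagram.Reaches (m := n + 1) (h.toWord x) (m + 1) h.rootWord := by
  induction t using Nat.strong_induction_on generalizing x n with
  | _ t ih =>
    rcases Nat.eq_zero_or_pos t with rfl | ht
    · obtain rfl : ⟨y, self_mem_seqCylinder y N⟩ = x := Subtype.ext hx
      exact ⟨n, le_rfl, .refl⟩
    · obtain ⟨t', hlt, ht'⟩ := h.exists_iterate_eq_base_of_pos ht hx
      obtain ⟨m, hm, hr⟩ := ih t' hlt (h.base x) ht' (n + 1)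
      refine ⟨m, by omega, ?_⟩
      have hstep : h.diagram.Reaches (m := n + 1) (h.toWord x) (n + 2) (h.toWord (h.base x)) := by
        refine OrderedBratteliDiagram.Reaches.step (B := h.diagram) (n := n + 1)
          (h.isPositioned.edge x) ?_
        have e : h.diagram.source (n := n + 1) (h.isPositioned.edge x) = h.toWord x :=
          h.source_edge x
        rw [e]
        exact .refl
      exact hstep.trans hr

/-- The minimal position is `0`, where every image starts with the return word of `y`. For
simplicity, minimality realizes every return word along the orbit of `y`. -/
theorem isSemiProper_diagram (h : ReturnSystem X T θ s y N) : h.diagram.IsSemiProper := by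
  have hmin := h.subshift.minimal
  refine OrderedBratteliDiagram.isSemiProper_of_reaches
    (v₀ := fun n => match n with
      | 0 => (PUnit.unit : OrderedBratteliDiagram.Level PUnit h.ReturnWords 0)
      | n + 1 => (h.rootWord : OrderedBratteliDiagram.Level PUnit h.ReturnWords (n + 1))) ?_ ?_
  · rintro (_ | n) e he
    · rfl
    · obtain ⟨r, j⟩ := (e : Σ r, h.imagePositions r)
      obtain ⟨z, rfl⟩ := h.toWord_surjective r
      have hj : IsMin j := Sigma.isMin_mk_iff (α := fun r => h.imagePositions r) |>.1 he
      have h0 : (⟨0, h.zero_mem_imagePositions z⟩ : h.imagePositions (h.toWord z)) ≤ j :=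
        Nat.zero_le _
      obtain rfl : j = ⟨0, h.zero_mem_imagePositions z⟩ := le_antisymm (hj h0) h0
      exact (h.source_mk (h.zero_mem_imagePositions z) (x := ⟨h.map z, h.map_mem z⟩) rfl).trans
        (h.toWord_eq_iff.2 (h.returnWord_map z))
  · rintro (_ | n) a
    · exact ⟨0, le_rfl, .refl⟩
    · obtain ⟨z, hz⟩ := h.toWord_surjective a
      subst hz
      -- Agreement on the return word and `N` further letters shows that the orbit point has the
      -- same return word as `z`.
      obtain ⟨x, hx, t, rfl⟩ := (hmin y).inter_open_nonempty _
        (isOpen_setOf_agree z.1 (returnTime T (seqCylinder y N) z.1 + N)) ⟨z.1, fun _ _ => rfl⟩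
      have hm : T^[t] y ∈ seqCylinder y N := fun i hi =>
        (hx i (by omega)).trans (z.2 i hi)
      obtain ⟨m, hm', hr⟩ := h.reaches_of_iterate t ⟨_, hm⟩ rfl n
      have e : h.toWord ⟨_, hm⟩ = h.toWord z :=
        h.toWord_eq_iff.2 (h.subshift.returnWord_congr (fun i hi => (hx i hi).symm)
          (h.returnTime_spec _) le_rfl)
      rw [e] at hr
      exact ⟨m + 1, by omega, hr⟩

/-- Equal edges put both points at the same height above base points with equal return words. Each
passage through the map adds a letter of agreement beyond the return word. -/
theorem agree_of_forall_edge_eq (h : ReturnSystem X T θ s y N) (M : ℕ) :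
    ∀ x x' : seqCylinder y N, h.toWord x = h.toWord x' →
      (∀ n, h.isPositioned.edge (h.base^[n] x) = h.isPositioned.edge (h.base^[n] x')) →
      ∀ i < returnTime T (seqCylinder y N) x.1 + (N + M), x.1.1 i = x'.1.1 i := by
  induction M with
  | zero => exact fun x x' e _ => h.agree_of_returnWord_eq (h.toWord_eq_iff.1 e)
  | succ M ih =>
    intro x x' _ he i hi
    have e0 : h.toWord (h.base x) = h.toWord (h.base x') := congrArg (fun e => e.1) (he 0)
    have ek : h.isTowerBase_range.height x.1 = h.isTowerBase_range.height x'.1 :=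
      congrArg (fun e => e.2.1) (he 0)
    have hb := ih (h.base x) (h.base x') e0 fun n => by
      simpa only [Function.iterate_succ_apply] using he (n + 1)
    have hag := h.agree_map (by have := h.pos; omega) hb
    have hle := h.returnTime_iterate_map_le (h.height_lt_imageTime x)
    rw [h.iterate_height] at hle
    have hlt := h.height_lt_imageTime x
    rw [← h.iterate_height x, ← h.iterate_height x', h.subshift.iterate_apply,
      h.subshift.iterate_apply, ← ek]
    exact hag _ (by omega)

/-- The towers over the iterated images of the cylinder. -/
noncomputable def towerSequence (h : ReturnSystem X T θ s y N) :
    h.diagram.TowerSequence (OrderedBratteliDiagram.Level X (seqCylinder y N)) where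
  T n := match n with
    | 0 => T
    | _ + 1 => h.next
  base n := match n with
    | 0 => h.base₀
    | _ + 1 => h.base
  edge n := match n with
    | 0 => h.isPositioned₀.edge
    | _ + 1 => h.isPositioned.edge
  continuous_base n := match n with
    | 0 => h.continuous_base₀
    | _ + 1 => h.continuous_base
  continuous_edge n := by
    have := h.compactSpace
    exact match n with
    | 0 =>
      letI : TopologicalSpace (Σ r, h.wordPositions r) := ⊥
      haveI : DiscreteTopology (Σ r, h.wordPositions r) := ⟨rfl⟩
      h.isPositioned₀.continuous_edge (h.continuous_toWord.comp h.continuous_base₀)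
        h.isTowerBase.continuous_height
    | _ + 1 =>
      letI : TopologicalSpace (Σ r, h.imagePositions r) := ⊥
      haveI : DiscreteTopology (Σ r, h.imagePositions r) := ⟨rfl⟩
      h.isPositioned.continuous_edge (h.continuous_toWord.comp h.continuous_base)
        (h.isTowerBase_range.continuous_height.comp continuous_subtype_val)
  range_edge n x := match n with
    | 0 => (h.source_edge (h.base₀ x)).symm
    | _ + 1 => (h.source_edge (h.base x)).symm
  exists_source_eq n := match n with
    | 0 => fun _ => ⟨y, rfl⟩
    | _ + 1 => fun v => by
      obtain ⟨z, hz⟩ := h.toWord_surjective v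
      exact ⟨z, (h.source_edge z).trans hz⟩
  exists_edge_eq n := match n with
    | 0 => fun z e he => h.isPositioned₀.exists_edge_eq z e (he.trans (h.source_edge z))
    | _ + 1 => fun z e he => h.isPositioned.exists_edge_eq z e (he.trans (h.source_edge z))
  step_of_isMax n := match n with
    | 0 => fun _ hx => h.isPositioned₀.step_of_isMax hx
    | _ + 1 => fun _ hx => h.isPositioned.step_of_isMax hx
  step_of_not_isMax n := match n with
    | 0 => fun _ hx => h.isPositioned₀.step_of_not_isMax hx
    | _ + 1 => fun _ hx => h.isPositioned.step_of_not_isMax hx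

theorem path_injective (h : ReturnSystem X T θ s y N) :
    Function.Injective h.towerSequence.path := by
  intro x x' e
  have hdesc : ∀ n (x : X), h.towerSequence.descend (n + 1) x = h.base^[n] (h.base₀ x) := by
    intro n x
    induction n with
    | zero => rfl
    | succ n ih => rw [Function.iterate_succ_apply', ← ih]; rfl
  have he : ∀ n, h.isPositioned.edge (h.base^[n] (h.base₀ x)) =
      h.isPositioned.edge (h.base^[n] (h.base₀ x')) := by
    intro n
    have e1 : h.isPositioned.edge (h.towerSequence.descend (n + 1) x) =
        h.isPositioned.edge (h.towerSequence.descend (n + 1) x') :=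
      congrFun (congrArg Subtype.val e) (n + 1)
    have ed := fun x => congrArg h.isPositioned.edge (hdesc n x)
    exact (ed x).symm.trans (e1.trans (ed x'))
  have e0 : h.isPositioned₀.edge x = h.isPositioned₀.edge x' :=
    congrFun (congrArg Subtype.val e) 0
  have hw : h.toWord (h.base₀ x) = h.toWord (h.base₀ x') := congrArg (fun e => e.1) e0
  have hk : h.isTowerBase.height x = h.isTowerBase.height x' := congrArg (fun e => e.2.1) e0
  have hb : h.isTowerBase.base x = h.isTowerBase.base x' :=
    Subtype.ext (funext fun i =>
      h.agree_of_forall_edge_eq (i + 1) (h.base₀ x) (h.base₀ x') hw he i (by omega))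
  rw [← (h.isTowerBase.inTower x).iterate_eq, ← (h.isTowerBase.inTower x').iterate_eq, hb, hk]

theorem isSemiProperModel_diagram (h : ReturnSystem X T θ s y N) :
    h.diagram.IsSemiProperModel T := by
  have : CompactSpace (OrderedBratteliDiagram.Level X (seqCylinder y N) 0) := h.compactSpace
  exact h.towerSequence.isSemiProperModel h.isSemiProper_diagram h.path_injective

end ReturnSystem

/-! ### Existence of the stationary model. -/

namespace Substitution

theorem exists_isSemiProperModel {A : Type u} [Finite A] [TopologicalSpace A]
    [DiscreteTopology A] {τ : Substitution A} {u : ℕ → A} (hproper : τ.IsLeftProper)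
    (hreas : τ.IsReasonable u) (hquasi : IsQuasiInvertible τ.shift) :
    ∃ B : OrderedBratteliDiagram.{u}, B.IsStationary ∧ B.IsSemiProperModel τ.shift := by
  have hX := isMinimalSubshift hreas.minimal
  have := compactSpace_of_isClosed hX.isClosed
  obtain ⟨l, hl⟩ := hproper
  obtain ⟨y, hy, -⟩ := id hquasi
  have hbr := hquasi.eq_of_isBranchPoint hy
  -- `N` and the bound `M` on return times depend on `y` only. They are fixed before the power `k`,
  -- on which `s` depends.
  obtain ⟨N, hN1, hN⟩ := hX.exists_agree_preimage y
  obtain ⟨M, hM⟩ := (hX.isTowerBase (isClopen_setOf_agree y.1 N) (self_mem_seqCylinder y N)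
    hbr).returnTime_bounded
  obtain ⟨k, hk⟩ := hreas.generating.exists_le_length_iter hl (M + N + 2)
  have hθ := hreas.isRecognizableOn.pow k
  obtain ⟨s, hs, hsuf⟩ := hX.exists_suffix_of_isBranchPoint hθ hy hbr
  have h : ReturnSystem τ.subshift τ.shift (τ.pow k) s y N :=
    { subshift := hX
      recog := hθ
      branch := hbr
      fixed := hs
      pos := hN1
      suffix := fun x hx => by
        obtain ⟨x', h1, h2⟩ := hN x hx
        exact h2 ▸ hsuf x' h1
      long := fun a z => by
        have h1 := hM z
        have h2 : M + N + 2 ≤ ((τ.pow k).toFun a).length := hk k le_rfl a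
        have h3 : returnTime τ.shift (seqCylinder y N) z ≤ M := h1
        omega }
  exact ⟨h.diagram, h.isStationary_diagram, h.isSemiProperModel_diagram⟩

end Substitution

theorem mainTheorem2 {A : Type u} [Finite A] [Nonempty A]
    [TopologicalSpace A] [DiscreteTopology A] (τ : Substitution A) (u : ℕ → A)
    (hproper : τ.IsLeftProper) (hreas : τ.IsReasonable u)
    (hquasi : IsQuasiInvertible τ.shift) :
    -- a stationary semi-proper adic model exists
    (∃ B : OrderedBratteliDiagram.{u}, B.IsStationary ∧ B.IsSemiProperModel τ.shift) ∧
    -- if the branch point is `u`, the diagram of `τ` is one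
    (∀ y : τ.subshift, IsBranchPoint τ.shift y → y.1 = u →
      ∃ h : τ.IsPrimitive,
        (τ.diagram h).IsStationary ∧ (τ.diagram h).IsSemiProperModel τ.shift) ∧
    -- whenever the modified substitution of a power of `τ` is defined, it has the same
    -- subshift, it fixes the branch point, and its diagram is one
    (∀ (m : ℕ) (s : List A) (τ' : Substitution A), 1 ≤ m → s ≠ [] →
      (τ.pow m).HasStableEnding s → (τ.pow m).IsRotationBy τ' s →
      τ'.subshift = τ.subshift ∧ τ'.IsLeftProper ∧
      (∀ y : τ.subshift, IsBranchPoint τ.shift y → y.1 ≠ u ∧ τ'.IsReasonable y.1) ∧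
      ∃ h : τ'.IsPrimitive,
        (τ'.diagram h).IsStationary ∧ (τ'.diagram h).IsSemiProperModel τ.shift) := by
  refine ⟨Substitution.exists_isSemiProperModel hproper hreas hquasi,
    fun y hy hyu => Substitution.isSemiProperModel_of_branchPoint_eq hproper hreas hquasi hy hyu,
    fun m s τ' hm hs hst hrot =>
      Substitution.isSemiProperModel_of_hasStableEnding hproper hreas hquasi hm hs hst hrot⟩
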